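/- Let $\mathbb X$ be a complex Banach space, $A$ a closed (possibly unbounded) linear operator in $\mathbb X$, $0<\alpha\le 1$, and $n\ge 0$ an integer. Put $g_\alpha(t)=t^{\alpha-1}/\Gamma(\alpha)$ and $J^\alpha u(t)=\int_0^t g_\alpha(t-s)u(s)\,ds$. A mild solution of $D^\alpha_C u=Au$ on $[0,\infty)$ is a continuous $u:[0,\infty)\to\mathbb X$ such that $J^\alpha u(t)\in D(A)$ and $u(t)=AJ^\alpha u(t)+u(0)$ for all $t\ge 0$. Suppose the equation is well posed with a resolvent family $(S_\alpha(t))_{t\ge0}$, i.e. a strongly continuous family of bounded linear operators with $S_\alpha(0)=I$ such that, for all $x\in D(A)$ and $t\ge 0$, $S_\alpha(t)x\in D(A)$, $AS_\alpha(t)x=S_\alpha(t)Ax$ and $S_\alpha(t)x=x+\int_0^t g_\alpha(t-s)AS_\alpha(s)x\,ds$. With principal powers, let $\rho(A,\alpha)$ be the set of $\xi\in\mathbb C$ such that $(\lambda^\alpha-A)^{-1}$ exists as a bounded operator on $\mathbb X$ and is analytic in $\lambda$ on a neighbourhood of $\xi$; let $\Sigma(A,\alpha)=\mathbb C\setminus\rho(A,\alpha)$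 and $R_\alpha(\lambda,A)=\lambda^{\alpha-1}(\lambda^\alpha-A)^{-1}$. Assume: 1. $\sup_{t\ge 0}\|S_\alpha(t)\|/(1+t)^n<\infty$; 2. $\Sigma(A,\alpha)\cap i\mathbb R$ is countable; 3. $\lim_{\eta\downarrow 0}\eta R_\alpha(\eta+i\zeta,A)x=0$ for every $x\in\mathbb X$ and every real $\zeta$ with $i\zeta\in\Sigma(A,\alpha)$. Then $S_\alpha(\cdot)x_0$ is a mild solution for every $x_0\in\mathbb X$, and every mild solution $u$ of $D^\alpha_Cu=Au$ is of the form $u=S_\alpha(\cdot)u(0)$, belongs to $BUC_n(\mathbb R^+,\mathbb X)$ (that is, $u$ is continuous, $\sup_{t\ge0}\|u(t)\|/(1+t)^n<\infty$ and $\lim_{h\downarrow0}\sup_{t\ge0}\|u(t+h)-u(t)\|/(1+t)^n=0$), and satisfies $$\lim_{t\to\infty}\frac{\|u(t)\|}{(1+t)^n}=0 .$$ -/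

import Mathlib

open Filter Topology Set

noncomputable section

namespace FracEq

variable {X : Type*} [NormedAddCommGroup X] [NormedSpace ℂ X]

/-- The kernel `g_α(t) = t^(α-1) / Γ(α)`, `t > 0`. -/
def g (α t : ℝ) : ℝ := t ^ (α - 1) / Real.Gamma α

/-- The Riemann-Liouville fractional integral
`(J^α u)(t) = ∫_0^t g_α(t - s) u(s) ds`. -/
def J (α : ℝ) (u : ℝ → X) (t : ℝ) : X := ∫ s in (0 : ℝ)..t, g α (t - s) • u s

/-- `u` (considered on `[0, ∞)`) is a mild solution of `D^α_C u = A u`: it is continuous and, for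
all `t ≥ 0`, `(J^α u)(t) ∈ D(A)` and `u(t) = A (J^α u)(t) + u(0)`. -/
def IsMildSolution (A : X →ₗ.[ℂ] X) (α : ℝ) (u : ℝ → X) : Prop :=
  ContinuousOn u (Ici 0) ∧
    ∀ t : ℝ, 0 ≤ t → ∃ h : J α u t ∈ A.domain, u t = A ⟨J α u t, h⟩ + u 0

/-- `u` (considered on `[0, ∞)`) is a solution of `D^α_C u = A u` in integrated form, with `u`
taking values in `D(A)`: `u` and `v = A u` are continuous and
`u(t) = u(0) + ∫_0^t g_α(t - s) A u(s) ds` for all `t ≥ 0`. -/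
def IsSolution (A : X →ₗ.[ℂ] X) (α : ℝ) (u : ℝ → X) : Prop :=
  ContinuousOn u (Ici 0) ∧ ∃ v : ℝ → X,
    (∀ s : ℝ, 0 ≤ s → ∃ h : u s ∈ A.domain, v s = A ⟨u s, h⟩) ∧
    ContinuousOn v (Ici 0) ∧
    ∀ t : ℝ, 0 ≤ t → u t = u 0 + J α v t

/-- `(S t)`, `t ≥ 0`, is a resolvent operator (resolvent family) of `D^α_C u = A u`. -/
structure IsResolventFamily (A : X →ₗ.[ℂ] X) (α : ℝ) (S : ℝ → X →L[ℂ] X) : Prop where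
  strongly_continuous : ∀ x : X, ContinuousOn (fun t => S t x) (Ici 0)
  map_zero : S 0 = ContinuousLinearMap.id ℂ X
  commutes : ∀ t : ℝ, 0 ≤ t → ∀ x : A.domain,
    ∃ h : S t (x : X) ∈ A.domain, A ⟨S t (x : X), h⟩ = S t (A x)
  solution : ∀ x : A.domain, IsSolution A α (fun t => S t (x : X))

/-- The bounded operator `R` is a two-sided inverse `(μ - A)⁻¹` of `μ - A : D(A) → X`. -/
def IsInverse (A : X →ₗ.[ℂ] X) (μ : ℂ) (R : X →L[ℂ] X) : Prop :=
  (∀ x : A.domain, R (μ • (x : X) - A x) = x) ∧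
    ∀ y : X, ∃ h : R y ∈ A.domain, μ • R y - A ⟨R y, h⟩ = y

/-- The resolvent set of the (unbounded) operator `A`. -/
def resolventSet (A : X →ₗ.[ℂ] X) : Set ℂ := {μ | ∃ R : X →L[ℂ] X, IsInverse A μ R}

open Classical in
/-- The resolvent operator `(μ - A)⁻¹` for `μ` in the resolvent set of `A` (and `0` otherwise). -/
def resolvent (A : X →ₗ.[ℂ] X) (μ : ℂ) : X →L[ℂ] X :=
  if h : ∃ R : X →L[ℂ] X, IsInverse A μ R then h.choose else 0

/-- `ρ(A, α)`: the points in a neighbourhood of which `(z ^ α - A)⁻¹` exists and is analytic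
(as a function of `z` with values in the bounded operators); the power is the principal one. -/
def fracResolventSet (A : X →ₗ.[ℂ] X) (α : ℝ) : Set ℂ :=
  {ξ | (∀ᶠ z in 𝓝 ξ, z ^ (α : ℂ) ∈ resolventSet A) ∧
    AnalyticAt ℂ (fun z : ℂ => resolvent A (z ^ (α : ℂ))) ξ}

/-- `Σ(A, α)`, the complement of `ρ(A, α)`. -/
def fracSpectrum (A : X →ₗ.[ℂ] X) (α : ℝ) : Set ℂ := (fracResolventSet A α)ᶜ

/-- `R_α(z, A) = z ^ (α - 1) (z ^ α - A)⁻¹`. -/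
def fracResolvent (A : X →ₗ.[ℂ] X) (α : ℝ) (z : ℂ) : X →L[ℂ] X :=
  z ^ ((α : ℂ) - 1) • resolvent A (z ^ (α : ℂ))

/-- `f ∈ BUC_n(ℝ⁺, X)`: `f` is continuous on `[0, ∞)`, `sup_{t ≥ 0} ‖f t‖ / (1 + t)^n < ∞`, and
`sup_{t ≥ 0} ‖f (t + h) - f t‖ / (1 + t)^n → 0` as `h ↓ 0`. -/
def MemBUC (n : ℕ) (f : ℝ → X) : Prop :=
  ContinuousOn f (Ici 0) ∧
  (∃ C : ℝ, ∀ t : ℝ, 0 ≤ t → ‖f t‖ / (1 + t) ^ n ≤ C) ∧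
  ∀ ε : ℝ, 0 < ε → ∃ δ : ℝ, 0 < δ ∧ ∀ h : ℝ, 0 < h → h < δ →
    ∀ t : ℝ, 0 ≤ t → ‖f (t + h) - f t‖ / (1 + t) ^ n ≤ ε

end FracEq

end

set_option linter.unusedSectionVars false

noncomputable section

namespace FracEq

open MeasureTheory
open scoped FourierTransform SchwartzMap ContDiff

variable {X : Type*} [NormedAddCommGroup X] [NormedSpace ℂ X]

/-! The orbit `F = S(·)x`, extended by zero to negative times, is `O((1 + t)^n)`, and its Laplace
transform on `Re z > 0` is `R_α(z, A)x`. Decay follows from a weighted Tauberian theorem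
(`asympLE_zero_of_countable`) of Katznelson-Tzafriri and Arendt-Batty-Lyubich-Vu type, proved with
Wiener's ideal method.

Call a Schwartz kernel `k` negligible if `k * F = o((1 + t)^n)`, and a frequency regular if some
negligible kernel has nonzero Fourier transform there. Negligible kernels form a convolution ideal,
so a kernel whose transform is supported compactly in the regular set is negligible
(`mem_nullKer_of_tsupport_subset`). Where the Laplace transform extends continuously to the axis,
Riemann-Lebesgue makes the frequency regular (`mem_regularFreq_of_laplace`). The non-regular set is
therefore closed and countable, and if nonempty it has an isolated point; but at an isolated point
ergodicity forces regularity (`mem_regularFreq_of_isolated`). So every frequency is regular, every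
band-limited approximate identity is negligible, and slow oscillation passes this on to `F`
(`asympLE_zero_of_regularFreq`).

Condition 3 concerns averages of the orbit from time `0`, whereas the Tauberian argument needs
averages over `[t, ∞)` with a bound uniform in `t` relative to the weight. For a semigroup `S(t + s)
= S(t)S(s)` settles this; for `α < 1` that law is lost. Instead, with `y = (z^α - A)⁻¹x`, the
function `S(·)y - y` is the fractional integral of `S(·)Ay`. `exists_norm_laplace_sub_le` shows that
Laplace averages over `[t, ∞)` of a function and of `z^α` times its fractional integral differ by
`O(‖z‖^(α-1))` times the size of the latter. As `‖z‖^(α-1) ‖y‖ = ‖R_α(z, A)x‖`, the required bound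
follows (`exists_norm_laplace_orbit_le`).

Uniqueness of mild solutions comes from evaluating one convolution in two ways (`eq_zero_of_J`),
uniform continuity from Hölder continuity of fractional integrals and density of the domain
(`memBUC`). -/

/-! ### Asymptotic bounds relative to a polynomial weight -/

/-- `F` grows at most like `c (1 + t)^n` as `t → ∞`. -/
def AsympLE (n : ℕ) (F : ℝ → X) (c : ℝ) : Prop :=
  ∀ ε : ℝ, 0 < ε → ∀ᶠ t : ℝ in atTop, ‖F t‖ ≤ (c + ε) * (1 + t) ^ n

/-- `F` is measurable with `‖F t‖ ≤ C (1 + |t|)^n`. -/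
def WBdd (n : ℕ) (F : ℝ → X) (C : ℝ) : Prop :=
  AEStronglyMeasurable F volume ∧ ∀ t, ‖F t‖ ≤ C * (1 + |t|) ^ n

/-- The kernel `k` is integrable with respect to the weight `(1 + |s|)^n`. -/
def Ker (n : ℕ) (k : ℝ → ℂ) : Prop :=
  Integrable (fun s : ℝ => ((1 + |s|) ^ n : ℝ) • k s)

/-- The convolution of a scalar kernel with a vector valued function. -/
def conv (k : ℝ → ℂ) (F : ℝ → X) (t : ℝ) : X := ∫ s : ℝ, k s • F (t - s)

theorem WBdd.nonneg {n : ℕ} {F : ℝ → X} {C : ℝ} (h : WBdd n F C) : 0 ≤ C := by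
  simpa using (norm_nonneg _).trans (h.2 0)

theorem AsympLE.mono {n : ℕ} {F : ℝ → X} {c d : ℝ} (h : AsympLE n F c) (hcd : c ≤ d) :
    AsympLE n F d := by
  intro ε hε
  filter_upwards [h ε hε, eventually_ge_atTop 0] with t ht h0
  exact ht.trans (by gcongr)

theorem AsympLE.add {n : ℕ} {F G : ℝ → X} {c d : ℝ} (h : AsympLE n F c) (h' : AsympLE n G d) :
    AsympLE n (fun t => F t + G t) (c + d) := by
  intro ε hε
  filter_upwards [h (ε / 2) (by linarith), h' (ε / 2) (by linarith)] with t h1 h2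
  calc ‖F t + G t‖ ≤ ‖F t‖ + ‖G t‖ := norm_add_le _ _
    _ ≤ (c + ε / 2) * (1 + t) ^ n + (d + ε / 2) * (1 + t) ^ n := add_le_add h1 h2
    _ = _ := by ring

theorem AsympLE.const_smul {n : ℕ} {F : ℝ → X} {c : ℝ} (h : AsympLE n F c) (a : ℂ) :
    AsympLE n (fun t => a • F t) (‖a‖ * c) := by
  intro ε hε
  have ha : 0 < ‖a‖ + 1 := by positivity
  filter_upwards [h (ε / (‖a‖ + 1)) (by positivity), eventually_ge_atTop 0] with t ht h0
  rw [norm_smul]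
  calc ‖a‖ * ‖F t‖ ≤ ‖a‖ * ((c + ε / (‖a‖ + 1)) * (1 + t) ^ n) := by gcongr
    _ = (‖a‖ * c + ‖a‖ * (ε / (‖a‖ + 1))) * (1 + t) ^ n := by ring
    _ ≤ _ := by
      gcongr
      rw [mul_div_assoc', div_le_iff₀ ha]
      nlinarith

theorem AsympLE.congr {n : ℕ} {F G : ℝ → X} {c : ℝ} (h : AsympLE n F c) (hFG : F =ᶠ[atTop] G) :
    AsympLE n G c := by
  intro ε hε
  filter_upwards [h ε hε, hFG] with t h1 h2
  rwa [← h2]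

theorem AsympLE.of_forall_gt {n : ℕ} {F : ℝ → X} {c : ℝ}
    (h : ∀ δ : ℝ, 0 < δ → AsympLE n F (c + δ)) : AsympLE n F c := by
  intro ε hε
  filter_upwards [h (ε / 2) (by linarith) (ε / 2) (by linarith)] with t ht
  convert ht using 2
  ring

theorem AsympLE.of_bound {n : ℕ} {F : ℝ → X} {c : ℝ}
    (h : ∀ t : ℝ, 0 ≤ t → ‖F t‖ ≤ c * (1 + t) ^ n) : AsympLE n F c := by
  intro ε hε
  filter_upwards [eventually_ge_atTop 0] with t h0
  refine (h t h0).trans ?_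
  gcongr
  linarith

theorem WBdd.asympLE {n : ℕ} {F : ℝ → X} {C : ℝ} (h : WBdd n F C) : AsympLE n F C :=
  .of_bound fun t ht => by simpa [abs_of_nonneg ht] using h.2 t

theorem AsympLE.of_tendsto_zero {n : ℕ} {F : ℝ → X} (h : Tendsto F atTop (𝓝 0)) :
    AsympLE n F 0 := by
  intro ε hε
  filter_upwards [(tendsto_zero_iff_norm_tendsto_zero.1 h).eventually_lt_const hε,
    eventually_ge_atTop 0] with t h1 h0
  have : 1 ≤ (1 + t) ^ n := one_le_pow₀ (by linarith)
  nlinarith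

theorem AsympLE.tendsto {n : ℕ} {F : ℝ → X} (h : AsympLE n F 0) :
    Tendsto (fun t => ‖F t‖ / (1 + t) ^ n) atTop (𝓝 0) := by
  rw [Metric.tendsto_nhds]
  intro ε hε
  filter_upwards [h (ε / 2) (by linarith), eventually_ge_atTop 0] with t h1 h0
  have h2 : 0 < (1 + t) ^ n := by positivity
  rw [Real.dist_eq, sub_zero, abs_of_nonneg (by positivity), div_lt_iff₀ h2]
  nlinarith

theorem tendsto_weight_ratio (n : ℕ) (s : ℝ) :
    Tendsto (fun t : ℝ => (1 + (t - s)) ^ n / (1 + t) ^ n) atTop (𝓝 1) := by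
  have h1 : Tendsto (fun t : ℝ => 1 - s / (1 + t)) atTop (𝓝 (1 - 0)) :=
    tendsto_const_nhds.sub (Tendsto.div_atTop tendsto_const_nhds
      (tendsto_atTop_add_const_left _ _ tendsto_id))
  have h2 := h1.pow n
  simp only [sub_zero, one_pow] at h2
  refine h2.congr' ?_
  filter_upwards [eventually_ge_atTop 0] with t ht
  rw [← div_pow]
  congr 1
  field_simp
  ring

/-- A polynomial weight changes under a fixed translation by a factor tending to `1`, so the
asymptotic constant is translation invariant. -/
theorem AsympLE.comp_sub {n : ℕ} {F : ℝ → X} {c : ℝ} (h : AsympLE n F c) (s : ℝ) :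
    AsympLE n (fun t => F (t - s)) c := by
  intro ε hε
  have h1 := (tendsto_atTop_add_const_right atTop (-s) tendsto_id).eventually
    (h (ε / 2) (by linarith))
  have h2 : Tendsto (fun t : ℝ => (c + ε / 2) * ((1 + (t - s)) ^ n / (1 + t) ^ n)) atTop
      (𝓝 ((c + ε / 2) * 1)) := (tendsto_weight_ratio n s).const_mul _
  filter_upwards [h1, h2.eventually_lt_const (show (c + ε / 2) * 1 < c + ε by linarith),
    eventually_ge_atTop 0] with t h1 h2 h0
  have h3 : 0 < (1 + t) ^ n := by positivity
  simp only [id, ← sub_eq_add_neg] at h1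
  rw [← mul_div_assoc, div_lt_iff₀ h3] at h2
  exact h1.trans h2.le

/-- A limsup form of dominated convergence: pointwise asymptotic constants may be integrated as soon
as the weighted norms have a common integrable majorant. -/
theorem AsympLE.integral {μ : Measure ℝ} {n : ℕ} {F : ℝ → ℝ → X} {M c : ℝ → ℝ}
    (hM : Integrable M μ) (hc : Integrable c μ)
    (hF : ∀ᶠ t in atTop, AEStronglyMeasurable (fun s => F s t) μ)
    (hFM : ∀ᶠ t : ℝ in atTop, ∀ᵐ s ∂μ, ‖F s t‖ ≤ M s * (1 + t) ^ n)
    (hlim : ∀ᵐ s ∂μ, AsympLE n (F s) (c s)) :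
    AsympLE n (fun t => ∫ s, F s t ∂μ) (∫ s, c s ∂μ) := by
  -- Taking the maximum with `c s` turns an upper bound on the limsup into genuine pointwise
  -- convergence to `c s`, to which dominated convergence applies.
  have key : Tendsto (fun t : ℝ => ∫ s, max (‖F s t‖ / (1 + t) ^ n) (c s) ∂μ) atTop
      (𝓝 (∫ s, c s ∂μ)) := by
    refine tendsto_integral_filter_of_dominated_convergence (fun s => |M s| + |c s|) ?_ ?_
      (hM.abs.add hc.abs) ?_
    · filter_upwards [hF] with t ht
      exact (ht.norm.mul_const (((1 + t) ^ n)⁻¹)).sup hc.aestronglyMeasurable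
    · filter_upwards [hFM, eventually_ge_atTop 0] with t ht h0
      filter_upwards [ht] with s hs
      have h3 : 0 < (1 + t) ^ n := by positivity
      have h4 : ‖F s t‖ / (1 + t) ^ n ≤ M s := by rwa [div_le_iff₀ h3]
      rw [Real.norm_eq_abs, abs_le]
      constructor
      · have := le_max_right (‖F s t‖ / (1 + t) ^ n) (c s)
        have := neg_abs_le (c s)
        have := abs_nonneg (M s)
        linarith
      · have := le_abs_self (c s)
        have := abs_nonneg (M s)
        have := abs_nonneg (c s)
        have := le_abs_self (M s)
        exact max_le (by linarith) (by linarith)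
    · filter_upwards [hlim] with s hs
      rw [Metric.tendsto_nhds]
      intro ε hε
      filter_upwards [hs (ε / 2) (by linarith), eventually_ge_atTop 0] with t ht h0
      have h3 : 0 < (1 + t) ^ n := by positivity
      rw [← div_le_iff₀ h3] at ht
      rw [Real.dist_eq, abs_of_nonneg (by simp)]
      have : max (‖F s t‖ / (1 + t) ^ n) (c s) ≤ c s + ε / 2 := max_le ht (by linarith)
      linarith
  intro ε hε
  filter_upwards [key.eventually_lt_const (show ∫ s, c s ∂μ < ∫ s, c s ∂μ + ε by linarith), hF,
    hFM, eventually_ge_atTop 0] with t h1 h2 h4 h0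
  have h3 : 0 < (1 + t) ^ n := by positivity
  rw [← div_le_iff₀ h3]
  refine le_trans ?_ h1.le
  have hi : Integrable (fun s => ‖F s t‖ / (1 + t) ^ n) μ := by
    refine hM.mono' (h2.norm.mul_const (((1 + t) ^ n)⁻¹)) ?_
    filter_upwards [h4] with s hs
    rw [Real.norm_of_nonneg (by positivity), div_le_iff₀ h3]
    exact hs
  calc ‖∫ s, F s t ∂μ‖ / (1 + t) ^ n ≤ (∫ s, ‖F s t‖ ∂μ) / (1 + t) ^ n := by
        gcongr
        exact norm_integral_le_integral_norm _
    _ = ∫ s, ‖F s t‖ / (1 + t) ^ n ∂μ := (integral_div _ _).symm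
    _ ≤ _ := integral_mono hi (hi.sup hc) fun s => le_max_left _ _

/-! ### Weighted kernels and their convolutions -/

theorem Ker.aestronglyMeasurable {n : ℕ} {k : ℝ → ℂ} (h : Ker n k) :
    AEStronglyMeasurable k volume := by
  have h1 : Continuous fun s : ℝ => ((1 + |s|) ^ n : ℝ)⁻¹ :=
    Continuous.inv₀ (by fun_prop) fun s => by positivity
  have h2 : AEStronglyMeasurable (fun s : ℝ => ((1 + |s|) ^ n : ℝ) • k s) volume :=
    MeasureTheory.Integrable.aestronglyMeasurable h
  refine (h1.aestronglyMeasurable.smul h2).congr (ae_of_all _ fun s => ?_)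
  have : ((1 + |s|) ^ n : ℝ) ≠ 0 := by positivity
  exact inv_smul_smul₀ this (k s)

theorem Ker.norm {n : ℕ} {k : ℝ → ℂ} (h : Ker n k) :
    Integrable (fun s : ℝ => (1 + |s|) ^ n * ‖k s‖) := by
  refine (Integrable.norm h).congr (ae_of_all _ fun s => ?_)
  simp only [norm_smul, Real.norm_eq_abs]
  rw [abs_of_nonneg (by positivity)]

theorem Ker.of_norm {n : ℕ} {k : ℝ → ℂ} (hk : AEStronglyMeasurable k volume)
    (h : Integrable (fun s : ℝ => (1 + |s|) ^ n * ‖k s‖)) : Ker n k := by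
  have h1 : Continuous fun s : ℝ => ((1 + |s|) ^ n : ℝ) := by fun_prop
  refine h.mono' (h1.aestronglyMeasurable.smul hk) (ae_of_all _ fun s => ?_)
  simp only [norm_smul, Real.norm_eq_abs]
  rw [abs_of_nonneg (by positivity)]

theorem Ker.of_le {n m : ℕ} {k : ℝ → ℂ} (h : Ker n k) (hmn : m ≤ n) : Ker m k := by
  have h1 : Continuous fun s : ℝ => ((1 + |s|) ^ m : ℝ) := by fun_prop
  refine Ker.of_norm h.aestronglyMeasurable (h.norm.mono'
    (h1.aestronglyMeasurable.mul h.aestronglyMeasurable.norm) (ae_of_all _ fun s => ?_))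
  simp only [Real.norm_eq_abs]
  rw [abs_of_nonneg (by positivity)]
  gcongr
  have := abs_nonneg s
  linarith

theorem Ker.integrable {n : ℕ} {k : ℝ → ℂ} (h : Ker n k) : Integrable k := by
  simpa [Ker] using h.of_le (Nat.zero_le n)

theorem weight_sub_le (n : ℕ) (t s : ℝ) :
    (1 + |t - s|) ^ n ≤ (1 + |t|) ^ n * (1 + |s|) ^ n := by
  rw [← mul_pow]
  gcongr
  nlinarith [abs_sub t s, abs_nonneg t, abs_nonneg s, mul_nonneg (abs_nonneg t) (abs_nonneg s)]

theorem WBdd.norm_sub_le {n : ℕ} {F : ℝ → X} {C : ℝ} (h : WBdd n F C) (t s : ℝ) :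
    ‖F (t - s)‖ ≤ C * ((1 + |t|) ^ n * (1 + |s|) ^ n) :=
  (h.2 _).trans (mul_le_mul_of_nonneg_left (weight_sub_le n t s) h.nonneg)

theorem WBdd.aestronglyMeasurable_sub {n : ℕ} {F : ℝ → X} {C : ℝ} (h : WBdd n F C) (t : ℝ) :
    AEStronglyMeasurable (fun s => F (t - s)) volume :=
  h.1.comp_quasiMeasurePreserving
    (quasiMeasurePreserving_sub_left_of_right_invariant volume t)

theorem integrable_conv {n : ℕ} {k : ℝ → ℂ} {F : ℝ → X} {C : ℝ} (hk : Ker n k) (hF : WBdd n F C)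
    (t : ℝ) : Integrable fun s => k s • F (t - s) := by
  refine (hk.norm.const_mul (C * (1 + |t|) ^ n)).mono'
    (hk.aestronglyMeasurable.smul (hF.aestronglyMeasurable_sub t)) (ae_of_all _ fun s => ?_)
  rw [norm_smul]
  calc ‖k s‖ * ‖F (t - s)‖ ≤ ‖k s‖ * (C * ((1 + |t|) ^ n * (1 + |s|) ^ n)) := by
        gcongr
        exact hF.norm_sub_le t s
    _ = _ := by ring

theorem WBdd.conv {n : ℕ} {k : ℝ → ℂ} {F : ℝ → X} {C : ℝ} (hk : Ker n k) (hF : WBdd n F C) :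
    WBdd n (conv k F) (C * ∫ s : ℝ, (1 + |s|) ^ n * ‖k s‖) := by
  constructor
  · exact (AEStronglyMeasurable.convolution_integrand (ContinuousLinearMap.lsmul ℂ ℂ)
      hk.aestronglyMeasurable hF.1).integral_prod_right'
  · intro t
    refine (norm_integral_le_of_norm_le (hk.norm.const_mul (C * (1 + |t|) ^ n))
      (ae_of_all _ fun s => ?_)).trans_eq ?_
    · rw [norm_smul]
      calc ‖k s‖ * ‖F (t - s)‖ ≤ ‖k s‖ * (C * ((1 + |t|) ^ n * (1 + |s|) ^ n)) := by
            gcongr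
            exact hF.norm_sub_le t s
        _ = _ := by ring
    · rw [integral_const_mul]
      ring

/-- Only the unweighted norm of `k` enters the constant, because each translate of `F` has the same
asymptotic constant as `F`. The weighted norm serves merely as a majorant. -/
theorem AsympLE.conv {n : ℕ} {k : ℝ → ℂ} {F : ℝ → X} {C c : ℝ} (hk : Ker n k)
    (hF : WBdd n F C) (h : AsympLE n F c) : AsympLE n (conv k F) (c * ∫ s, ‖k s‖) := by
  rw [mul_comm, ← integral_mul_const]
  refine AsympLE.integral (F := fun s t => k s • F (t - s))
    (M := fun s => C * ((1 + |s|) ^ n * ‖k s‖)) (hk.norm.const_mul _)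
    (hk.integrable.norm.mul_const _) (.of_forall fun t => (integrable_conv hk hF t).1) ?_
    (ae_of_all _ fun s => (h.comp_sub s).const_smul (k s))
  filter_upwards [eventually_ge_atTop 0] with t ht
  refine ae_of_all _ fun s => ?_
  rw [norm_smul]
  have := hF.norm_sub_le t s
  rw [abs_of_nonneg ht] at this
  calc ‖k s‖ * ‖F (t - s)‖ ≤ ‖k s‖ * (C * ((1 + t) ^ n * (1 + |s|) ^ n)) := by gcongr
    _ = _ := by ring

theorem integrable_conv_conv {n : ℕ} {k l : ℝ → ℂ} {F : ℝ → X} {C : ℝ} (hk : Ker n k)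
    (hl : Ker n l) (hF : WBdd n F C) (t : ℝ) :
    Integrable (fun p : ℝ × ℝ => k p.1 • l p.2 • F (t - p.1 - p.2)) (volume.prod volume) := by
  have h1 : AEStronglyMeasurable (fun p : ℝ × ℝ => F (t - p.1 - p.2)) (volume.prod volume) := by
    refine (hF.1.mono_ac ?_).comp_measurable (by fun_prop)
    refine Measure.QuasiMeasurePreserving.absolutelyContinuous ?_
    refine QuasiMeasurePreserving.prod_of_right (by fun_prop) (ae_of_all _ fun y => ?_)
    exact quasiMeasurePreserving_sub_left_of_right_invariant (volume : Measure ℝ) (t - y)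
  refine ((hk.norm.mul_prod hl.norm).const_mul (C * (1 + |t|) ^ n)).mono'
    (hk.aestronglyMeasurable.comp_fst.smul (hl.aestronglyMeasurable.comp_snd.smul h1))
    (ae_of_all _ fun p => ?_)
  rw [norm_smul, norm_smul]
  calc ‖k p.1‖ * (‖l p.2‖ * ‖F (t - p.1 - p.2)‖)
      ≤ ‖k p.1‖ * (‖l p.2‖ * (C * (((1 + |t|) ^ n * (1 + |p.1|) ^ n) * (1 + |p.2|) ^ n))) := by
        gcongr
        refine (hF.norm_sub_le _ _).trans ?_
        have := hF.nonneg
        gcongr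
        exact weight_sub_le n t p.1
    _ = _ := by ring

theorem conv_conv_comm {n : ℕ} {k l : ℝ → ℂ} {F : ℝ → X} {C : ℝ} (hk : Ker n k) (hl : Ker n l)
    (hF : WBdd n F C) : conv k (conv l F) = conv l (conv k F) := by
  ext t
  have h := integral_integral_swap (f := fun s r => k s • l r • F (t - s - r))
    (integrable_conv_conv hk hl hF t)
  simp only [conv, ← integral_smul]
  rw [h]
  refine integral_congr_ae (ae_of_all _ fun s => integral_congr_ae (ae_of_all _ fun r => ?_))
  simp only [smul_comm (l s), sub_right_comm t s r]

theorem conv_assoc [CompleteSpace X] {n : ℕ} {k l : ℝ → ℂ} {F : ℝ → X} {C : ℝ} (hk : Ker n k)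
    (hl : Ker n l) (hF : WBdd n F C) : conv (conv k l) F = conv k (conv l F) := by
  ext t
  -- Fubini is applied after the measure-preserving shear `(u, s) ↦ (s, u - s)`, up to the order of
  -- the coordinates.
  have h := (measurePreserving_prod_sub (volume : Measure ℝ) volume).integrable_comp_of_integrable
    (integrable_conv_conv hk hl hF t)
  have h2 := integral_integral_swap (f := fun s u => k s • l (u - s) • F (t - s - (u - s))) h
  calc conv (conv k l) F t = ∫ u, ∫ s, k s • l (u - s) • F (t - s - (u - s)) := by
        refine integral_congr_ae ?_
        have hkl := (hk.integrable.integrable_convolution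
          (ContinuousLinearMap.mul ℂ ℂ) hl.integrable)
        have h3 : ∀ᵐ u : ℝ, Integrable fun s => k s * l (u - s) :=
          hk.integrable.ae_convolution_exists (ContinuousLinearMap.mul ℂ ℂ) hl.integrable
        filter_upwards [h3] with u hu
        simp only [conv, smul_eq_mul]
        rw [← integral_smul_const]
        refine integral_congr_ae (ae_of_all _ fun s => ?_)
        simp only [smul_smul]
        congr 2
        ring
    _ = ∫ s, ∫ u, k s • l (u - s) • F (t - s - (u - s)) := by rw [h2]
    _ = _ := by
        simp only [conv, ← integral_smul]
        refine integral_congr_ae (ae_of_all _ fun s => ?_)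
        exact integral_sub_right_eq_self (fun u => k s • l u • F (t - s - u)) s

/-! ### Schwartz kernels, the ideal of negligible kernels and regular frequencies -/

theorem ker_schwartz (n : ℕ) (k : 𝓢(ℝ, ℂ)) : Ker n k := by
  refine Ker.of_norm k.continuous.aestronglyMeasurable ?_
  have h := (((k.integrable_pow_mul volume 0).add (k.integrable_pow_mul volume n)).const_mul
    (2 ^ (n - 1)))
  refine h.mono' (by fun_prop) (ae_of_all _ fun s => ?_)
  have h1 := add_pow_le (zero_le_one' ℝ) (abs_nonneg s) n
  rw [Real.norm_of_nonneg (by positivity)]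
  simp only [Pi.add_apply, Real.norm_eq_abs, pow_zero]
  calc (1 + |s|) ^ n * ‖k s‖ ≤ 2 ^ (n - 1) * (1 ^ n + |s| ^ n) * ‖k s‖ := by gcongr
    _ = _ := by rw [one_pow]; ring

/-- The convolution product of two Schwartz functions. -/
def schwartzConv (k l : 𝓢(ℝ, ℂ)) : 𝓢(ℝ, ℂ) :=
  SchwartzMap.convolution (ContinuousLinearMap.mul ℂ ℂ) k l

theorem coe_schwartzConv (k l : 𝓢(ℝ, ℂ)) : (schwartzConv k l : ℝ → ℂ) = conv k l := by
  ext x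
  exact SchwartzMap.convolution_apply (ContinuousLinearMap.mul ℂ ℂ) k l x

/-- The Fourier transform of a Schwartz function, as a Schwartz function. -/
abbrev ft (k : 𝓢(ℝ, ℂ)) : 𝓢(ℝ, ℂ) := 𝓕 k

theorem fourier_schwartzConv (k l : 𝓢(ℝ, ℂ)) (ξ : ℝ) :
    ft (schwartzConv k l) ξ = ft k ξ * ft l ξ := by
  rw [ft, schwartzConv, SchwartzMap.fourier_convolution]
  rfl

theorem schwartz_ext_fourier {k l : 𝓢(ℝ, ℂ)} (h : ∀ ξ, ft k ξ = ft l ξ) : k = l := by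
  have : ft k = ft l := by ext ξ; exact h ξ
  simpa using congrArg (fun f => 𝓕⁻ f) this

/-- The Schwartz functions `k` for which `k * F` is negligible at infinity. -/
def nullKer (n : ℕ) (F : ℝ → X) : Set 𝓢(ℝ, ℂ) := {k | AsympLE n (conv k F) 0}

theorem conv_add_left {n : ℕ} {F : ℝ → X} {C : ℝ} (hF : WBdd n F C) (k l : 𝓢(ℝ, ℂ)) :
    conv (k + l : 𝓢(ℝ, ℂ)) F = fun t => conv k F t + conv l F t := by
  ext t
  rw [conv, conv, conv, ← integral_add (integrable_conv (ker_schwartz n k) hF t)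
    (integrable_conv (ker_schwartz n l) hF t)]
  simp [add_smul]

theorem nullKer_zero (n : ℕ) (F : ℝ → X) : (0 : 𝓢(ℝ, ℂ)) ∈ nullKer n F := by
  have : conv (0 : 𝓢(ℝ, ℂ)) F = fun _ => 0 := by ext t; simp [conv]
  rw [nullKer, mem_ofPred_eq, this]
  exact .of_tendsto_zero tendsto_const_nhds

theorem nullKer_add {n : ℕ} {F : ℝ → X} {C : ℝ} (hF : WBdd n F C) {k l : 𝓢(ℝ, ℂ)}
    (hk : k ∈ nullKer n F) (hl : l ∈ nullKer n F) : k + l ∈ nullKer n F := by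
  rw [nullKer, mem_ofPred_eq, conv_add_left hF]
  simpa using AsympLE.add hk hl

theorem nullKer_sum {n : ℕ} {F : ℝ → X} {C : ℝ} (hF : WBdd n F C) {ι : Type*} (s : Finset ι)
    {k : ι → 𝓢(ℝ, ℂ)} (hk : ∀ i ∈ s, k i ∈ nullKer n F) : ∑ i ∈ s, k i ∈ nullKer n F := by
  classical
  induction s using Finset.induction_on with
  | empty => simpa using nullKer_zero n F
  | insert i s hi ih =>
    rw [Finset.sum_insert hi]
    exact nullKer_add hF (hk i (by simp)) (ih fun j hj => hk j (by simp [hj]))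

/-- The ideal property: by associativity `(l * k) * F = l * (k * F)`, and convolution with `l`
preserves the asymptotic constant `0`. -/
theorem nullKer_conv [CompleteSpace X] {n : ℕ} {F : ℝ → X} {C : ℝ} (hF : WBdd n F C)
    (l : 𝓢(ℝ, ℂ)) {k : 𝓢(ℝ, ℂ)} (hk : k ∈ nullKer n F) : schwartzConv l k ∈ nullKer n F := by
  rw [nullKer, mem_ofPred_eq, coe_schwartzConv,
    conv_assoc (ker_schwartz n l) (ker_schwartz n k) hF]
  simpa using AsympLE.conv (ker_schwartz n l) (hF.conv (ker_schwartz n k)) hk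

/-- The frequencies at which some negligible kernel does not vanish. -/
def regularFreq (n : ℕ) (F : ℝ → X) : Set ℝ := {ξ | ∃ k ∈ nullKer n F, ft k ξ ≠ 0}

theorem isOpen_regularFreq (n : ℕ) (F : ℝ → X) : IsOpen (regularFreq n F) := by
  have : regularFreq n F = ⋃ k ∈ nullKer n F, {ξ : ℝ | ft k ξ ≠ 0} := by
    ext ξ; simp [regularFreq]
  rw [this]
  exact isOpen_biUnion fun k _ => isOpen_ne_fun (ft k).continuous continuous_const

/-- Wiener's local division. Finitely many negligible `m i` have no common zero of their transforms
on the compact support, so there `ft k` is a smooth combination of the `ft (m i)`, and `k` lies in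
the ideal they generate. -/
theorem mem_nullKer_of_tsupport_subset [CompleteSpace X] {n : ℕ} {F : ℝ → X} {C : ℝ}
    (hF : WBdd n F C) {k : 𝓢(ℝ, ℂ)} (hk : HasCompactSupport (ft k))
    (hsub : tsupport (ft k) ⊆ regularFreq n F) : k ∈ nullKer n F := by
  have hch : ∀ ξ : tsupport (ft k), ∃ m ∈ nullKer n F, ft m ξ ≠ 0 := fun ξ => hsub ξ.2
  choose m hm hm0 using hch
  obtain ⟨t, ht⟩ := IsCompact.elim_finite_subcover hk
    (fun ξ : tsupport (ft k) => {x : ℝ | ft (m ξ) x ≠ 0})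
    (fun ξ => isOpen_ne_fun (ft (m ξ)).continuous continuous_const)
    (fun x hx => mem_iUnion.2 ⟨⟨x, hx⟩, hm0 ⟨x, hx⟩⟩)
  -- The sum of the squared moduli `|ft (m i)|²`: smooth, and positive wherever some `ft (m i)` is
  -- nonzero, hence a legitimate divisor on the support of `ft k`.
  set Ψ : ℝ → ℂ := fun x => ∑ i ∈ t, starRingEnd ℂ (ft (m i) x) * ft (m i) x with hΨ
  have hΨ0 : ∀ x ∈ tsupport (ft k), Ψ x ≠ 0 := by
    intro x hx h0
    obtain ⟨i, hi, hix⟩ : ∃ i ∈ t, ft (m i) x ≠ 0 := by simpa using ht hx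
    have h1 : Ψ x = ((∑ i ∈ t, Complex.normSq (ft (m i) x) : ℝ) : ℂ) := by
      simp only [hΨ, ← Complex.normSq_eq_conj_mul_self]
      push_cast
      rfl
    rw [h1, Complex.ofReal_eq_zero,
      Finset.sum_eq_zero_iff_of_nonneg fun i _ => Complex.normSq_nonneg _] at h0
    exact hix (Complex.normSq_eq_zero.1 (h0 i hi))
  have hconj : ∀ i, ContDiff ℝ ∞ fun x => starRingEnd ℂ (ft (m i) x) := fun i =>
    Complex.conjCLE.contDiff.comp ((ft (m i)).smooth ⊤)
  have hΨs : ContDiff ℝ ∞ Ψ := ContDiff.sum fun i _ => (hconj i).mul ((ft (m i)).smooth ⊤)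
  have hq : ∀ i, ContDiff ℝ ∞ fun x => ft k x * starRingEnd ℂ (ft (m i) x) / Ψ x := by
    intro i
    rw [contDiff_iff_contDiffAt]
    intro x
    by_cases hx : x ∈ tsupport (ft k)
    · simp only [div_eq_mul_inv]
      -- On the support the denominator is nonzero; off it the quotient vanishes locally, whatever
      -- `Ψ` does there.
      exact ((((ft k).smooth ⊤).mul (hconj i)).contDiffAt).mul (hΨs.contDiffAt.inv (hΨ0 x hx))
    · refine (contDiffAt_const (c := (0 : ℂ))).congr_of_eventuallyEq ?_
      filter_upwards [notMem_tsupport_iff_eventuallyEq.1 hx] with y hy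
      simp [hy]
  have hqs : ∀ i, HasCompactSupport fun x => ft k x * starRingEnd ℂ (ft (m i) x) / Ψ x := by
    intro i
    refine hk.mono fun x hx => ?_
    rw [Function.mem_support] at hx ⊢
    contrapose! hx
    simp [hx]
  have key : k = ∑ i ∈ t, schwartzConv (𝓕⁻ ((hqs i).toSchwartzMap (hq i))) (m i) := by
    refine schwartz_ext_fourier fun ξ => ?_
    have h1 : ft (∑ i ∈ t, schwartzConv (𝓕⁻ ((hqs i).toSchwartzMap (hq i))) (m i))
        = ∑ i ∈ t, ft (schwartzConv (𝓕⁻ ((hqs i).toSchwartzMap (hq i))) (m i)) :=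
      map_sum (FourierTransform.fourierCLM ℂ 𝓢(ℝ, ℂ)) _ _
    rw [h1, sum_apply]
    simp only [fourier_schwartzConv, ft, FourierTransform.fourier_fourierInv_eq]
    by_cases hx : ξ ∈ tsupport (ft k)
    · have : ∀ i, ((hqs i).toSchwartzMap (hq i)) ξ * ft (m i) ξ
          = ft k ξ / Ψ ξ * (starRingEnd ℂ (ft (m i) ξ) * ft (m i) ξ) := by
        intro i
        change ft k ξ * starRingEnd ℂ (ft (m i) ξ) / Ψ ξ * ft (m i) ξ = _
        ring
      simp only [this]
      rw [← Finset.mul_sum, div_mul_cancel₀ _ (hΨ0 ξ hx)]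
    · have h0 := image_eq_zero_of_notMem_tsupport hx
      have : ∀ i, ((hqs i).toSchwartzMap (hq i)) ξ = 0 := by
        intro i
        change ft k ξ * starRingEnd ℂ (ft (m i) ξ) / Ψ ξ = 0
        simp [h0]
      simp [this, h0]
  rw [key]
  exact nullKer_sum hF t fun i _ => nullKer_conv hF _ (hm i)

/-! ### Band-limited kernels -/

/-- A smooth cutoff function, `1` on `[-1, 1]` and `0` outside `[-2, 2]`. -/
def cutoff : ContDiffBump (0 : ℝ) := ⟨1, 2, one_pos, one_lt_two⟩

/-- The cutoff function rescaled to the interval of radius `δ` around `ξ₀`. -/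
def scaledCutoff (ξ₀ δ : ℝ) (ξ : ℝ) : ℂ := (cutoff ((ξ - ξ₀) / δ) : ℝ)

theorem contDiff_scaledCutoff (ξ₀ δ : ℝ) : ContDiff ℝ ∞ (scaledCutoff ξ₀ δ) :=
  Complex.ofRealCLM.contDiff.comp (cutoff.contDiff.comp ((contDiff_id.sub contDiff_const).div_const _))

theorem scaledCutoff_eq_one {ξ₀ δ ξ : ℝ} (hδ : 0 < δ) (h : |ξ - ξ₀| ≤ δ) :
    scaledCutoff ξ₀ δ ξ = 1 := by
  rw [scaledCutoff, cutoff.one_of_mem_closedBall, Complex.ofReal_one]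
  rw [mem_closedBall_zero_iff, Real.norm_eq_abs, abs_div, abs_of_pos hδ, div_le_iff₀ hδ]
  simpa [cutoff] using h

theorem scaledCutoff_eq_zero {ξ₀ δ ξ : ℝ} (hδ : 0 < δ) (h : 2 * δ ≤ |ξ - ξ₀|) :
    scaledCutoff ξ₀ δ ξ = 0 := by
  rw [scaledCutoff, cutoff.zero_of_le_dist, Complex.ofReal_zero]
  rw [dist_zero_right, Real.norm_eq_abs, abs_div, abs_of_pos hδ, le_div_iff₀ hδ]
  simpa [cutoff] using h

theorem tsupport_scaledCutoff {ξ₀ δ : ℝ} (hδ : 0 < δ) :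
    tsupport (scaledCutoff ξ₀ δ) ⊆ Metric.closedBall ξ₀ (2 * δ) := by
  refine closure_minimal (fun ξ hξ => ?_) Metric.isClosed_closedBall
  by_contra h
  rw [Metric.mem_closedBall, Real.dist_eq, not_le] at h
  exact hξ (scaledCutoff_eq_zero hδ h.le)

theorem hasCompactSupport_scaledCutoff {ξ₀ δ : ℝ} (hδ : 0 < δ) :
    HasCompactSupport (scaledCutoff ξ₀ δ) :=
  HasCompactSupport.of_support_subset_isCompact (isCompact_closedBall ξ₀ (2 * δ))
    ((subset_tsupport _).trans (tsupport_scaledCutoff hδ))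

/-- The Schwartz function whose Fourier transform is `scaledCutoff ξ₀ δ`. -/
def bandKernel (ξ₀ : ℝ) {δ : ℝ} (hδ : 0 < δ) : 𝓢(ℝ, ℂ) :=
  𝓕⁻ ((hasCompactSupport_scaledCutoff (ξ₀ := ξ₀) hδ).toSchwartzMap (contDiff_scaledCutoff ξ₀ δ))

theorem fourier_bandKernel (ξ₀ : ℝ) {δ : ℝ} (hδ : 0 < δ) :
    (ft (bandKernel ξ₀ hδ) : ℝ → ℂ) = scaledCutoff ξ₀ δ := by
  rw [ft, bandKernel, FourierTransform.fourier_fourierInv_eq]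
  rfl

theorem bandKernel_eq_integral (ξ₀ : ℝ) {δ : ℝ} (hδ : 0 < δ) (t : ℝ) :
    bandKernel ξ₀ hδ t
      = ∫ ξ : ℝ, Complex.exp (2 * Real.pi * Complex.I * ξ * t) * scaledCutoff ξ₀ δ ξ := by
  rw [bandKernel, SchwartzMap.fourierInv_coe, Real.fourierInv_eq']
  refine integral_congr_ae (ae_of_all _ fun ξ => ?_)
  simp only [smul_eq_mul]
  congr 2
  simp
  ring

/-- All band kernels are modulated dilates of a single one. Hence their `L¹` norms do not depend on
the width `δ`, while their first absolute moments scale like `1 / δ`. -/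
theorem bandKernel_apply (ξ₀ : ℝ) {δ : ℝ} (hδ : 0 < δ) (t : ℝ) :
    bandKernel ξ₀ hδ t
      = Complex.exp (2 * Real.pi * Complex.I * ξ₀ * t) * (δ * bandKernel 0 one_pos (δ * t)) := by
  rw [bandKernel_eq_integral, bandKernel_eq_integral]
  have h2 := integral_sub_right_eq_self (μ := volume) (fun ξ : ℝ =>
    Complex.exp (2 * Real.pi * Complex.I * (ξ + ξ₀) * t) * scaledCutoff 0 δ ξ) ξ₀
  have h3 := Measure.integral_comp_mul_left (F := ℂ) (fun ξ : ℝ =>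
    Complex.exp (2 * Real.pi * Complex.I * (ξ + ξ₀) * t) * scaledCutoff 0 δ ξ) δ
  calc _ = ∫ ξ : ℝ, Complex.exp (2 * Real.pi * Complex.I * (ξ + ξ₀) * t) * scaledCutoff 0 δ ξ := by
        rw [← h2]
        refine integral_congr_ae (ae_of_all _ fun ξ => ?_)
        simp [scaledCutoff]
    _ = δ * ∫ ξ : ℝ, Complex.exp (2 * Real.pi * Complex.I * ((δ * ξ : ℝ) + ξ₀) * t)
          * scaledCutoff 0 δ (δ * ξ) := by
        rw [h3, abs_of_pos (by positivity), Complex.real_smul, ← mul_assoc, ← Complex.ofReal_mul,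
          mul_inv_cancel₀ hδ.ne', Complex.ofReal_one, one_mul]
    _ = _ := by
        rw [mul_left_comm]
        congr 1
        rw [← integral_const_mul]
        refine integral_congr_ae (ae_of_all _ fun ξ => ?_)
        simp only [scaledCutoff, sub_zero, div_one, mul_div_cancel_left₀ _ hδ.ne']
        rw [← mul_assoc, ← Complex.exp_add]
        congr 2
        push_cast
        ring

theorem norm_bandKernel (ξ₀ : ℝ) {δ : ℝ} (hδ : 0 < δ) (t : ℝ) :
    ‖bandKernel ξ₀ hδ t‖ = δ * ‖bandKernel 0 one_pos (δ * t)‖ := by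
  rw [bandKernel_apply, norm_mul, norm_mul, Complex.norm_real, Real.norm_of_nonneg hδ.le,
    Complex.norm_exp]
  simp

theorem integral_norm_bandKernel (ξ₀ : ℝ) {δ : ℝ} (hδ : 0 < δ) :
    ∫ t, ‖bandKernel ξ₀ hδ t‖ = ∫ t, ‖bandKernel 0 one_pos t‖ := by
  simp only [norm_bandKernel ξ₀ hδ]
  rw [integral_const_mul, Measure.integral_comp_mul_left (fun t => ‖bandKernel 0 one_pos t‖),
    abs_of_pos (by positivity), smul_eq_mul, mul_inv_cancel_left₀ hδ.ne']

theorem integral_abs_mul_norm_bandKernel (ξ₀ : ℝ) {δ : ℝ} (hδ : 0 < δ) :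
    ∫ t, |t| * ‖bandKernel ξ₀ hδ t‖ = (∫ t, |t| * ‖bandKernel 0 one_pos t‖) / δ := by
  have : ∀ t, |t| * ‖bandKernel ξ₀ hδ t‖ = |δ * t| * ‖bandKernel 0 one_pos (δ * t)‖ := by
    intro t
    rw [norm_bandKernel ξ₀ hδ, abs_mul, abs_of_pos hδ]
    ring
  simp only [this]
  rw [Measure.integral_comp_mul_left (fun t => |t| * ‖bandKernel 0 one_pos t‖),
    abs_of_pos (by positivity), smul_eq_mul, div_eq_inv_mul]

theorem integral_bandKernel_zero {δ : ℝ} (hδ : 0 < δ) : ∫ t, bandKernel 0 hδ t = 1 := by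
  have h := congrFun (fourier_bandKernel 0 hδ) 0
  rw [scaledCutoff_eq_one hδ (by simpa using hδ.le), SchwartzMap.fourier_coe,
    Real.fourier_eq'] at h
  simpa using h

/-- Translation is Lipschitz in `L¹` on smooth kernels: write the difference as the integral of the
derivative along the segment and use Fubini. The constant is the `L¹` norm of the derivative. -/
theorem exists_integral_norm_sub_translate_le (V : 𝓢(ℝ, ℂ)) :
    ∃ A : ℝ, 0 ≤ A ∧ ∀ σ : ℝ, ∫ τ, ‖V τ - V (τ - σ)‖ ≤ A * |σ| := by
  set W : 𝓢(ℝ, ℂ) := SchwartzMap.derivCLM ℂ ℂ V with hW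
  have hder : ∀ x, HasDerivAt V (W x) x := fun x => V.differentiableAt.hasDerivAt
  refine ⟨∫ τ, ‖W τ‖, by positivity, fun σ => ?_⟩
  have hpt : ∀ τ, ‖V τ - V (τ - σ)‖ ≤ ∫ θ in Ioc (0 : ℝ) 1, ‖W (τ - θ * σ)‖ * |σ| := by
    intro τ
    have h1 : ∀ θ ∈ uIcc (0 : ℝ) 1, HasDerivAt (fun θ : ℝ => V (τ - θ * σ))
        ((-σ) • W (τ - θ * σ)) θ := fun θ _ =>
      (hder (τ - θ * σ)).scomp θ
        (by simpa using ((hasDerivAt_id θ).mul_const σ).const_sub τ)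
    have h2 := intervalIntegral.integral_eq_sub_of_hasDerivAt h1
      (Continuous.intervalIntegrable (by fun_prop) _ _)
    simp only [one_mul, zero_mul, sub_zero] at h2
    rw [norm_sub_rev, ← h2, intervalIntegral.integral_of_le zero_le_one]
    refine (norm_integral_le_integral_norm _).trans_eq ?_
    refine integral_congr_ae (ae_of_all _ fun θ => ?_)
    simp [mul_comm]
  have hint : ∀ θ : ℝ, Integrable fun τ => ‖W (τ - θ * σ)‖ * |σ| := fun θ =>
    (W.integrable.comp_sub_right (θ * σ)).norm.mul_const _
  have hval : ∀ θ : ℝ, ∫ τ, ‖W (τ - θ * σ)‖ * |σ| = (∫ τ, ‖W τ‖) * |σ| := fun θ => by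
    rw [integral_mul_const, integral_sub_right_eq_self (fun τ => ‖W τ‖)]
  have hprod : Integrable (Function.uncurry fun τ θ : ℝ => ‖W (τ - θ * σ)‖ * |σ|)
      (volume.prod (volume.restrict (Ioc (0 : ℝ) 1))) := by
    rw [integrable_prod_iff']
    · refine ⟨ae_of_all _ fun θ => hint θ, ?_⟩
      have hc : ∀ θ : ℝ, ∫ τ, ‖Function.uncurry (fun τ θ : ℝ => ‖W (τ - θ * σ)‖ * |σ|) (τ, θ)‖
          = (∫ τ, ‖W τ‖) * |σ| := fun θ => by
        rw [← hval θ]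
        refine integral_congr_ae (ae_of_all _ fun τ => Real.norm_of_nonneg ?_)
        exact mul_nonneg (norm_nonneg _) (abs_nonneg _)
      simp only [hc]
      exact integrable_const _
    · exact (by fun_prop : Continuous (Function.uncurry fun τ θ : ℝ =>
        ‖W (τ - θ * σ)‖ * |σ|)).aestronglyMeasurable
  calc ∫ τ, ‖V τ - V (τ - σ)‖ ≤ ∫ τ, ∫ θ in Ioc (0 : ℝ) 1, ‖W (τ - θ * σ)‖ * |σ| :=
        integral_mono (V.integrable.sub (V.integrable.comp_sub_right σ)).norm
          hprod.integral_prod_left hpt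
    _ = ∫ θ in Ioc (0 : ℝ) 1, ∫ τ, ‖W (τ - θ * σ)‖ * |σ| := integral_integral_swap hprod
    _ = _ := by simp [hval]

/-! ### Ergodic frequencies -/

/-- `F` is averaged out at the frequency `ξ` by suitable integrable kernels. -/
def ErgodicAt (n : ℕ) (F : ℝ → X) (ξ : ℝ) : Prop :=
  ∀ ε : ℝ, 0 < ε → ∃ e : ℝ → ℂ, Ker (n + 1) e ∧
    ∫ s : ℝ, e s * Complex.exp (-(2 * Real.pi * Complex.I * ξ * s)) = 1 ∧
    AsympLE n (conv e F) ε

theorem norm_exp_I_mul (a b : ℝ) : ‖Complex.exp (-(2 * Real.pi * Complex.I * a * b))‖ = 1 := by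
  rw [Complex.norm_exp]
  simp

/-- A kernel `V` concentrated near `ξ₀` at scale `δ` makes `u = V * F` almost a pure oscillation: `u
(t - s)` is close to `exp (-2πiξ₀s) u t`, with error of order `δ|s|`. Averaging against an ergodic
kernel `e`, whose transform is `1` at `ξ₀`, gives `u ≈ e * u = V * (e * F)`, which is small. The
`L¹` norm of `V` does not grow as `δ` shrinks. -/
theorem asympLE_conv_bandKernel [CompleteSpace X] {n : ℕ} {F : ℝ → X} {C ξ₀ : ℝ}
    (hF : WBdd n F C) (h : ErgodicAt n F ξ₀) {ε : ℝ} (hε : 0 < ε) :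
    ∃ δ₀ : ℝ, 0 < δ₀ ∧ ∀ (δ : ℝ) (hδ : 0 < δ), δ < δ₀ →
      AsympLE n (conv (bandKernel ξ₀ hδ) F) ε := by
  set A : ℝ := ∫ t, ‖bandKernel 0 one_pos t‖ with hA
  obtain ⟨B, hB0, hB⟩ := exists_integral_norm_sub_translate_le (bandKernel 0 one_pos)
  obtain ⟨e, he, he1, heF⟩ := h (ε / (2 * (A + 1))) (by positivity)
  set E : ℝ := ∫ s, |s| * ‖e s‖ with hE
  -- The first moment of `e` must be finite even for `n = 0`; the extra power in `Ker (n + 1)`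
  -- provides this.
  have hEint : Integrable fun s => |s| * ‖e s‖ := by
    refine (he.of_le (Nat.le_add_left 1 n)).norm.mono'
      (by have := he.aestronglyMeasurable.norm; fun_prop) (ae_of_all _ fun s => ?_)
    rw [Real.norm_of_nonneg (by positivity), pow_one]
    gcongr
    linarith
  have hC := hF.nonneg
  have hen := he.of_le (Nat.le_succ n)
  -- Half of `ε` goes to `e * u`, half to the oscillation error `C * B * E * δ`.
  refine ⟨ε / (2 * (C * B * E + 1)), by positivity, fun δ hδ hδ' => ?_⟩
  set V := bandKernel ξ₀ hδ with hV
  have hkV := ker_schwartz n V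
  set u := conv V F with hu
  have hub := hF.conv hkV
  have h1 : AsympLE n (conv e u) (ε / (2 * (A + 1)) * A) := by
    rw [hu, conv_conv_comm hen hkV hF]
    convert heF.conv hkV (hF.conv hen) using 2
    exact (integral_norm_bandKernel ξ₀ hδ).symm
  have hshift : ∀ s : ℝ, AsympLE n
      (fun t => Complex.exp (-(2 * Real.pi * Complex.I * ξ₀ * s)) • u t - u (t - s))
      (C * (B * |δ * s|)) := by
    intro s
    set D : ℝ → ℂ := fun r =>
      Complex.exp (-(2 * Real.pi * Complex.I * ξ₀ * s)) * V r - V (r - s) with hD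
    have hkT : Ker n fun r => V (r - s) := by
      refine Ker.of_norm (by fun_prop) (((hkV.norm.comp_sub_right s).const_mul
        ((1 + |s|) ^ n)).mono' (by fun_prop) (ae_of_all _ fun r => ?_))
      rw [Real.norm_of_nonneg (by positivity)]
      have := weight_sub_le n (r - s) (-s)
      rw [sub_neg_eq_add, sub_add_cancel, abs_neg] at this
      calc _ ≤ ((1 + |r - s|) ^ n * (1 + |s|) ^ n) * ‖V (r - s)‖ := by gcongr
        _ = _ := by ring
    have hkD : Ker n D := by
      have := (hkV.smul (Complex.exp (-(2 * Real.pi * Complex.I * ξ₀ * s)))).sub hkT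
      refine this.congr (ae_of_all _ fun r => ?_)
      simp only [hD, Pi.sub_apply, Pi.smul_apply, smul_sub, smul_eq_mul, Complex.real_smul]
      ring
    -- After removal of the modulation and rescaling by `δ`, this is the `L¹` distance between the
    -- reference kernel and its translate by `δ * s`.
    have hDn : ∫ r, ‖D r‖ ≤ B * |δ * s| := by
      refine le_trans (le_of_eq ?_) (hB (δ * s))
      have h3 : ∀ r, ‖D r‖ = δ * ‖bandKernel 0 one_pos (δ * r)
          - bandKernel 0 one_pos (δ * r - δ * s)‖ := by
        intro r
        have : D r = Complex.exp (-(2 * Real.pi * Complex.I * ξ₀ * (s - r : ℝ)))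
            * (δ * (bandKernel 0 one_pos (δ * r) - bandKernel 0 one_pos (δ * r - δ * s))) := by
          simp only [hD, hV]
          rw [bandKernel_apply ξ₀ hδ r, bandKernel_apply ξ₀ hδ (r - s), ← mul_assoc,
            ← Complex.exp_add, mul_sub, mul_sub, mul_sub]
          congr 2
          · congr 1
            push_cast
            ring
          · congr 1
            push_cast
            ring
        rw [this, norm_mul, norm_exp_I_mul, one_mul, norm_mul, Complex.norm_real,
          Real.norm_of_nonneg hδ.le]
      simp only [h3]
      rw [integral_const_mul, Measure.integral_comp_mul_left (fun r =>
        ‖bandKernel 0 one_pos r - bandKernel 0 one_pos (r - δ * s)‖),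
        abs_of_pos (by positivity), smul_eq_mul, mul_inv_cancel_left₀ hδ.ne']
    have h4 : conv D F = fun t =>
        Complex.exp (-(2 * Real.pi * Complex.I * ξ₀ * s)) • u t - u (t - s) := by
      ext t
      have h5 : u (t - s) = ∫ r, V (r - s) • F (t - r) := by
        have := integral_sub_right_eq_self (μ := volume) (fun r => V r • F (t - s - r)) s
        simp only [sub_sub_sub_cancel_right] at this
        exact this.symm
      rw [h5, hu]
      simp only [conv]
      rw [← integral_smul]
      refine Eq.trans ?_ (integral_sub ((integrable_conv hkV hF t).smul
        (Complex.exp (-(2 * Real.pi * Complex.I * ξ₀ * s)))) (integrable_conv hkT hF t))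
      refine integral_congr_ae (ae_of_all _ fun r => ?_)
      simp only [hD, sub_smul, smul_smul]
    rw [← h4]
    exact (hF.asympLE.conv hkD hF).mono (by gcongr)
  set K : ℝ := C * ∫ s : ℝ, (1 + |s|) ^ n * ‖V s‖ with hK
  have hexp : Continuous fun s : ℝ => Complex.exp (-(2 * Real.pi * Complex.I * ξ₀ * s)) := by
    fun_prop
  have hi1 : ∀ t, Integrable fun s => (e s * Complex.exp (-(2 * Real.pi * Complex.I * ξ₀ * s))) •
      u t := fun t => by
    refine Integrable.smul_const (hen.integrable.norm.mono'
      (hen.aestronglyMeasurable.mul hexp.aestronglyMeasurable) (ae_of_all _ fun s => ?_)) _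
    rw [Pi.mul_apply, norm_mul, norm_exp_I_mul, mul_one]
  have hi2 : ∀ t, Integrable fun s => e s • u (t - s) := integrable_conv hen hub
  have hi3 : ∀ s t, e s • (Complex.exp (-(2 * Real.pi * Complex.I * ξ₀ * s)) • u t - u (t - s))
      = (e s * Complex.exp (-(2 * Real.pi * Complex.I * ξ₀ * s))) • u t - e s • u (t - s) :=
    fun s t => by rw [smul_sub, smul_smul]
  have h2 : AsympLE n (fun t => ∫ s, e s •
      (Complex.exp (-(2 * Real.pi * Complex.I * ξ₀ * s)) • u t - u (t - s))) (ε / 2) := by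
    have h6 := AsympLE.integral (μ := volume) (n := n) (F := fun s t => e s •
      (Complex.exp (-(2 * Real.pi * Complex.I * ξ₀ * s)) • u t - u (t - s)))
      (M := fun s => K * ‖e s‖ + K * ((1 + |s|) ^ n * ‖e s‖))
      (c := fun s => C * B * δ * (|s| * ‖e s‖))
      ((hen.integrable.norm.const_mul K).add (hen.norm.const_mul K)) (hEint.const_mul _)
      (.of_forall fun t => ?_) ?_ (ae_of_all _ fun s => ?_)
    · rw [integral_const_mul] at h6
      refine h6.mono ?_
      rw [lt_div_iff₀ (by positivity)] at hδ'
      rw [← hE]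
      nlinarith
    · simp only [hi3]
      exact ((hi1 t).sub (hi2 t)).1
    · filter_upwards [eventually_ge_atTop 0] with t ht
      refine ae_of_all _ fun s => ?_
      have h7 := hub.2 t
      have h8 := hub.norm_sub_le t s
      rw [abs_of_nonneg ht] at h7 h8
      rw [norm_smul]
      calc ‖e s‖ * ‖Complex.exp (-(2 * Real.pi * Complex.I * ξ₀ * s)) • u t - u (t - s)‖
          ≤ ‖e s‖ * (K * (1 + t) ^ n + K * ((1 + t) ^ n * (1 + |s|) ^ n)) := by
            gcongr
            refine (norm_sub_le _ _).trans (add_le_add ?_ h8)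
            rw [norm_smul, norm_exp_I_mul, one_mul]
            exact h7
        _ = _ := by ring
    · convert (hshift s).const_smul (e s) using 1
      rw [abs_mul, abs_of_pos hδ]
      ring
  have h3 := h1.add h2
  refine (h3.mono ?_).congr (.of_forall fun t => ?_)
  · have : ε / (2 * (A + 1)) * A ≤ ε / 2 := by
      rw [div_mul_eq_mul_div, div_le_div_iff₀ (by positivity) (by positivity)]
      nlinarith
    linarith
  · simp only [hi3]
    rw [integral_sub (hi1 t) (hi2 t), integral_smul_const, he1, one_smul]
    simp [conv]

/-- An isolated point of the set of non regular frequencies is not ergodic. -/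
theorem mem_regularFreq_of_isolated [CompleteSpace X] {n : ℕ} {F : ℝ → X} {C ξ₀ r : ℝ}
    (hF : WBdd n F C) (hr : 0 < r) (hreg : ∀ ξ, ξ ≠ ξ₀ → |ξ - ξ₀| < r → ξ ∈ regularFreq n F)
    (h : ErgodicAt n F ξ₀) : ξ₀ ∈ regularFreq n F := by
  -- The cutoff of scale `r / 4` is supported within distance `r / 2` of `ξ₀`, hence inside the
  -- punctured neighbourhood of regular frequencies together with `ξ₀`.
  have hr4 : 0 < r / 4 := by positivity
  set k := bandKernel ξ₀ hr4 with hk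
  refine ⟨k, ?_, ?_⟩
  · set A : ℝ := ∫ t, ‖k t‖ with hA
    refine AsympLE.of_forall_gt fun ε hε => ?_
    obtain ⟨δ₀, hδ₀, hδF⟩ := asympLE_conv_bandKernel hF h (ε := ε / (A + 1)) (by positivity)
    have hδ : 0 < δ₀ / 2 := by positivity
    set V := bandKernel ξ₀ hδ with hV
    have h1 : AsympLE n (conv (schwartzConv k V) F) (ε / (A + 1) * A) := by
      rw [coe_schwartzConv, conv_assoc (ker_schwartz n k) (ker_schwartz n V) hF]
      exact (hδF _ hδ (by linarith)).conv (ker_schwartz n k) (hF.conv (ker_schwartz n V))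
    -- Split `k = k * V + m`. The first piece is small by ergodicity; the transform of `m` vanishes
    -- near `ξ₀`, so its support consists of regular frequencies only.
    set m : 𝓢(ℝ, ℂ) := k - schwartzConv k V with hm
    have hmft : ∀ ξ, ft m ξ = scaledCutoff ξ₀ (r / 4) ξ * (1 - scaledCutoff ξ₀ (δ₀ / 2) ξ) := by
      intro ξ
      have h2 : ft m = ft k - ft (schwartzConv k V) :=
        map_sub (FourierTransform.fourierCLM ℂ 𝓢(ℝ, ℂ)) _ _
      rw [h2, sub_apply, fourier_schwartzConv, fourier_bandKernel, fourier_bandKernel]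
      ring
    have hsupp : tsupport (ft m) ⊆ Metric.closedBall ξ₀ (2 * (r / 4)) \ Metric.ball ξ₀ (δ₀ / 2) := by
      refine closure_minimal (fun ξ hξ => ?_) (Metric.isClosed_closedBall.sdiff Metric.isOpen_ball)
      rw [Function.mem_support, hmft] at hξ
      constructor
      · rw [Metric.mem_closedBall, Real.dist_eq]
        by_contra hcon
        exact hξ (by rw [scaledCutoff_eq_zero hr4 (not_le.1 hcon).le, zero_mul])
      · rw [Metric.mem_ball, Real.dist_eq]
        intro hcon
        exact hξ (by rw [scaledCutoff_eq_one hδ hcon.le, sub_self, mul_zero])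
    have h2 : m ∈ nullKer n F := by
      refine mem_nullKer_of_tsupport_subset hF ?_ ?_
      · exact HasCompactSupport.of_support_subset_isCompact (isCompact_closedBall ξ₀ (2 * (r / 4)))
          ((subset_tsupport _).trans (hsupp.trans sdiff_subset))
      · intro ξ hξ
        obtain ⟨h3, h4⟩ := hsupp hξ
        rw [Metric.mem_closedBall, Real.dist_eq] at h3
        refine hreg ξ (fun h5 => h4 ?_) (by linarith)
        rw [h5]
        exact Metric.mem_ball_self hδ
    have h3 : k = schwartzConv k V + m := by rw [hm]; abel
    rw [h3, conv_add_left hF]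
    refine (h1.add h2).mono ?_
    rw [add_zero, zero_add, div_mul_eq_mul_div, div_le_iff₀ (by positivity)]
    nlinarith
  · rw [fourier_bandKernel, scaledCutoff_eq_one hr4 (by simpa using hr4.le)]
    exact one_ne_zero

/-! ### Isolated points and the removal of the band limit -/

/-- Otherwise `S` would be a nonempty perfect set and would contain an injective image of Cantor
space, which is uncountable. -/
theorem exists_isolated_of_countable {S : Set ℝ} (hS : IsClosed S) (hc : S.Countable)
    (hne : S.Nonempty) : ∃ x ∈ S, ∃ r > 0, ∀ y, y ≠ x → |y - x| < r → y ∉ S := by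
  by_contra! hcon
  have hP : Perfect S := by
    refine ⟨hS, preperfect_iff_nhds.2 fun x hx U hU => ?_⟩
    obtain ⟨r, hr, hrU⟩ := Metric.mem_nhds_iff.1 hU
    obtain ⟨y, hyx, hyr, hyS⟩ := hcon x hx r hr
    exact ⟨y, ⟨hrU (by rwa [Metric.mem_ball, Real.dist_eq]), hyS⟩, hyx⟩
  obtain ⟨f, hfS, -, hfi⟩ := hP.exists_nat_bool_injection hne
  have h1 : (range f).Countable := hc.mono hfS
  have h2 : Countable (ℕ → Bool) := by
    have : Countable (range f) := h1
    exact (Equiv.ofInjective f hfi).countable_iff.2 this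
  have h3 := Cardinal.mk_le_aleph0_iff.2 h2
  simp only [Cardinal.mk_pi, Cardinal.mk_fintype, Fintype.card_bool, Nat.cast_ofNat,
    Cardinal.prod_const, Cardinal.lift_id, Cardinal.mk_nat] at h3
  exact Cardinal.aleph0_lt_continuum.not_ge (by simpa using h3)

/-- If all frequencies are regular, a slowly oscillating function is negligible. -/
theorem asympLE_zero_of_regularFreq [CompleteSpace X] {n : ℕ} {F : ℝ → X} {C : ℝ}
    (hF : WBdd n F C) (hreg : ∀ ξ, ξ ∈ regularFreq n F)
    (hosc : ∀ ε : ℝ, 0 < ε → ∃ d : ℝ, 0 < d ∧ ∀ s : ℝ, |s| < d →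
      AsympLE n (fun t => F t - F (t - s)) ε) : AsympLE n F 0 := by
  refine AsympLE.of_forall_gt fun ε hε => ?_
  rw [zero_add]
  set A : ℝ := ∫ t, ‖bandKernel 0 one_pos t‖ with hA
  set B : ℝ := ∫ t, |t| * ‖bandKernel 0 one_pos t‖ with hB
  have hC := hF.nonneg
  set ε' := ε / (2 * (A + 1)) with hε'
  obtain ⟨d, hd, hdF⟩ := hosc ε' (by positivity)
  -- Chosen so that the tail term `2 * C / d * (B / δ)` is at most `ε / 2`: wide band kernels
  -- concentrate near time `0`.
  set δ : ℝ := 4 * (C * B + 1) / (d * ε) with hδdef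
  have hδ : 0 < δ := by positivity
  set V := bandKernel 0 hδ with hV
  have hkV := ker_schwartz n V
  have h1 : AsympLE n (conv V F) 0 := by
    refine mem_nullKer_of_tsupport_subset hF ?_ fun ξ _ => hreg ξ
    rw [fourier_bandKernel]
    exact hasCompactSupport_scaledCutoff hδ
  have hi : ∀ t, Integrable fun s => V s • (F t - F (t - s)) := fun t => by
    simp only [smul_sub]
    exact (V.integrable.smul_const _).sub (integrable_conv hkV hF t)
  have hVabs : Integrable fun s => |s| * ‖V s‖ := by
    simpa using V.integrable_pow_mul volume 1
  -- This integral is `F - V * F`, because `V` has integral `1`. For `|s| < d` slow oscillation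
  -- gives `ε'`; for larger `s` the trivial bound `2 * C` is at most `2 * C * |s| / d`, which is
  -- integrable against `V`.
  have h2 : AsympLE n (fun t => ∫ s, V s • (F t - F (t - s)))
      (∫ s, (ε' * ‖V s‖ + 2 * C / d * (|s| * ‖V s‖))) := by
    refine AsympLE.integral (M := fun s => C * ‖V s‖ + C * ((1 + |s|) ^ n * ‖V s‖))
      ((V.integrable.norm.const_mul _).add (hkV.norm.const_mul _))
      ((V.integrable.norm.const_mul _).add (hVabs.const_mul _)) (.of_forall fun t => (hi t).1) ?_
      (ae_of_all _ fun s => ?_)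
    · filter_upwards [eventually_ge_atTop 0] with t ht
      refine ae_of_all _ fun s => ?_
      have h7 := hF.2 t
      have h8 := hF.norm_sub_le t s
      rw [abs_of_nonneg ht] at h7 h8
      rw [norm_smul]
      calc ‖V s‖ * ‖F t - F (t - s)‖
          ≤ ‖V s‖ * (C * (1 + t) ^ n + C * ((1 + t) ^ n * (1 + |s|) ^ n)) := by
            gcongr
            exact (norm_sub_le _ _).trans (add_le_add h7 h8)
        _ = _ := by ring
    · have hε'0 : 0 < ε' := by positivity
      by_cases hs : |s| < d
      · refine ((hdF s hs).const_smul (V s)).mono ?_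
        have : 0 ≤ 2 * C / d * (|s| * ‖V s‖) := by positivity
        linarith
      · have h9 := hF.asympLE.add ((hF.asympLE.comp_sub s).const_smul (-1))
        simp only [neg_smul, one_smul, ← sub_eq_add_neg, norm_neg, norm_one, one_mul] at h9
        refine (h9.const_smul (V s)).mono ?_
        have h10 : 1 ≤ |s| / d := by rwa [le_div_iff₀ hd, one_mul, ← not_lt]
        have h11 : 0 ≤ ε' * ‖V s‖ := by positivity
        have h12 : 2 * C * ‖V s‖ * 1 ≤ 2 * C * ‖V s‖ * (|s| / d) := by gcongr
        have h13 : 2 * C * ‖V s‖ * (|s| / d) = 2 * C / d * (|s| * ‖V s‖) := by ring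
        linarith
  refine ((h1.add h2).mono ?_).congr (.of_forall fun t => ?_)
  · rw [zero_add, integral_add (V.integrable.norm.const_mul _) (hVabs.const_mul _),
      integral_const_mul, integral_const_mul, integral_norm_bandKernel,
      integral_abs_mul_norm_bandKernel, ← hA, ← hB]
    have h3 : ε' * A ≤ ε / 2 := by
      rw [hε', div_mul_eq_mul_div, div_le_div_iff₀ (by positivity) (by positivity)]
      nlinarith
    have h4 : 2 * C / d * (B / δ) ≤ ε / 2 := by
      rw [hδdef, div_mul_div_comm, div_le_iff₀ (by positivity)]
      have : ε / 2 * (d * (4 * (C * B + 1) / (d * ε))) = 2 * (C * B + 1) := by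
        field_simp
        ring
      rw [this]
      linarith
    linarith
  · have h5 : ∫ s, V s • (F t - F (t - s)) = F t - conv V F t := by
      simp only [smul_sub]
      rw [integral_sub (V.integrable.smul_const _) (integrable_conv hkV hF t),
        integral_smul_const, integral_bandKernel_zero, one_smul]
      rfl
    simp only [h5]
    abel

/-! ### Boundary behaviour of the Laplace transform and the Tauberian theorem -/

/-- The Laplace transform. -/
def laplace (F : ℝ → X) (z : ℂ) : X := ∫ s in Ioi (0 : ℝ), Complex.exp (-(z * s)) • F s

theorem integrableOn_weight_mul_exp (n : ℕ) {η : ℝ} (hη : 0 < η) :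
    IntegrableOn (fun s : ℝ => (1 + s) ^ n * Real.exp (-(η * s))) (Ioi 0) := by
  have h0 := integrableOn_rpow_mul_exp_neg_mul_rpow (s := 0) (by norm_num) one_pos hη
  have h1 := integrableOn_rpow_mul_exp_neg_mul_rpow (s := n)
    (by have : (0 : ℝ) ≤ n := n.cast_nonneg
        linarith) one_pos hη
  refine ((h0.add h1).const_mul (2 ^ (n - 1))).mono' (by fun_prop) ?_
  refine (ae_restrict_iff' measurableSet_Ioi).2 (ae_of_all _ fun s (hs : 0 < s) => ?_)
  rw [Real.norm_of_nonneg (by positivity)]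
  simp only [Pi.add_apply, Real.rpow_zero, Real.rpow_one, Real.rpow_natCast]
  calc (1 + s) ^ n * Real.exp (-(η * s))
      ≤ 2 ^ (n - 1) * (1 ^ n + s ^ n) * Real.exp (-(η * s)) := by
        gcongr
        exact add_pow_le zero_le_one hs.le n
    _ = _ := by rw [one_pow, neg_mul]; ring

theorem norm_exp_neg_mul (z : ℂ) (s : ℝ) :
    ‖Complex.exp (-(z * s))‖ = Real.exp (-(z.re * s)) := by
  rw [Complex.norm_exp]
  simp

/-- A frequency at which the Laplace transform extends continuously is regular. -/
theorem mem_regularFreq_of_laplace [CompleteSpace X] {n : ℕ} {F : ℝ → X} {C ξ₀ : ℝ}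
    (hF : WBdd n F C) (hF0 : ∀ t < 0, F t = 0) {H : ℂ → X}
    (hH : ∀ᶠ z in 𝓝 (2 * Real.pi * Complex.I * ξ₀), ContinuousAt H z)
    (hL : ∀ᶠ z in 𝓝 (2 * Real.pi * Complex.I * ξ₀), 0 < z.re → laplace F z = H z) :
    ξ₀ ∈ regularFreq n F := by
  set z₀ : ℂ := 2 * Real.pi * Complex.I * ξ₀ with hz₀
  set M : ℝ := ‖H z₀‖ + 1 with hM
  have hHM : ∀ᶠ z in 𝓝 z₀, ‖H z‖ ≤ M :=
    (hH.self_of_nhds.norm.eventually_lt_const (lt_add_one _)).mono fun z hz => hz.le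
  obtain ⟨r, hr, hball⟩ := Metric.eventually_nhds_iff.1 (hH.and (hL.and hHM))
  have hπ := Real.pi_pos
  -- The cutoff has radius `2 * δ`, so on the vertical axis it covers a distance `4 * π * δ = r /
  -- 4`; with `η < r / 2` all points stay in the ball of radius `r`.
  set δ : ℝ := r / (16 * Real.pi) with hδdef
  have hδ : 0 < δ := by positivity
  set χ : ℝ → ℂ := scaledCutoff ξ₀ δ with hχ
  set k := bandKernel ξ₀ hδ with hk
  set p : ℝ → ℝ → ℂ := fun η ξ => η + 2 * Real.pi * Complex.I * ξ with hp
  have hpball : ∀ η ξ : ℝ, 0 ≤ η → η < r / 2 → ξ ∈ tsupport χ → dist (p η ξ) z₀ < r := by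
    intro η ξ h0 h1 h2
    have h3 := tsupport_scaledCutoff hδ h2
    rw [Metric.mem_closedBall, Real.dist_eq] at h3
    have h4 : p η ξ - z₀ = (η : ℂ) + 2 * Real.pi * Complex.I * ((ξ - ξ₀ : ℝ) : ℂ) := by
      simp only [hp, hz₀]
      push_cast
      ring
    rw [dist_eq_norm, h4]
    have h5 : ‖(η : ℂ) + 2 * Real.pi * Complex.I * ((ξ - ξ₀ : ℝ) : ℂ)‖
        ≤ η + 2 * Real.pi * |ξ - ξ₀| := by
      refine (norm_add_le _ _).trans_eq ?_
      simp only [norm_mul, Complex.norm_real, Complex.norm_I, Real.norm_eq_abs, abs_of_nonneg h0,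
        abs_of_pos hπ, Complex.norm_ofNat, mul_one]
    have h6 : 2 * Real.pi * |ξ - ξ₀| ≤ 2 * Real.pi * (2 * δ) := by gcongr
    have h7 : 2 * Real.pi * (2 * δ) = r / 4 := by
      rw [hδdef]
      field_simp
      ring
    linarith
  have hcont : ∀ η : ℝ, 0 ≤ η → η < r / 2 → Continuous fun ξ => χ ξ • H (p η ξ) := by
    intro η h0 h1
    refine continuous_of_tsupport fun ξ hξ => ?_
    have hξ' : ξ ∈ tsupport χ := tsupport_smul_subset_left _ _ hξ
    exact (contDiff_scaledCutoff ξ₀ δ).continuous.continuousAt.smul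
      (ContinuousAt.comp (f := fun ξ => p η ξ) (hball (hpball η ξ h0 h1 hξ')).1 (by fun_prop))
  set e : ℝ → ℝ → ℂ := fun ξ t => Complex.exp (2 * Real.pi * Complex.I * ξ * t) with he
  have hen : ∀ ξ t, ‖e ξ t‖ = 1 := fun ξ t => by
    simp [he, Complex.norm_exp]
  have hχi : Integrable χ :=
    (contDiff_scaledCutoff ξ₀ δ).continuous.integrable_of_hasCompactSupport
      (hasCompactSupport_scaledCutoff hδ)
  have hconvF : ∀ t, conv k F t = ∫ s in Ioi (0 : ℝ), k (t - s) • F s := by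
    intro t
    rw [conv, ← integral_sub_left_eq_self _ volume t]
    simp only [sub_sub_cancel]
    rw [← integral_Ici_eq_integral_Ioi]
    refine (setIntegral_eq_integral_of_forall_compl_eq_zero fun s hs => ?_).symm
    rw [hF0 s (not_le.1 hs), smul_zero]
  -- Damping by `exp (-ηs)` makes the double integral absolutely convergent, so Fubini expresses the
  -- damped convolution by values of the Laplace transform on the line `Re z = η`.
  have step1 : ∀ η : ℝ, 0 < η → η < r / 2 → ∀ t,
      ∫ s in Ioi (0 : ℝ), k (t - s) • (Real.exp (-(η * s)) : ℂ) • F s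
        = ∫ ξ, e ξ t • χ ξ • H (p η ξ) := by
    intro η h0 h1 t
    have hint : Integrable (Function.uncurry fun s ξ : ℝ =>
        (e ξ (t - s) * χ ξ) • (Real.exp (-(η * s)) : ℂ) • F s)
        ((volume.restrict (Ioi (0 : ℝ))).prod volume) := by
      have hw := (integrableOn_weight_mul_exp n h0).const_mul C
      refine (hw.mul_prod hχi.norm).mono' ?_ ?_
      · refine AEStronglyMeasurable.smul ?_ ?_
        · refine Continuous.aestronglyMeasurable ?_
          have := (contDiff_scaledCutoff ξ₀ δ).continuous
          fun_prop
        · refine AEStronglyMeasurable.smul (Continuous.aestronglyMeasurable (by fun_prop)) ?_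
          exact hF.1.restrict.comp_fst
      · have h3 : ∀ᵐ s ∂(volume.restrict (Ioi (0 : ℝ))), (0 : ℝ) < s :=
          ae_restrict_mem measurableSet_Ioi
        filter_upwards [Measure.quasiMeasurePreserving_fst.ae h3] with q hq
        simp only [Function.uncurry]
        rw [norm_smul, norm_smul, norm_mul, hen, one_mul, Complex.norm_real, Real.norm_eq_abs,
          Real.abs_exp]
        have h4 := hF.2 q.1
        rw [abs_of_pos hq] at h4
        calc ‖χ q.2‖ * (Real.exp (-(η * q.1)) * ‖F q.1‖)
            ≤ ‖χ q.2‖ * (Real.exp (-(η * q.1)) * (C * (1 + q.1) ^ n)) := by gcongr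
          _ = _ := by ring
    calc _ = ∫ s in Ioi (0 : ℝ), ∫ ξ, (e ξ (t - s) * χ ξ) • (Real.exp (-(η * s)) : ℂ) • F s := by
          refine integral_congr_ae (ae_of_all _ fun s => ?_)
          simp only [hk]
          rw [bandKernel_eq_integral, ← integral_smul_const]
      _ = ∫ ξ, ∫ s in Ioi (0 : ℝ), (e ξ (t - s) * χ ξ) • (Real.exp (-(η * s)) : ℂ) • F s :=
          integral_integral_swap hint
      _ = _ := by
          refine integral_congr_ae (ae_of_all _ fun ξ => ?_)
          by_cases hξ : ξ ∈ tsupport χ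
          · have h5 := (hball (hpball η ξ h0.le h1 hξ)).2.1 (by simpa [hp] using h0)
            simp only
            rw [← h5, laplace, ← integral_smul, ← integral_smul]
            refine integral_congr_ae (ae_of_all _ fun s => ?_)
            simp only [smul_smul]
            congr 1
            rw [he, mul_right_comm, mul_assoc, mul_comm (χ ξ), ← mul_assoc, ← mul_assoc]
            congr 1
            simp only [Complex.ofReal_exp, hp]
            rw [← Complex.exp_add, ← Complex.exp_add]
            congr 1
            push_cast
            ring
          · have h6 : χ ξ = 0 := image_eq_zero_of_notMem_tsupport hξ
            simp [h6]
  -- Both sides pass to the limit `η ↓ 0` by dominated convergence, `H` being bounded and continuous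
  -- on the relevant compact region.
  have step2 : ∀ t, conv k F t = ∫ ξ, e ξ t • χ ξ • H (p 0 ξ) := by
    intro t
    have hk1 : Integrable fun s => k (t - s) • F s := by
      have := (integrable_conv (ker_schwartz n k) hF t).comp_sub_left t
      simpa using this
    have hev : ∀ᶠ η : ℝ in 𝓝[>] 0, 0 < η ∧ η < r / 2 :=
      Ioo_mem_nhdsGT (by positivity)
    have t1 : Tendsto (fun η : ℝ =>
        ∫ s in Ioi (0 : ℝ), k (t - s) • (Real.exp (-(η * s)) : ℂ) • F s) (𝓝[>] 0)
        (𝓝 (∫ s in Ioi (0 : ℝ), k (t - s) • F s)) := by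
      refine tendsto_integral_filter_of_dominated_convergence (fun s => ‖k (t - s) • F s‖) ?_ ?_
        hk1.norm.integrableOn ?_
      · refine .of_forall fun η => ?_
        exact (Continuous.aestronglyMeasurable (by fun_prop)).smul
          ((Continuous.aestronglyMeasurable (by fun_prop)).smul hF.1.restrict)
      · filter_upwards [hev] with η hη
        refine (ae_restrict_iff' measurableSet_Ioi).2 (ae_of_all _ fun s (hs : 0 < s) => ?_)
        rw [norm_smul, norm_smul, norm_smul, Complex.norm_real, Real.norm_eq_abs, Real.abs_exp]
        have : Real.exp (-(η * s)) ≤ 1 := Real.exp_le_one_iff.2 (by nlinarith [hη.1])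
        gcongr
        exact mul_le_of_le_one_left (norm_nonneg _) this
      · refine ae_of_all _ fun s => ?_
        have : Tendsto (fun η : ℝ => (Real.exp (-(η * s)) : ℂ)) (𝓝 0) (𝓝 ((Real.exp (-(0 * s)) : ℝ) : ℂ)) :=
          (by fun_prop : Continuous fun η : ℝ => (Real.exp (-(η * s)) : ℂ)).tendsto 0
        simp only [zero_mul, neg_zero, Real.exp_zero, Complex.ofReal_one] at this
        have := ((this.mono_left (nhdsWithin_le_nhds (s := Ioi (0 : ℝ)))).smul_const (F s)).const_smul (k (t - s))
        simpa using this
    have t2 : Tendsto (fun η : ℝ => ∫ ξ, e ξ t • χ ξ • H (p η ξ)) (𝓝[>] 0)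
        (𝓝 (∫ ξ, e ξ t • χ ξ • H (p 0 ξ))) := by
      refine tendsto_integral_filter_of_dominated_convergence (fun ξ => ‖χ ξ‖ * M) ?_ ?_
        (hχi.norm.mul_const M) ?_
      · filter_upwards [hev] with η hη
        exact ((by fun_prop : Continuous fun ξ => e ξ t).smul
          (hcont η hη.1.le hη.2)).aestronglyMeasurable
      · filter_upwards [hev] with η hη
        refine ae_of_all _ fun ξ => ?_
        rw [norm_smul, norm_smul, hen, one_mul]
        by_cases hξ : ξ ∈ tsupport χ
        · gcongr
          exact (hball (hpball η ξ hη.1.le hη.2 hξ)).2.2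
        · have h6 : χ ξ = 0 := image_eq_zero_of_notMem_tsupport hξ
          simp [h6]
      · refine ae_of_all _ fun ξ => ?_
        by_cases hξ : ξ ∈ tsupport χ
        · have h7 : ContinuousAt (fun η : ℝ => H (p η ξ)) 0 :=
            ContinuousAt.comp (f := fun η : ℝ => p η ξ)
              (hball (hpball 0 ξ le_rfl (by positivity) hξ)).1 (by fun_prop)
          exact ((h7.tendsto.mono_left nhdsWithin_le_nhds).const_smul (χ ξ)).const_smul (e ξ t)
        · have h6 : χ ξ = 0 := image_eq_zero_of_notMem_tsupport hξ
          simp [h6]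
    rw [hconvF]
    refine tendsto_nhds_unique t1 (t2.congr' ?_)
    filter_upwards [hev] with η hη
    exact (step1 η hη.1 hη.2 t).symm
  refine ⟨k, AsympLE.of_tendsto_zero ?_, ?_⟩
  -- Riemann-Lebesgue: `k * F` even tends to `0` without any weight.
  · have h1 := (Real.tendsto_integral_exp_smul_cocompact fun ξ => χ ξ • H (p 0 ξ)).comp
      ((tendsto_neg_atTop_atBot (G := ℝ)).mono_right atBot_le_cocompact)
    refine h1.congr fun t => ?_
    rw [step2 t]
    refine integral_congr_ae (ae_of_all _ fun ξ => ?_)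
    simp only [he, Circle.smul_def, Real.fourierChar_apply]
    congr 2
    push_cast
    ring
  · rw [fourier_bandKernel, scaledCutoff_eq_one hδ (by simpa using hδ.le)]
    exact one_ne_zero

/-- A Tauberian theorem with countably many ergodic singularities on the imaginary axis. -/
theorem asympLE_zero_of_countable [CompleteSpace X] {n : ℕ} {F : ℝ → X} {C : ℝ}
    (hF : WBdd n F C) (hF0 : ∀ t < 0, F t = 0)
    (hosc : ∀ ε : ℝ, 0 < ε → ∃ d : ℝ, 0 < d ∧ ∀ s : ℝ, |s| < d →
      AsympLE n (fun t => F t - F (t - s)) ε)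
    {E : Set ℝ} (hE : E.Countable) (herg : ∀ ξ ∈ E, ErgodicAt n F ξ)
    (hreg : ∀ ξ ∉ E, ∃ H : ℂ → X,
      (∀ᶠ z in 𝓝 (2 * Real.pi * Complex.I * ξ), ContinuousAt H z) ∧
      ∀ᶠ z in 𝓝 (2 * Real.pi * Complex.I * ξ), 0 < z.re → laplace F z = H z) :
    AsympLE n F 0 := by
  have hsub : (regularFreq n F)ᶜ ⊆ E := fun ξ hξ => by
    by_contra hcon
    obtain ⟨H, h1, h2⟩ := hreg ξ hcon
    exact hξ (mem_regularFreq_of_laplace hF hF0 h1 h2)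
  refine asympLE_zero_of_regularFreq hF (fun ξ => ?_) hosc
  by_contra hξ
  obtain ⟨x, hx, r, hr, hxr⟩ := exists_isolated_of_countable
    (isOpen_regularFreq n F).isClosed_compl (hE.mono hsub) ⟨ξ, hξ⟩
  exact hx (mem_regularFreq_of_isolated hF hr
    (fun y hy hyr => by simpa using hxr y hy hyr) (herg x (hsub hx)))

/-! ### Fractional kernels and fractional integrals -/

/-- The kernel `g β`, extended by zero to the negative half-line. -/
def gz (β t : ℝ) : ℝ := (Ioi (0 : ℝ)).indicator (g β) t

theorem gz_of_pos {β t : ℝ} (ht : 0 < t) : gz β t = g β t := indicator_of_mem ht _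

theorem gz_of_nonpos {β t : ℝ} (ht : t ≤ 0) : gz β t = 0 :=
  indicator_of_notMem (not_lt.2 ht) _

theorem g_nonneg {β t : ℝ} (hβ : 0 < β) (ht : 0 ≤ t) : 0 ≤ g β t :=
  div_nonneg (Real.rpow_nonneg ht _) (Real.Gamma_pos_of_pos hβ).le

theorem gz_nonneg {β : ℝ} (hβ : 0 < β) (t : ℝ) : 0 ≤ gz β t :=
  indicator_nonneg (fun _ hx => g_nonneg hβ (le_of_lt hx)) t

@[fun_prop]
theorem measurable_g (β : ℝ) : Measurable (g β) := by
  unfold g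
  fun_prop

@[fun_prop]
theorem measurable_gz (β : ℝ) : Measurable (gz β) :=
  (measurable_g β).indicator measurableSet_Ioi

theorem gz_antitone {β : ℝ} (hβ1 : β ≤ 1) (hβ : 0 < β) {s t : ℝ} (hs : 0 < s) (hst : s ≤ t) :
    gz β t ≤ gz β s := by
  rw [gz_of_pos hs, gz_of_pos (hs.trans_le hst), g, g]
  exact div_le_div_of_nonneg_right (Real.rpow_le_rpow_of_nonpos hs hst (by linarith))
    (Real.Gamma_pos_of_pos hβ).le

theorem intervalIntegrable_g {β : ℝ} (hβ : 0 < β) (a b : ℝ) :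
    IntervalIntegrable (g β) volume a b :=
  (intervalIntegral.intervalIntegrable_rpow' (by linarith)).div_const _

theorem integral_g {β : ℝ} (hβ : 0 < β) (t : ℝ) :
    ∫ s in (0 : ℝ)..t, g β s = t ^ β / Real.Gamma (β + 1) := by
  unfold g
  rw [intervalIntegral.integral_div, integral_rpow (Or.inl (by linarith)), sub_add_cancel,
    Real.zero_rpow hβ.ne', sub_zero, Real.Gamma_add_one hβ.ne', div_div]

theorem integrableOn_gz_sub {β : ℝ} (hβ : 0 < β) (t : ℝ) :
    IntegrableOn (fun r => gz β (t - r)) (Ioi 0) := by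
  have h1 : Integrable ((Ioo 0 t).indicator (g β)) := by
    rw [integrable_indicator_iff measurableSet_Ioo]
    rcases le_or_gt t 0 with ht | ht
    · simp [Ioo_eq_empty (not_lt.2 ht)]
    · exact ((intervalIntegrable_iff_integrableOn_Ioo_of_le ht.le).1 (intervalIntegrable_g hβ 0 t))
  refine ((h1.comp_sub_left t).integrableOn (s := Ioi 0)).congr_fun (fun r (hr : 0 < r) => ?_)
    measurableSet_Ioi
  by_cases h : r < t
  · have h2 : t - r ∈ Ioo 0 t := ⟨by linarith, by linarith⟩
    simp only [gz_of_pos h2.1, indicator_of_mem h2]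
  · have h2 : t - r ∉ Ioo 0 t := fun h' => h (by linarith [h'.1])
    simp only [gz_of_nonpos (show t - r ≤ 0 by linarith), indicator_of_notMem h2]

theorem setIntegral_gz_smul {β a t : ℝ} (ha : a ≤ t) {B : Set ℝ} (hB : MeasurableSet B)
    (hB1 : Ioo a t ⊆ B) (hB2 : B ⊆ Ioi a) (u : ℝ → X) :
    ∫ r in B, gz β (t - r) • u r = ∫ r in a..t, g β (t - r) • u r := by
  rw [intervalIntegral.integral_of_le ha, integral_Ioc_eq_integral_Ioo,
    setIntegral_eq_of_subset_of_forall_sdiff_eq_zero hB hB1]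
  · refine setIntegral_congr_fun measurableSet_Ioo fun r hr => ?_
    simp only [gz_of_pos (sub_pos.2 hr.2)]
  · intro r hr
    have : t ≤ r := by
      by_contra h
      exact hr.2 ⟨hB2 hr.1, not_le.1 h⟩
    rw [gz_of_nonpos (by linarith), zero_smul]

/-- Since `gz` cuts off at the right place, the domain `B` may be chosen freely. Fractional
integrals at different times then share one domain, and double integrals live on a square. -/
theorem J_eq_setIntegral {β t : ℝ} (ht : 0 ≤ t) {B : Set ℝ} (hB : MeasurableSet B)
    (hB1 : Ioo 0 t ⊆ B) (hB2 : B ⊆ Ioi 0) (u : ℝ → X) :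
    J β u t = ∫ r in B, gz β (t - r) • u r :=
  (setIntegral_gz_smul ht hB hB1 hB2 u).symm

theorem setIntegral_gz_sub {β t a : ℝ} (hβ : 0 < β) (ht : a ≤ t) {B : Set ℝ} (hB : MeasurableSet B)
    (hB1 : Ioo a t ⊆ B) (hB2 : B ⊆ Ioi a) :
    ∫ r in B, gz β (t - r) = (t - a) ^ β / Real.Gamma (β + 1) := by
  have h : ∫ r in B, gz β (t - r) • (1 : ℂ) = ((∫ r in B, gz β (t - r) : ℝ) : ℂ) := by
    rw [← integral_complex_ofReal]
    simp
  have h2 := setIntegral_gz_smul (β := β) ht hB hB1 hB2 (fun _ => (1 : ℂ))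
  rw [h] at h2
  have h3 : ∫ r in a..t, g β (t - r) • (1 : ℂ) = ((∫ r in a..t, g β (t - r) : ℝ) : ℂ) := by
    rw [← intervalIntegral.integral_ofReal]
    simp
  rw [h3, Complex.ofReal_inj] at h2
  rw [h2, intervalIntegral.integral_comp_sub_left (g β) t, sub_self, integral_g hβ]

theorem norm_J_le {β t M : ℝ} (hβ : 0 < β) (ht : 0 ≤ t) {u : ℝ → X}
    (hu : ∀ s, 0 < s → s ≤ t → ‖u s‖ ≤ M) :
    ‖J β u t‖ ≤ M * (t ^ β / Real.Gamma (β + 1)) := by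
  have hs : Ioo 0 t ⊆ Ioc 0 t := Ioo_subset_Ioc_self
  have hs2 : Ioc 0 t ⊆ Ioi 0 := Ioc_subset_Ioi_self
  rw [J_eq_setIntegral ht measurableSet_Ioc hs hs2]
  have h0 := setIntegral_gz_sub hβ ht measurableSet_Ioc hs hs2
  rw [sub_zero] at h0
  rw [← h0, mul_comm, ← integral_mul_const]
  refine norm_integral_le_of_norm_le (((integrableOn_gz_sub hβ t).mono_set hs2).mul_const M)
    ((ae_restrict_iff' measurableSet_Ioc).2 (ae_of_all _ fun s hs => ?_))
  rw [norm_smul, Real.norm_of_nonneg (gz_nonneg hβ _)]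
  exact mul_le_mul_of_nonneg_left (hu s hs.1 hs.2) (gz_nonneg hβ _)

theorem integrableOn_gz_smul {β t τ M : ℝ} (hβ : 0 < β) {u : ℝ → X}
    (hu : AEStronglyMeasurable u (volume.restrict (Ioc 0 t)))
    (huM : ∀ s, 0 < s → s ≤ t → ‖u s‖ ≤ M) :
    IntegrableOn (fun r => gz β (τ - r) • u r) (Ioc 0 t) := by
  refine (((integrableOn_gz_sub hβ τ).mono_set Ioc_subset_Ioi_self).mul_const M).mono'
    ((by fun_prop : Measurable fun r => gz β (τ - r)).aestronglyMeasurable.smul hu)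
    ((ae_restrict_iff' measurableSet_Ioc).2 (ae_of_all _ fun s hs => ?_))
  rw [norm_smul, Real.norm_of_nonneg (gz_nonneg hβ _)]
  exact mul_le_mul_of_nonneg_left (huM s hs.1 hs.2) (gz_nonneg hβ _)

/-- The modulus of continuity of a fractional integral. -/
theorem norm_J_sub_le {β t h M : ℝ} (hβ : 0 < β) (hβ1 : β ≤ 1) (ht : 0 ≤ t) (hh : 0 ≤ h)
    {u : ℝ → X} (hu : AEStronglyMeasurable u (volume.restrict (Ioc 0 (t + h))))
    (huM : ∀ s, 0 < s → s ≤ t + h → ‖u s‖ ≤ M) (hM : 0 ≤ M) :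
    ‖J β u (t + h) - J β u t‖ ≤ M * (2 * (h ^ β / Real.Gamma (β + 1))) := by
  have hth : 0 ≤ t + h := by linarith
  have hB : Ioc 0 (t + h) ⊆ Ioi 0 := Ioc_subset_Ioi_self
  have hB1 : Ioo 0 t ⊆ Ioc 0 (t + h) := fun r hr => ⟨hr.1, by linarith [hr.2]⟩
  rw [J_eq_setIntegral hth measurableSet_Ioc Ioo_subset_Ioc_self hB,
    J_eq_setIntegral ht measurableSet_Ioc hB1 hB,
    ← integral_sub (integrableOn_gz_smul hβ hu huM) (integrableOn_gz_smul hβ hu huM)]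
  have i1 := (integrableOn_gz_sub hβ (t + h)).mono_set hB
  have i2 := (integrableOn_gz_sub hβ t).mono_set hB
  have i3 : IntegrableOn ((Ioi t).indicator fun r => gz β (t + h - r)) (Ioc 0 (t + h)) :=
    i1.indicator measurableSet_Ioi
  have e1 := setIntegral_gz_sub hβ hth measurableSet_Ioc Ioo_subset_Ioc_self hB
  have e2 := setIntegral_gz_sub hβ ht measurableSet_Ioc hB1 hB
  have e3 : ∫ r in Ioc 0 (t + h), (Ioi t).indicator (fun r => gz β (t + h - r)) r
      = h ^ β / Real.Gamma (β + 1) := by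
    rw [setIntegral_indicator measurableSet_Ioi, setIntegral_gz_sub (a := t) hβ (by linarith)
      (measurableSet_Ioc.inter measurableSet_Ioi) (fun r hr => ⟨⟨ht.trans_lt hr.1, hr.2.le⟩, hr.1⟩)
      inter_subset_right, add_sub_cancel_left]
  -- For `r < t` the kernel is decreasing, so the difference has a fixed sign and no absolute value
  -- is needed; for `r > t` only the later kernel survives, and the coefficient `2` offsets its
  -- negative sign. The integral is at most `2 * h ^ β / Γ(β + 1)` because `t ^ β ≤ (t + h) ^ β`.
  have hint : IntegrableOn (fun r => M * (gz β (t - r) - gz β (t + h - r)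
      + 2 * (Ioi t).indicator (fun r => gz β (t + h - r)) r)) (Ioc 0 (t + h)) :=
    ((i2.sub i1).add (i3.const_mul 2)).const_mul M
  refine (norm_integral_le_of_norm_le hint ?_).trans ?_
  · filter_upwards [ae_restrict_mem measurableSet_Ioc,
      ae_restrict_of_ae (compl_mem_ae_iff.2 (measure_singleton t))] with r hr hrt'
    rw [← sub_smul, norm_smul, mul_comm]
    refine mul_le_mul (huM r hr.1 hr.2) ?_ (norm_nonneg _) hM
    rw [Real.norm_eq_abs]
    by_cases hrt : t < r
    · rw [indicator_of_mem (mem_Ioi.2 hrt), gz_of_nonpos (show t - r ≤ 0 by linarith), sub_zero,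
        abs_of_nonneg (gz_nonneg hβ _)]
      linarith
    · rw [indicator_of_notMem (mt mem_Ioi.1 hrt), mul_zero, add_zero]
      rcases eq_or_lt_of_le (not_lt.1 hrt) with h1 | h1
      · exact absurd h1 hrt'
      · have := gz_antitone hβ1 hβ (show 0 < t - r by linarith)
          (show t - r ≤ t + h - r by linarith)
        rw [abs_sub_comm, abs_of_nonneg (by linarith)]
  · rw [integral_const_mul, integral_add (f := fun r => gz β (t - r) - gz β (t + h - r))
      (i2.sub i1) (i3.const_mul 2), integral_sub i2 i1,
      integral_const_mul, e1, e2, e3, sub_zero, sub_zero]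
    have h5 : t ^ β / Real.Gamma (β + 1) ≤ (t + h) ^ β / Real.Gamma (β + 1) := by
      have := Real.Gamma_pos_of_pos (show 0 < β + 1 by linarith)
      gcongr
      linarith
    gcongr
    linarith

theorem integrable_gz_triangle {β t : ℝ} (hβ : 0 < β) {Φ : ℝ → ℝ → X} {a : ℝ → ℝ}
    (hΦ : AEStronglyMeasurable (Function.uncurry Φ)
      ((volume.restrict (Ioc 0 t)).prod (volume.restrict (Ioc 0 t))))
    (ha : IntegrableOn a (Ioc 0 t))
    (hΦa : ∀ q ∈ Ioc 0 t, ∀ r ∈ Ioc 0 t, ‖Φ q r‖ ≤ a q) :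
    Integrable (Function.uncurry fun q r => gz β (t - q - r) • Φ q r)
      ((volume.restrict (Ioc 0 t)).prod (volume.restrict (Ioc 0 t))) := by
  have hm : AEStronglyMeasurable (Function.uncurry fun q r => gz β (t - q - r) • Φ q r)
      ((volume.restrict (Ioc 0 t)).prod (volume.restrict (Ioc 0 t))) :=
    (by fun_prop : Measurable fun p : ℝ × ℝ => gz β (t - p.1 - p.2)).aestronglyMeasurable.smul hΦ
  have hgi : ∀ q, IntegrableOn (fun r => gz β (t - q - r)) (Ioc 0 t) := fun q =>
    (integrableOn_gz_sub hβ _).mono_set Ioc_subset_Ioi_self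
  have hpt : ∀ q ∈ Ioc 0 t, ∀ r ∈ Ioc 0 t, ‖gz β (t - q - r) • Φ q r‖
      ≤ gz β (t - q - r) * a q := fun q hq r hr => by
    rw [norm_smul, Real.norm_of_nonneg (gz_nonneg hβ _)]
    exact mul_le_mul_of_nonneg_left (hΦa q hq r hr) (gz_nonneg hβ _)
  rw [integrable_prod_iff hm]
  constructor
  · filter_upwards [hm.prodMk_left, ae_restrict_mem measurableSet_Ioc] with q hq1 hq
    exact ((hgi q).mul_const (a q)).mono' hq1
      ((ae_restrict_iff' measurableSet_Ioc).2 (ae_of_all _ fun r hr => hpt q hq r hr))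
  · refine (ha.const_mul (t ^ β / Real.Gamma (β + 1))).mono' hm.norm.integral_prod_right' ?_
    filter_upwards [ae_restrict_mem measurableSet_Ioc] with q hq
    have ha0 : 0 ≤ a q := (norm_nonneg _).trans (hΦa q hq q hq)
    rw [Real.norm_of_nonneg (by positivity)]
    calc ∫ r in Ioc 0 t, ‖gz β (t - q - r) • Φ q r‖ ≤ ∫ r in Ioc 0 t, gz β (t - q - r) * a q := by
          refine integral_mono_of_nonneg (ae_of_all _ fun r => norm_nonneg _)
            ((hgi q).mul_const (a q))
            ((ae_restrict_iff' measurableSet_Ioc).2 (ae_of_all _ fun r hr => hpt q hq r hr))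
      _ = (t - q - 0) ^ β / Real.Gamma (β + 1) * a q := by
          rw [integral_mul_const, setIntegral_gz_sub hβ (by linarith [hq.2]) measurableSet_Ioc
            (fun r hr => ⟨hr.1, by linarith [hr.2, hq.1]⟩) Ioc_subset_Ioi_self]
      _ ≤ _ := by
          have := Real.Gamma_pos_of_pos (show 0 < β + 1 by linarith)
          have := hq.1
          have := hq.2
          gcongr
          · linarith
          · linarith

/-- The kernel is supported on the triangle `q + r < t` and is symmetric in `q` and `r`. The
majorant may depend on `q`, so `Φ` can carry an integrable singularity in that variable. -/
theorem integral_gz_triangle {β t : ℝ} (hβ : 0 < β) {Φ : ℝ → ℝ → X} {a : ℝ → ℝ}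
    (hΦ : AEStronglyMeasurable (Function.uncurry Φ)
      ((volume.restrict (Ioc 0 t)).prod (volume.restrict (Ioc 0 t))))
    (ha : IntegrableOn a (Ioc 0 t))
    (hΦa : ∀ q ∈ Ioc 0 t, ∀ r ∈ Ioc 0 t, ‖Φ q r‖ ≤ a q) :
    ∫ q in Ioc 0 t, ∫ r in Ioc 0 t, gz β (t - q - r) • Φ q r
      = ∫ r in Ioc 0 t, ∫ q in Ioc 0 t, gz β (t - r - q) • Φ q r := by
  rw [integral_integral_swap (integrable_gz_triangle hβ hΦ ha hΦa)]
  simp only [sub_right_comm t]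

/-- Euler's Beta integral `B(1 - α, α) = Γ(1 - α)Γ(α)`; the powers of `τ` cancel. -/
theorem integral_g_mul_g {α τ : ℝ} (hα : 0 < α) (hα1 : α < 1) (hτ : 0 < τ) :
    ∫ q in (0 : ℝ)..τ, g α (τ - q) * g (1 - α) q = 1 := by
  have h1 := Complex.betaIntegral_scaled (1 - α : ℝ) α hτ
  have h2 := Complex.Gamma_mul_Gamma_eq_betaIntegral (s := ((1 - α : ℝ) : ℂ)) (t := (α : ℂ))
    (by simpa using hα1) (by simpa using hα)
  have h3 : ((1 - α : ℝ) : ℂ) + α = 1 := by push_cast; ring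
  rw [h3, Complex.Gamma_one, one_mul] at h2
  rw [h3, sub_self, Complex.cpow_zero, one_mul, ← h2] at h1
  have h4 : ((∫ q in (0 : ℝ)..τ, q ^ ((1 - α) - 1) * (τ - q) ^ (α - 1) : ℝ) : ℂ)
      = ((Real.Gamma (1 - α) * Real.Gamma α : ℝ) : ℂ) := by
    rw [← intervalIntegral.integral_ofReal]
    push_cast
    rw [← Complex.Gamma_ofReal, ← Complex.Gamma_ofReal, ← h1]
    rw [intervalIntegral.integral_of_le hτ.le, intervalIntegral.integral_of_le hτ.le]
    refine setIntegral_congr_fun measurableSet_Ioc fun q hq => ?_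
    rw [Complex.ofReal_cpow hq.1.le, Complex.ofReal_cpow (sub_nonneg.2 hq.2)]
    push_cast
    rfl
  rw [Complex.ofReal_inj] at h4
  have h7 : ∀ q, g α (τ - q) * g (1 - α) q = q ^ ((1 - α) - 1) * (τ - q) ^ (α - 1)
      / (Real.Gamma (1 - α) * Real.Gamma α) := by
    intro q
    simp only [g]
    field_simp
  simp only [h7]
  rw [intervalIntegral.integral_div, h4, div_self (by positivity)]

/-- Fractional integrals of complementary orders compose to the primitive. -/
theorem J_J [CompleteSpace X] {α t M : ℝ} (hα : 0 < α) (hα1 : α < 1) (ht : 0 ≤ t) {v : ℝ → X}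
    (hv : AEStronglyMeasurable v (volume.restrict (Ioc 0 t)))
    (hvM : ∀ s, 0 < s → s ≤ t → ‖v s‖ ≤ M) :
    J (1 - α) (J α v) t = ∫ s in (0 : ℝ)..t, v s := by
  have h1 : J (1 - α) (J α v) t
      = ∫ q in Ioc 0 t, ∫ r in Ioc 0 t, gz α (t - q - r) • g (1 - α) q • v r := by
    have h2 := intervalIntegral.integral_comp_sub_left (a := 0) (b := t)
      (fun s => g (1 - α) (t - s) • J α v s) t
    simp only [sub_self, sub_zero, sub_sub_cancel] at h2
    rw [J, ← h2, intervalIntegral.integral_of_le ht]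
    refine setIntegral_congr_fun measurableSet_Ioc fun q hq => ?_
    rw [J_eq_setIntegral (B := Ioc 0 t) (by linarith [hq.2]) measurableSet_Ioc
      (fun r hr => ⟨hr.1, by linarith [hr.2, hq.1]⟩) Ioc_subset_Ioi_self, ← integral_smul]
    simp only [smul_comm (g (1 - α) q)]
  rw [h1, integral_gz_triangle hα (a := fun q => g (1 - α) q * M)]
  · rw [intervalIntegral.integral_of_le ht, integral_Ioc_eq_integral_Ioo,
      integral_Ioc_eq_integral_Ioo]
    refine setIntegral_congr_fun measurableSet_Ioo fun r hr => ?_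
    have hr2 : 0 < t - r := by linarith [hr.2]
    simp only [smul_smul]
    rw [integral_smul_const]
    have h3 := setIntegral_gz_smul (β := α) hr2.le (measurableSet_Ioc (a := 0) (b := t))
      (fun q hq => ⟨hq.1, by linarith [hq.2, hr.1]⟩) Ioc_subset_Ioi_self
      (fun q => ((g (1 - α) q : ℝ) : ℂ))
    have h4 : ((∫ q in Ioc 0 t, gz α (t - r - q) * g (1 - α) q : ℝ) : ℂ) = 1 := by
      rw [← integral_complex_ofReal]
      simp only [Complex.ofReal_mul, ← Complex.real_smul, h3]
      have h5 := integral_g_mul_g hα hα1 hr2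
      simp only [Complex.real_smul, ← Complex.ofReal_mul]
      rw [intervalIntegral.integral_ofReal, h5, Complex.ofReal_one]
    rw [← Complex.ofReal_one, Complex.ofReal_inj] at h4
    rw [h4, one_smul]
  · exact ((measurable_g _).comp measurable_fst).aestronglyMeasurable.smul hv.comp_snd
  · exact (((intervalIntegrable_iff_integrableOn_Ioc_of_le ht).1
      (intervalIntegrable_g (by linarith) 0 t))).mul_const M
  · intro q hq r hr
    rw [norm_smul, Real.norm_of_nonneg (g_nonneg (by linarith) hq.1.le)]
    exact mul_le_mul_of_nonneg_left (hvM r hr.1 hr.2) (g_nonneg (by linarith) hq.1.le)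

/-! ### Laplace transforms of fractional kernels and integrals -/

theorem integrableOn_rpow_mul_exp {β η : ℝ} (hβ : -1 < β) (hη : 0 < η) :
    IntegrableOn (fun t : ℝ => t ^ β * Real.exp (-(η * t))) (Ioi 0) := by
  have := integrableOn_rpow_mul_exp_neg_mul_rpow hβ one_pos hη
  simpa using this

theorem integrableOn_g_mul_exp {β η : ℝ} (hβ : 0 < β) (hη : 0 < η) :
    IntegrableOn (fun t : ℝ => g β t * Real.exp (-(η * t))) (Ioi 0) := by
  refine ((integrableOn_rpow_mul_exp (β := β - 1) (by linarith) hη).div_const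
    (Real.Gamma β)).congr (ae_of_all _ fun t => ?_)
  simp only [g]
  ring

/-- The Laplace transform of `g β` is `z ^ (-β)`. -/
theorem integral_exp_mul_g {β : ℝ} (hβ : 0 < β) {z : ℂ} (hz : 0 < z.re) :
    ∫ t in Ioi (0 : ℝ), Complex.exp (-(z * t)) * (g β t : ℂ) = z ^ (-(β : ℂ)) := by
  set f : ℂ → ℂ := fun z => ∫ t in Ioi (0 : ℝ), Complex.exp (-(z * t)) * (g β t : ℂ) with hf
  have hm : ∀ z : ℂ, AEStronglyMeasurable (fun t : ℝ => Complex.exp (-(z * t)) * (g β t : ℂ))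
      (volume.restrict (Ioi 0)) := fun z => Measurable.aestronglyMeasurable (by fun_prop)
  have hdiff : DifferentiableOn ℂ f {z | 0 < z.re} := by
    intro z₀ (hz₀ : 0 < z₀.re)
    set η := z₀.re / 2 with hη
    have hη0 : 0 < η := by positivity
    have hs : {z : ℂ | η < z.re} ∈ 𝓝 z₀ :=
      (isOpen_lt continuous_const Complex.continuous_re).mem_nhds
        (show η < z₀.re by linarith)
    have hi : Integrable (fun t : ℝ => Complex.exp (-(z₀ * t)) * (g β t : ℂ))
        (volume.restrict (Ioi 0)) := by
      refine (integrableOn_g_mul_exp hβ hz₀).mono' (hm z₀)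
        ((ae_restrict_iff' measurableSet_Ioi).2 (ae_of_all _ fun t (ht : 0 < t) => ?_))
      rw [norm_mul, norm_exp_neg_mul, Complex.norm_real, Real.norm_of_nonneg (g_nonneg hβ ht.le),
        mul_comm]
    have hb : IntegrableOn (fun t : ℝ => t * (g β t * Real.exp (-(η * t)))) (Ioi 0) := by
      refine IntegrableOn.congr_fun ((integrableOn_rpow_mul_exp (β := β) (by linarith)
        hη0).div_const (Real.Gamma β)) (fun t (ht : 0 < t) => ?_) measurableSet_Ioi
      have : t ^ β = t * t ^ (β - 1) := by
        rw [← Real.rpow_one_add' ht.le (by linarith), add_sub_cancel]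
      simp only [g, this]
      ring
    refine (hasDerivAt_integral_of_dominated_loc_of_deriv_le hs (.of_forall hm) hi
      (F' := fun z t => (-(t : ℂ)) * Complex.exp (-(z * t)) * (g β t : ℂ))
      (Measurable.aestronglyMeasurable (by fun_prop)) (bound := fun t : ℝ =>
      t * (g β t * Real.exp (-(η * t)))) ?_ hb ?_).2.differentiableAt.differentiableWithinAt
    · refine (ae_restrict_iff' measurableSet_Ioi).2 (ae_of_all _ fun t (ht : 0 < t) z hzη => ?_)
      rw [norm_mul, norm_mul, norm_neg, norm_exp_neg_mul, Complex.norm_real, Complex.norm_real,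
        Real.norm_of_nonneg (g_nonneg hβ ht.le), Real.norm_of_nonneg ht.le, mul_assoc,
        mul_comm (g β t)]
      have h1 : η < z.re := hzη
      have := g_nonneg hβ ht.le
      gcongr
    · refine ae_of_all _ fun t z _ => ?_
      have h1 : HasDerivAt (fun z : ℂ => -(z * t)) (-(t : ℂ)) z := by
        simpa using ((hasDerivAt_id z).mul_const (t : ℂ)).fun_neg
      have h2 := h1.cexp.mul_const (g β t : ℂ)
      rwa [mul_comm (Complex.exp _)] at h2
  have hopen : IsOpen {z : ℂ | 0 < z.re} := isOpen_lt continuous_const Complex.continuous_re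
  have hpow : DifferentiableOn ℂ (fun z : ℂ => z ^ (-(β : ℂ))) {z | 0 < z.re} := fun z hz =>
    (DifferentiableAt.cpow_const differentiableAt_id (Or.inl hz)).differentiableWithinAt
  have hreal : ∀ x : ℝ, 0 < x → f x = (x : ℂ) ^ (-(β : ℂ)) := by
    intro x hx
    have h1 := Real.integral_rpow_mul_exp_neg_mul_Ioi hβ hx
    have h2 : f x = ((∫ t in Ioi (0 : ℝ), Real.exp (-(x * t)) * g β t : ℝ) : ℂ) := by
      rw [← integral_complex_ofReal]
      simp [hf]
    have h3 : ∫ t in Ioi (0 : ℝ), Real.exp (-(x * t)) * g β t = x ^ (-β) := by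
      have h4 : ∀ t, Real.exp (-(x * t)) * g β t
          = t ^ (β - 1) * Real.exp (-(x * t)) / Real.Gamma β := fun t => by
        simp only [g]
        ring
      simp only [h4]
      rw [integral_div, h1, mul_div_cancel_right₀ _ (Real.Gamma_pos_of_pos hβ).ne', one_div,
        Real.inv_rpow hx.le, Real.rpow_neg hx.le]
    rw [h2, h3, Complex.ofReal_cpow hx.le]
    push_cast
    rfl
  -- Both sides are holomorphic on the half-plane and agree on the positive reals by the Gamma
  -- integral; the identity theorem does the rest.
  refine AnalyticOnNhd.eqOn_of_preconnected_of_frequently_eq (hdiff.analyticOnNhd hopen)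
    (hpow.analyticOnNhd hopen) (convex_halfSpace_re_gt 0).isPreconnected
    (z₀ := 1) (by simp) ?_ hz
  have h5 : Tendsto (fun x : ℝ => (x : ℂ)) (𝓝[>] 1) (𝓝[≠] 1) := by
    refine tendsto_nhdsWithin_iff.2 ⟨?_, ?_⟩
    · have := (Complex.continuous_ofReal.tendsto 1).mono_left
        (nhdsWithin_le_nhds (s := Ioi (1 : ℝ)))
      simpa using this
    · filter_upwards [self_mem_nhdsWithin] with x (hx : 1 < x)
      simpa using hx.ne'
  refine h5.frequently (Eventually.frequently ?_)
  filter_upwards [self_mem_nhdsWithin] with x (hx : 1 < x)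
  exact hreal x (by linarith)

/-- The Laplace transform of a fractional integral, over a half-line. -/
theorem integral_exp_J [CompleteSpace X] {β t C : ℝ} {n : ℕ} (hβ : 0 < β) (ht : 0 ≤ t) {z : ℂ}
    (hz : 0 < z.re) {F : ℝ → X} (hF : WBdd n F C) :
    IntegrableOn (fun s : ℝ => Complex.exp (-(z * s)) • J β F s) (Ioi 0) ∧
    IntegrableOn (fun r : ℝ =>
      (∫ s in Ioi t, Complex.exp (-(z * s)) * (g β (s - r) : ℂ)) • F r) (Ioc 0 t) ∧
    ∫ s in Ioi t, Complex.exp (-(z * s)) • J β F s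
      = z ^ (-(β : ℂ)) • (∫ r in Ioi t, Complex.exp (-(z * r)) • F r)
        + ∫ r in Ioc 0 t,
          (∫ s in Ioi t, Complex.exp (-(z * s)) * (g β (s - r) : ℂ)) • F r := by
  set a : ℝ → ℂ := (Ioi (0 : ℝ)).indicator fun s => Complex.exp (-(z * s)) * (g β s : ℂ) with ha
  set b : ℝ → X := (Ioi (0 : ℝ)).indicator fun r => Complex.exp (-(z * r)) • F r with hb
  have hai : Integrable a := by
    rw [ha, integrable_indicator_iff measurableSet_Ioi]
    refine (integrableOn_g_mul_exp hβ hz).mono' (Measurable.aestronglyMeasurable (by fun_prop))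
      ((ae_restrict_iff' measurableSet_Ioi).2 (ae_of_all _ fun t (ht : 0 < t) => ?_))
    rw [norm_mul, norm_exp_neg_mul, Complex.norm_real, Real.norm_of_nonneg (g_nonneg hβ ht.le),
      mul_comm]
  have hbi : Integrable b := by
    rw [hb, integrable_indicator_iff measurableSet_Ioi]
    refine ((integrableOn_weight_mul_exp n hz).const_mul C).mono'
      ((Continuous.aestronglyMeasurable (by fun_prop)).smul hF.1.restrict)
      ((ae_restrict_iff' measurableSet_Ioi).2 (ae_of_all _ fun s (hs : 0 < s) => ?_))
    rw [norm_smul, norm_exp_neg_mul]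
    have := hF.2 s
    rw [abs_of_pos hs] at this
    calc Real.exp (-(z.re * s)) * ‖F s‖ ≤ Real.exp (-(z.re * s)) * (C * (1 + s) ^ n) := by gcongr
      _ = _ := by ring
  have hprod : Integrable (fun p : ℝ × ℝ => a (p.1 - p.2) • b p.2) (volume.prod volume) :=
    hbi.convolution_integrand (ContinuousLinearMap.lsmul ℂ ℂ).flip hai
  have hab : ∀ s r : ℝ, 0 < r →
      a (s - r) • b r = Complex.exp (-(z * s)) • gz β (s - r) • F r := by
    intro s r hr
    simp only [ha, hb, indicator_of_mem (mem_Ioi.2 hr)]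
    by_cases h : 0 < s - r
    · rw [indicator_of_mem (mem_Ioi.2 h), gz_of_pos h, ← Complex.coe_smul (g β (s - r)), smul_smul,
        smul_smul, mul_right_comm, ← Complex.exp_add]
      congr 3
      push_cast
      ring
    · rw [indicator_of_notMem (mt mem_Ioi.1 h), gz_of_nonpos (not_lt.1 h), zero_smul, zero_smul,
        smul_zero]
  have hinner : ∀ s : ℝ, 0 < s → ∫ r in Ioi (0 : ℝ), a (s - r) • b r
      = Complex.exp (-(z * s)) • J β F s := by
    intro s hs
    rw [J_eq_setIntegral hs.le measurableSet_Ioi Ioo_subset_Ioi_self subset_rfl, ← integral_smul]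
    exact setIntegral_congr_fun measurableSet_Ioi fun r hr => hab s r hr
  have hprod0 : Integrable (fun p : ℝ × ℝ => a (p.1 - p.2) • b p.2)
      ((volume.restrict (Ioi 0)).prod (volume.restrict (Ioi 0))) := by
    rw [Measure.prod_restrict]
    exact hprod.restrict
  have hprodt : Integrable (Function.uncurry fun s r : ℝ => a (s - r) • b r)
      ((volume.restrict (Ioi t)).prod (volume.restrict (Ioi 0))) := by
    rw [Measure.prod_restrict]
    exact hprod.restrict
  have h1 : ∫ s in Ioi t, Complex.exp (-(z * s)) • J β F s
      = ∫ r in Ioi (0 : ℝ), ∫ s in Ioi t, a (s - r) • b r := by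
    rw [← integral_integral_swap hprodt]
    exact setIntegral_congr_fun measurableSet_Ioi fun s hs => (hinner s (ht.trans_lt hs)).symm
  have h2 : IntegrableOn (fun r => ∫ s in Ioi t, a (s - r) • b r) (Ioi 0) :=
    hprodt.integral_prod_right
  have h3 : EqOn (fun r => ∫ s in Ioi t, a (s - r) • b r)
      (fun r => (∫ s in Ioi t, Complex.exp (-(z * s)) * (g β (s - r) : ℂ)) • F r) (Ioc 0 t) := by
    intro r hr
    simp only
    rw [← integral_smul_const]
    refine setIntegral_congr_fun measurableSet_Ioi fun s (hs : t < s) => ?_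
    rw [hab s r hr.1, gz_of_pos (by linarith [hr.2]), ← Complex.coe_smul, smul_smul]
  refine ⟨hprod0.integral_prod_left.congr ((ae_restrict_iff' measurableSet_Ioi).2
    (ae_of_all _ fun s hs => hinner s hs)),
    (h2.mono_set Ioc_subset_Ioi_self).congr_fun h3 measurableSet_Ioc, ?_⟩
  -- For `r > t` the integral in `s` sees the whole kernel and yields `z ^ (-β)`; for `r ≤ t` part
  -- of the kernel lies before time `t`, which leaves the second term.
  rw [h1, ← Ioc_union_Ioi_eq_Ioi ht, setIntegral_union (Ioc_disjoint_Ioi le_rfl) measurableSet_Ioi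
    (h2.mono_set Ioc_subset_Ioi_self) (h2.mono_set (Ioi_subset_Ioi ht)), add_comm]
  congr 1
  · rw [← integral_smul]
    refine setIntegral_congr_fun measurableSet_Ioi fun r (hr : t < r) => ?_
    have hr0 : 0 < r := ht.trans_lt hr
    rw [integral_smul_const]
    simp only [hb, indicator_of_mem (mem_Ioi.2 hr0)]
    congr 1
    rw [setIntegral_eq_of_subset_of_forall_sdiff_eq_zero measurableSet_Ioi (Ioi_subset_Ioi hr.le)]
    · rw [← integral_exp_mul_g hβ hz, ← integral_indicator measurableSet_Ioi,
        ← integral_indicator measurableSet_Ioi]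
      refine Eq.trans ?_ (integral_sub_right_eq_self a r)
      refine integral_congr_ae (ae_of_all _ fun s => ?_)
      simp only [ha, indicator, mem_Ioi, sub_pos]
      split_ifs <;> rfl
    · intro s hs
      have : ¬ (0 < s - r) := fun h => hs.2 (sub_pos.1 h)
      exact indicator_of_notMem (mt mem_Ioi.1 this) _
  · exact setIntegral_congr_fun measurableSet_Ioc h3

/-! ### Comparing Laplace averages of a function and of its fractional integral -/

/-- The Laplace transform of the translated power `s ↦ (τ + s) ^ (-p)`. -/
def expPow (z : ℂ) (τ p : ℝ) : ℂ :=
  ∫ s in Ioi (0 : ℝ), Complex.exp (-(z * s)) * ((τ + s) ^ (-p) : ℝ)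

theorem setIntegral_Ioi_comp_add {E : Type*} [NormedAddCommGroup E] [NormedSpace ℝ E] (f : ℝ → E)
    (a : ℝ) : ∫ s in Ioi (0 : ℝ), f (a + s) = ∫ s in Ioi a, f s := by
  have := (measurePreserving_add_left volume a).setIntegral_preimage_emb
    (measurableEmbedding_addLeft a) f (Ioi a)
  simpa using this

theorem integrableOn_Ioi_comp_add {E : Type*} [NormedAddCommGroup E] {f : ℝ → E} {a : ℝ}
    (hf : IntegrableOn f (Ioi a)) : IntegrableOn (fun s => f (a + s)) (Ioi 0) := by
  have := ((measurePreserving_add_left volume a).integrableOn_comp_preimage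
    (measurableEmbedding_addLeft a)).2 hf
  simpa [Function.comp_def] using this

theorem integrableOn_add_rpow {τ p : ℝ} (hτ : 0 < τ) (hp : 1 < p) :
    IntegrableOn (fun s : ℝ => (τ + s) ^ (-p)) (Ioi 0) ∧
      ∫ s in Ioi (0 : ℝ), (τ + s) ^ (-p) = τ ^ (1 - p) / (p - 1) := by
  have h1 := integrableOn_Ioi_rpow_of_lt (show -p < -1 by linarith) hτ
  have h2 := integral_Ioi_rpow_of_lt (show -p < -1 by linarith) hτ
  constructor
  · exact integrableOn_Ioi_comp_add h1
  · rw [setIntegral_Ioi_comp_add (fun s : ℝ => s ^ (-p)), h2,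
      show -p + 1 = 1 - p by ring, neg_div, ← div_neg, neg_sub]

theorem integrableOn_exp_mul_rpow {z : ℂ} (hz : 0 < z.re) {τ p : ℝ} (hτ : 0 < τ) (hp : 0 ≤ p) :
    IntegrableOn (fun s : ℝ => Complex.exp (-(z * s)) * ((τ + s) ^ (-p) : ℝ)) (Ioi 0) := by
  have h1 := integrableOn_weight_mul_exp 0 hz
  simp only [pow_zero, one_mul] at h1
  refine (h1.mul_const (τ ^ (-p))).mono' (Measurable.aestronglyMeasurable (by fun_prop))
    ((ae_restrict_iff' measurableSet_Ioi).2 (ae_of_all _ fun s (hs : 0 < s) => ?_))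
  rw [norm_mul, norm_exp_neg_mul, Complex.norm_real, Real.norm_of_nonneg (by positivity)]
  have := Real.rpow_le_rpow_of_nonpos hτ (show τ ≤ τ + s by linarith) (show -p ≤ 0 by linarith)
  gcongr

theorem norm_expPow_le {z : ℂ} (hz : 0 < z.re) {τ p : ℝ} (hτ : 0 < τ) (hp : 1 < p) :
    ‖expPow z τ p‖ ≤ τ ^ (1 - p) / (p - 1) := by
  obtain ⟨h1, h2⟩ := integrableOn_add_rpow hτ hp
  rw [← h2]
  refine norm_integral_le_of_norm_le h1
    ((ae_restrict_iff' measurableSet_Ioi).2 (ae_of_all _ fun s (hs : 0 < s) => ?_))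
  rw [norm_mul, norm_exp_neg_mul, Complex.norm_real, Real.norm_of_nonneg (by positivity)]
  exact mul_le_of_le_one_left (by positivity) (Real.exp_le_one_iff.2 (by nlinarith))

/-- Integration by parts: a factor `z` is traded for one more power of decay in `τ`. -/
theorem mul_expPow {z : ℂ} (hz : 0 < z.re) {τ p : ℝ} (hτ : 0 < τ) (hp : 0 < p) :
    z * expPow z τ p = (τ ^ (-p) : ℝ) - p * expPow z τ (p + 1) := by
  set f : ℝ → ℂ := fun s => Complex.exp (-(z * s)) * ((τ + s) ^ (-p) : ℝ) with hf
  set f' : ℝ → ℂ := fun s => (-z) * (Complex.exp (-(z * s)) * ((τ + s) ^ (-p) : ℝ))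
    + (-(p : ℂ)) * (Complex.exp (-(z * s)) * ((τ + s) ^ (-(p + 1)) : ℝ)) with hf'
  have i1 := integrableOn_exp_mul_rpow hz hτ hp.le
  have i2 := integrableOn_exp_mul_rpow hz hτ (show 0 ≤ p + 1 by linarith)
  have hder : ∀ s : ℝ, 0 ≤ s → HasDerivAt f (f' s) s := by
    intro s hs
    have h1 : HasDerivAt (fun s : ℝ => Complex.exp (-(z * s))) (Complex.exp (-(z * s)) * (-z)) s := by
      have h2 : HasDerivAt (fun s : ℝ => -(z * (s : ℂ))) (-z) s := by
        simpa using ((Complex.ofRealCLM.hasDerivAt (x := s)).const_mul z).fun_neg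
      exact h2.cexp
    have h3 : HasDerivAt (fun s : ℝ => (τ + s) ^ (-p)) (1 * (-p) * (τ + s) ^ (-p - 1)) s :=
      ((hasDerivAt_id s).const_add τ).rpow_const (Or.inl (by simp only [id]; linarith))
    have h4 := h1.mul h3.ofReal_comp
    have h5 : f' s = Complex.exp (-(z * s)) * -z * ((τ + s) ^ (-p) : ℝ)
        + Complex.exp (-(z * s)) * ((1 * -p * (τ + s) ^ (-p - 1) : ℝ) : ℂ) := by
      simp only [hf', show -p - 1 = -(p + 1) by ring]
      push_cast
      ring
    rw [h5]
    exact h4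
  have hint : IntegrableOn f' (Ioi 0) := (i1.const_mul _).add (i2.const_mul _)
  have hlim : Tendsto f atTop (𝓝 0) :=
    tendsto_zero_of_hasDerivAt_of_integrableOn_Ioi (fun s hs => hder s (le_of_lt hs)) hint i1
  have h5 := integral_Ioi_of_hasDerivAt_of_tendsto (hder 0 le_rfl).continuousAt.continuousWithinAt
    (fun s hs => hder s (le_of_lt hs)) hint hlim
  rw [hf', integral_add (i1.const_mul _) (i2.const_mul _), integral_const_mul,
    integral_const_mul] at h5
  change -z * expPow z τ p + -(p : ℂ) * expPow z τ (p + 1) = 0 - f 0 at h5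
  have h6 : f 0 = (τ ^ (-p) : ℝ) := by simp [hf]
  rw [h6] at h5
  linear_combination -h5

/-- A pointwise bound for the kernel that compares Laplace averages of a function with those of
its fractional derivative. -/
theorem norm_mul_expPow_sub_le {z : ℂ} (hz : 0 < z.re) {τ α : ℝ} (hτ : 0 < τ) (hα : 0 < α) :
    ‖z * expPow z τ α - (τ ^ (-α) : ℝ)‖ ≤ τ ^ (-α) ∧
    ‖z * expPow z τ α - (τ ^ (-α) : ℝ)‖ ≤ 2 * α * ‖z‖⁻¹ * τ ^ (-(α + 1)) := by
  have hz0 : 0 < ‖z‖ := norm_pos_iff.2 fun h => by simp [h] at hz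
  -- The leading behaviour `τ ^ (-α)` cancels. What remains is bounded either directly, or after one
  -- more integration by parts, which gains `‖z‖⁻¹ * τ⁻¹`.
  have h1 : z * expPow z τ α - (τ ^ (-α) : ℝ) = -(α * expPow z τ (α + 1)) := by
    rw [mul_expPow hz hτ hα]
    ring
  have h2 := norm_expPow_le hz hτ (show 1 < α + 1 by linarith)
  have h3 := norm_expPow_le hz hτ (show 1 < α + 1 + 1 by linarith)
  have h4 := mul_expPow hz hτ (show 0 < α + 1 by linarith)
  rw [show 1 - (α + 1) = -α by ring, add_sub_cancel_right] at h2
  rw [show 1 - (α + 1 + 1) = -(α + 1) by ring, add_sub_cancel_right] at h3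
  rw [h1, norm_neg, norm_mul, Complex.norm_real, Real.norm_of_nonneg hα.le]
  constructor
  · calc α * ‖expPow z τ (α + 1)‖ ≤ α * (τ ^ (-α) / α) := by gcongr
      _ = _ := mul_div_cancel₀ _ hα.ne'
  · have h5 : ‖z‖ * ‖expPow z τ (α + 1)‖ ≤ 2 * τ ^ (-(α + 1)) := by
      rw [← norm_mul, h4]
      refine (norm_sub_le _ _).trans ?_
      rw [Complex.norm_real, Real.norm_of_nonneg (by positivity), norm_mul, Complex.norm_real,
        Real.norm_of_nonneg (by positivity)]
      have : (α + 1) * ‖expPow z τ (α + 1 + 1)‖ ≤ (α + 1) * (τ ^ (-(α + 1)) / (α + 1)) := by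
        gcongr
      rw [mul_div_cancel₀ _ (show α + 1 ≠ 0 by linarith)] at this
      linarith
    have h6 : ‖expPow z τ (α + 1)‖ ≤ ‖z‖⁻¹ * (2 * τ ^ (-(α + 1))) := by
      rwa [← div_eq_inv_mul, le_div_iff₀ hz0, mul_comm]
    calc α * ‖expPow z τ (α + 1)‖ ≤ α * (‖z‖⁻¹ * (2 * τ ^ (-(α + 1)))) := by gcongr
      _ = _ := by ring

/-- An integrable majorant of the comparison kernel. -/
def kernelBound (α c τ : ℝ) : ℝ :=
  if τ ≤ c then τ ^ (-α) else 2 * α * c * τ ^ (-(α + 1))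

/-- The pieces below and above the threshold `c` both scale like `c ^ (1 - α)`. For `c = ‖z‖⁻¹` this
is `‖z‖ ^ (α - 1)`, the very factor in `R_α(z, A)`. -/
theorem integral_kernelBound {α c : ℝ} (hα : 0 < α) (hα1 : α < 1) (hc : 0 < c) :
    IntegrableOn (kernelBound α c) (Ioi 0) ∧
      ∫ τ in Ioi (0 : ℝ), kernelBound α c τ = (1 / (1 - α) + 2) * c ^ (1 - α) := by
  have e1 : EqOn (fun τ : ℝ => τ ^ (-α)) (kernelBound α c) (Ioc 0 c) := fun τ hτ => by
    simp only [kernelBound, if_pos hτ.2]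
  have e2 : EqOn (fun τ : ℝ => 2 * α * c * τ ^ (-(α + 1))) (kernelBound α c) (Ioi c) :=
    fun τ (hτ : c < τ) => by simp only [kernelBound, if_neg (not_le.2 hτ)]
  have i1 : IntegrableOn (fun τ : ℝ => τ ^ (-α)) (Ioc 0 c) :=
    (intervalIntegrable_iff_integrableOn_Ioc_of_le hc.le).1
      (intervalIntegral.intervalIntegrable_rpow' (by linarith))
  have i2 : IntegrableOn (fun τ : ℝ => 2 * α * c * τ ^ (-(α + 1))) (Ioi c) :=
    (integrableOn_Ioi_rpow_of_lt (by linarith) hc).const_mul _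
  have j1 := i1.congr_fun e1 measurableSet_Ioc
  have j2 := i2.congr_fun e2 measurableSet_Ioi
  rw [← Ioc_union_Ioi_eq_Ioi hc.le]
  refine ⟨j1.union j2, ?_⟩
  rw [setIntegral_union (Ioc_disjoint_Ioi le_rfl) measurableSet_Ioi j1 j2,
    ← setIntegral_congr_fun measurableSet_Ioc e1, ← setIntegral_congr_fun measurableSet_Ioi e2,
    ← intervalIntegral.integral_of_le hc.le, integral_rpow (Or.inl (by linarith)),
    integral_const_mul, integral_Ioi_rpow_of_lt (by linarith) hc, Real.zero_rpow (by linarith),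
    show -(α + 1) + 1 = -α by ring, show -α + 1 = 1 - α by ring,
    show c ^ (1 - α) = c * c ^ (-α) by
      rw [sub_eq_add_neg, Real.rpow_add hc, Real.rpow_one]]
  have : 1 - α ≠ 0 := by linarith
  field_simp
  ring

theorem WBdd.integrableOn_exp {n : ℕ} {v : ℝ → X} {B : ℝ} (hv : WBdd n v B) {z : ℂ}
    (hz : 0 < z.re) : IntegrableOn (fun s : ℝ => Complex.exp (-(z * s)) • v s) (Ioi 0) := by
  refine ((integrableOn_weight_mul_exp n hz).const_mul B).mono'
    ((Continuous.aestronglyMeasurable (by fun_prop)).smul hv.1.restrict)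
    ((ae_restrict_iff' measurableSet_Ioi).2 (ae_of_all _ fun s (hs : 0 < s) => ?_))
  rw [norm_smul, norm_exp_neg_mul]
  have := hv.2 s
  rw [abs_of_pos hs] at this
  calc Real.exp (-(z.re * s)) * ‖v s‖ ≤ Real.exp (-(z.re * s)) * (B * (1 + s) ^ n) := by gcongr
    _ = _ := by ring

/-- Integration by parts for the Laplace averages of a function over `[t, ∞)`. -/
theorem laplace_primitive [CompleteSpace X] {n : ℕ} {v : ℝ → X} {B : ℝ} (hv : WBdd n v B)
    (hvc : ContinuousOn v (Ici 0)) {z : ℂ} (hz : 0 < z.re) {t : ℝ} (ht : 0 ≤ t)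
    (iW : IntegrableOn (fun s : ℝ => Complex.exp (-(z * s)) • ∫ r in (0 : ℝ)..s, v r) (Ioi 0)) :
    ∫ s in Ioi t, Complex.exp (-(z * s)) • v s
      = z • (∫ s in Ioi t, Complex.exp (-(z * s)) • ∫ r in (0 : ℝ)..s, v r)
        - Complex.exp (-(z * t)) • ∫ r in (0 : ℝ)..t, v r := by
  set W : ℝ → X := fun s => ∫ r in (0 : ℝ)..s, v r with hW
  have iv := hv.integrableOn_exp hz
  have hWc : ContinuousOn W (Ici 0) := by
    intro s hs
    have h1 : ContinuousOn W (Icc 0 (s + 1)) := by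
      have h2 : IntegrableOn v (Icc 0 (s + 1)) :=
        (hvc.mono Icc_subset_Ici_self).integrableOn_Icc
      have := intervalIntegral.continuousOn_primitive_interval (μ := volume) (f := v)
        (a := 0) (b := s + 1) (by rwa [uIcc_of_le (by linarith [mem_Ici.1 hs])])
      rwa [uIcc_of_le (by linarith [mem_Ici.1 hs])] at this
    refine (h1 s ⟨hs, by linarith⟩).mono_of_mem_nhdsWithin ?_
    exact mem_nhdsWithin.2 ⟨Iio (s + 1), isOpen_Iio, by simp, fun x hx => ⟨hx.2, hx.1.le⟩⟩
  have hWd : ∀ s : ℝ, 0 < s → HasDerivAt W (v s) s := by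
    intro s hs
    have hca : ContinuousAt v s := hvc.continuousAt (Ici_mem_nhds hs)
    refine intervalIntegral.integral_hasDerivAt_right ?_ ?_ hca
    · exact (hvc.mono Icc_subset_Ici_self).intervalIntegrable_of_Icc hs.le
    · exact ⟨Ioi 0, Ioi_mem_nhds hs, hv.1.restrict⟩
  have hder : ∀ s : ℝ, 0 < s → HasDerivAt (fun s : ℝ => Complex.exp (-(z * s)) • W s)
      (Complex.exp (-(z * s)) • v s + (-z) • Complex.exp (-(z * s)) • W s) s := by
    intro s hs
    have h1 : HasDerivAt (fun s : ℝ => Complex.exp (-(z * s))) (Complex.exp (-(z * s)) * (-z)) s := by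
      have h2 : HasDerivAt (fun s : ℝ => -(z * (s : ℂ))) (-z) s := by
        simpa using ((Complex.ofRealCLM.hasDerivAt (x := s)).const_mul z).fun_neg
      exact h2.cexp
    have h3 := h1.smul (hWd s hs)
    rwa [mul_comm (Complex.exp _), ← smul_smul] at h3
  have hsub : Ioi t ⊆ Ioi 0 := Ioi_subset_Ioi ht
  have ivt := iv.mono_set hsub
  have iWt := iW.mono_set hsub
  have hd : IntegrableOn (fun s : ℝ => Complex.exp (-(z * s)) • v s
      + (-z) • Complex.exp (-(z * s)) • W s) (Ioi t) := ivt.add (iWt.smul (-z))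
  have hlim := tendsto_zero_of_hasDerivAt_of_integrableOn_Ioi (fun s hs => hder s (hsub hs)) hd iWt
  have hparts := integral_Ioi_of_hasDerivAt_of_tendsto (a := t)
    (f := fun s : ℝ => Complex.exp (-(z * s)) • W s)
    (ContinuousWithinAt.smul (by fun_prop) ((hWc t ht).mono (Ici_subset_Ici.2 ht)))
    (fun s hs => hder s (hsub hs)) hd hlim
  rw [integral_add (g := fun s : ℝ => (-z) • Complex.exp (-(z * s)) • W s) ivt (iWt.smul (-z)),
    integral_smul] at hparts
  change ∫ s in Ioi t, Complex.exp (-(z * s)) • v s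
    = z • (∫ s in Ioi t, Complex.exp (-(z * s)) • W s) - Complex.exp (-(z * t)) • W t
  rw [zero_sub, neg_smul, ← sub_eq_add_neg, sub_eq_iff_eq_add] at hparts
  rw [hparts, neg_add_eq_sub]

/-- If `v` is the fractional derivative of order `α` of `w`, then the Laplace averages of `v` and of
`z ^ α w` over `[t, ∞)` agree up to a controlled error. -/
theorem norm_laplace_sub_le [CompleteSpace X] {α : ℝ} (hα : 0 < α) (hα1 : α < 1) {n : ℕ}
    {v w : ℝ → X} {B C : ℝ} (hv : WBdd n v B) (hvc : ContinuousOn v (Ici 0)) (hw : WBdd n w C)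
    (hvw : ∀ t : ℝ, 0 ≤ t → ∫ s in (0 : ℝ)..t, v s = J (1 - α) w t) {z : ℂ} (hz : 0 < z.re) {t : ℝ}
    (ht : 0 ≤ t) :
    ‖(∫ s in Ioi t, Complex.exp (-(z * s)) • v s)
        - z ^ (α : ℂ) • ∫ s in Ioi t, Complex.exp (-(z * s)) • w s‖
      ≤ Real.exp (-(z.re * t)) * (C * (1 + t) ^ n) *
        ((1 / (1 - α) + 2) / Real.Gamma (1 - α) * ‖z‖⁻¹ ^ (1 - α)) := by
  have hz0 : z ≠ 0 := fun h => by simp [h] at hz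
  have hβ : 0 < 1 - α := by linarith
  have hΓ := Real.Gamma_pos_of_pos hβ
  have hC := hw.nonneg
  obtain ⟨iJ, iK, hJ⟩ := integral_exp_J hβ ht hz hw
  have hJW : ∫ s in Ioi t, Complex.exp (-(z * s)) • (∫ r in (0 : ℝ)..s, v r)
      = ∫ s in Ioi t, Complex.exp (-(z * s)) • J (1 - α) w s :=
    setIntegral_congr_fun measurableSet_Ioi fun s (hs : t < s) => by
      simp only [hvw s (ht.trans hs.le)]
  have hparts := laplace_primitive hv hvc hz ht
    (iJ.congr_fun (fun s (hs : 0 < s) => by simp only [hvw s hs.le]) measurableSet_Ioi)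
  have hinner : ∀ r ∈ Ioo 0 t, ∫ s in Ioi t, Complex.exp (-(z * s)) * (g (1 - α) (s - r) : ℂ)
      = Complex.exp (-(z * t)) * (expPow z (t - r) α / Real.Gamma (1 - α)) := by
    intro r hr
    have h1 := setIntegral_Ioi_comp_add (fun s : ℝ =>
      Complex.exp (-(z * s)) * (g (1 - α) (s - r) : ℂ)) t
    rw [← h1, expPow, ← integral_div, ← integral_const_mul]
    refine integral_congr_ae (ae_of_all _ fun s => ?_)
    simp only [g, show 1 - α - 1 = -α by ring, show t + s - r = t - r + s by ring]
    push_cast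
    rw [mul_add, neg_add, Complex.exp_add]
    ring
  have hc : 0 < ‖z‖⁻¹ := inv_pos.2 (norm_pos_iff.2 hz0)
  obtain ⟨ib, hb⟩ := integral_kernelBound hα hα1 hc
  -- The error kernel: the contribution of `w` on `(0, t)` to the Laplace average, minus the
  -- boundary term from integration by parts. Each alone has a tail of order `τ ^ (-α)`, not
  -- integrable at infinity; their difference is dominated by `kernelBound`, whose integral is
  -- bounded independently of `t`.
  set κ : ℝ → ℂ := fun r => Complex.exp (-(z * t)) *
    ((z * expPow z (t - r) α - ((t - r) ^ (-α) : ℝ)) / Real.Gamma (1 - α)) with hκ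
  have hJt : J (1 - α) w t = ∫ r in Ioo 0 t, g (1 - α) (t - r) • w r := by
    rw [J, intervalIntegral.integral_of_le ht, integral_Ioc_eq_integral_Ioo]
  have iJt : IntegrableOn (fun r => g (1 - α) (t - r) • w r) (Ioo 0 t) := by
    refine IntegrableOn.congr_fun ((integrableOn_gz_smul (τ := t) (t := t) (u := w)
      (M := C * (1 + t) ^ n) hβ hw.1.restrict fun s hs hst => ?_).mono_set Ioo_subset_Ioc_self)
      (fun r hr => by simp only [gz_of_pos (sub_pos.2 hr.2)]) measurableSet_Ioo
    refine (hw.2 s).trans ?_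
    rw [abs_of_pos hs]
    gcongr
  have hpow : z * z ^ (-((1 - α : ℝ) : ℂ)) = z ^ (α : ℂ) := by
    calc z * z ^ (-((1 - α : ℝ) : ℂ)) = z ^ (1 : ℂ) * z ^ (-((1 - α : ℝ) : ℂ)) := by
          rw [Complex.cpow_one]
      _ = z ^ ((1 : ℂ) + -((1 - α : ℝ) : ℂ)) := (Complex.cpow_add _ _ hz0).symm
      _ = z ^ (α : ℂ) := by
          congr 1
          push_cast
          ring
  have hmain : (∫ s in Ioi t, Complex.exp (-(z * s)) • v s)
      - z ^ (α : ℂ) • ∫ s in Ioi t, Complex.exp (-(z * s)) • w s = ∫ r in Ioo 0 t, κ r • w r := by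
    have h1 : ∫ r in Ioc 0 t,
        (∫ s in Ioi t, Complex.exp (-(z * s)) * (g (1 - α) (s - r) : ℂ)) • w r
        = ∫ r in Ioo 0 t, (Complex.exp (-(z * t)) * (expPow z (t - r) α / Real.Gamma (1 - α))) •
          w r := by
      rw [integral_Ioc_eq_integral_Ioo]
      exact setIntegral_congr_fun measurableSet_Ioo fun r hr => by simp only [hinner r hr]
    rw [h1] at hJ
    have h2 : z • (∫ r in Ioo 0 t, (Complex.exp (-(z * t)) *
        (expPow z (t - r) α / Real.Gamma (1 - α))) • w r)
        - Complex.exp (-(z * t)) • (∫ r in (0 : ℝ)..t, v r) = ∫ r in Ioo 0 t, κ r • w r := by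
      have iK' : IntegrableOn (fun r => (Complex.exp (-(z * t)) *
          (expPow z (t - r) α / Real.Gamma (1 - α))) • w r) (Ioo 0 t) :=
        (iK.mono_set Ioo_subset_Ioc_self).congr_fun (fun r hr => by simp only [hinner r hr])
          measurableSet_Ioo
      rw [hvw t ht, hJt, ← integral_smul, ← integral_smul]
      refine (integral_sub (iK'.smul z) (iJt.smul (Complex.exp (-(z * t))))).symm.trans ?_
      refine setIntegral_congr_fun measurableSet_Ioo fun r hr => ?_
      simp only [hκ, Pi.smul_apply, g, show 1 - α - 1 = -α by ring]
      rw [← Complex.coe_smul, smul_smul, smul_smul, ← sub_smul]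
      congr 1
      push_cast
      ring
    rw [← h2]
    rw [hJW, hJ] at hparts
    rw [hparts, smul_add, smul_smul, hpow]
    abel
  rw [hmain]
  have hbt : IntegrableOn (fun r => kernelBound α ‖z‖⁻¹ (t - r)) (Ioo 0 t) := by
    have h1 := ((ib.mono_set (Ioo_subset_Ioi_self : Ioo 0 t ⊆ Ioi 0)).integrable_indicator
      measurableSet_Ioo).comp_sub_left t
    refine (h1.integrableOn (s := Ioo 0 t)).congr_fun (fun r hr => ?_) measurableSet_Ioo
    have h2 : t - r ∈ Ioo 0 t := ⟨by linarith [hr.2], by linarith [hr.1]⟩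
    simp only [indicator_of_mem h2]
  have hbn : ∀ τ, 0 < τ → 0 ≤ kernelBound α ‖z‖⁻¹ τ := fun τ hτ => by
    unfold kernelBound
    split_ifs <;> positivity
  have hbt2 : ∫ r in Ioo 0 t, kernelBound α ‖z‖⁻¹ (t - r)
      ≤ (1 / (1 - α) + 2) * ‖z‖⁻¹ ^ (1 - α) := by
    have h1 := intervalIntegral.integral_comp_sub_left (a := 0) (b := t)
      (kernelBound α ‖z‖⁻¹) t
    rw [sub_self, sub_zero, intervalIntegral.integral_of_le ht, intervalIntegral.integral_of_le ht,
      integral_Ioc_eq_integral_Ioo, integral_Ioc_eq_integral_Ioo] at h1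
    rw [h1, ← hb]
    exact setIntegral_mono_set ib ((ae_restrict_iff' measurableSet_Ioi).2 (ae_of_all _ hbn))
      (ae_of_all _ Ioo_subset_Ioi_self)
  refine (norm_integral_le_of_norm_le (hbt.const_mul (Real.exp (-(z.re * t)) *
    (C * (1 + t) ^ n) / Real.Gamma (1 - α)))
    ((ae_restrict_iff' measurableSet_Ioo).2 (ae_of_all _ fun r hr => ?_))).trans ?_
  · have hτ : 0 < t - r := sub_pos.2 hr.2
    obtain ⟨h1, h2⟩ := norm_mul_expPow_sub_le hz hτ hα
    have h3 : ‖z * expPow z (t - r) α - ((t - r) ^ (-α) : ℝ)‖ ≤ kernelBound α ‖z‖⁻¹ (t - r) := by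
      unfold kernelBound
      split_ifs
      exacts [h1, h2]
    have h4 : ‖w r‖ ≤ C * (1 + t) ^ n := by
      refine (hw.2 r).trans ?_
      have := hr.1
      have := hr.2.le
      rw [abs_of_pos hr.1]
      gcongr
    rw [norm_smul]
    simp only [hκ]
    rw [norm_mul, norm_exp_neg_mul, norm_div, Complex.norm_real, Real.norm_of_nonneg hΓ.le]
    calc Real.exp (-(z.re * t)) *
          (‖z * expPow z (t - r) α - ((t - r) ^ (-α) : ℝ)‖ / Real.Gamma (1 - α)) * ‖w r‖
        ≤ Real.exp (-(z.re * t)) * (kernelBound α ‖z‖⁻¹ (t - r) / Real.Gamma (1 - α)) *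
          (C * (1 + t) ^ n) := by
          have := hbn _ hτ
          gcongr
      _ = _ := by ring
  · rw [integral_const_mul]
    calc _ ≤ Real.exp (-(z.re * t)) * (C * (1 + t) ^ n) / Real.Gamma (1 - α) *
          ((1 / (1 - α) + 2) * ‖z‖⁻¹ ^ (1 - α)) := by gcongr
      _ = _ := by ring

/-- The Laplace averages of `v` and of `z ^ α` times its fractional integral of order `α` agree up to
a controlled error. -/
theorem exists_norm_laplace_sub_le [CompleteSpace X] (n : ℕ) {α : ℝ} (hα : 0 < α) (hα1 : α ≤ 1) :
    ∃ K : ℝ, 0 ≤ K ∧ ∀ (v w : ℝ → X) (B C : ℝ), WBdd n v B → ContinuousOn v (Ici 0) → WBdd n w C →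
      (∀ t : ℝ, 0 ≤ t → w t = J α v t) → ∀ z : ℂ, 0 < z.re → ∀ t : ℝ, 0 ≤ t →
      ‖(∫ s in Ioi t, Complex.exp (-(z * s)) • v s)
        - z ^ (α : ℂ) • ∫ s in Ioi t, Complex.exp (-(z * s)) • w s‖
      ≤ Real.exp (-(z.re * t)) * (C * (1 + t) ^ n) * (K * ‖z‖⁻¹ ^ (1 - α)) := by
  rcases hα1.lt_or_eq with hα1 | rfl
  · refine ⟨(1 / (1 - α) + 2) / Real.Gamma (1 - α), ?_,
      fun v w B C hv hvc hw hvw z hz t ht => ?_⟩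
    · have h1 : 0 < 1 - α := by linarith
      have := Real.Gamma_pos_of_pos h1
      positivity
    refine norm_laplace_sub_le hα hα1 hv hvc hw (fun s hs => ?_) hz ht
    -- Applying `J (1 - α)` to `w = J α v` gives the primitive of `v`, so `v` is the fractional
    -- derivative of `w`.
    rw [← J_J (M := B * (1 + s) ^ n) hα hα1 hs hv.1.restrict fun r hr hrs => ?_]
    · refine intervalIntegral.integral_congr fun r hr => ?_
      rw [uIcc_of_le hs] at hr
      simp only [hvw r hr.1]
    · refine (hv.2 r).trans ?_
      have := hv.nonneg
      rw [abs_of_pos hr]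
      gcongr
  -- For `α = 1` there is no complementary kernel: `w` is the primitive of `v`, and the error is
  -- just the boundary term `exp (-zt) w t`.
  · refine ⟨1, zero_le_one, fun v w B C hv hvc hw hvw z hz t ht => ?_⟩
    have hJ : ∀ s : ℝ, 0 ≤ s → ∫ r in (0 : ℝ)..s, v r = w s := fun s hs => by
      rw [hvw s hs]
      simp [J, g]
    have h1 := laplace_primitive hv hvc hz ht ((hw.integrableOn_exp hz).congr_fun
      (fun s (hs : 0 < s) => by simp only [hJ s hs.le]) measurableSet_Ioi)
    have h2 : ∫ s in Ioi t, Complex.exp (-(z * s)) • (∫ r in (0 : ℝ)..s, v r)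
        = ∫ s in Ioi t, Complex.exp (-(z * s)) • w s :=
      setIntegral_congr_fun measurableSet_Ioi fun s (hs : t < s) => by
        simp only [hJ s (ht.trans hs.le)]
    rw [h1, h2, hJ t ht, Complex.ofReal_one, Complex.cpow_one, sub_sub_cancel_left, norm_neg,
      norm_smul, norm_exp_neg_mul, sub_self, Real.rpow_zero, mul_one, mul_one]
    have := hw.2 t
    rw [abs_of_nonneg ht] at this
    gcongr

/-! ### Resolvents, mild solutions and uniqueness -/

variable {A : X →ₗ.[ℂ] X} {α : ℝ} {S : ℝ → X →L[ℂ] X} {μ : ℂ} {R : X →L[ℂ] X}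

theorem J_congr {β : ℝ} {u v : ℝ → X} {t : ℝ} (ht : 0 ≤ t) (h : ∀ s, 0 ≤ s → s ≤ t → u s = v s) :
    J β u t = J β v t := by
  refine intervalIntegral.integral_congr fun s hs => ?_
  rw [uIcc_of_le ht] at hs
  simp only [h s hs.1 hs.2]

theorem intervalIntegrable_g_smul {β t : ℝ} (hβ : 0 < β) (ht : 0 ≤ t) {u : ℝ → X}
    (hu : ContinuousOn u (Ici 0)) :
    IntervalIntegrable (fun s => g β (t - s) • u s) volume 0 t := by
  have h1 : IntervalIntegrable (fun s => g β (t - s)) volume 0 t := by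
    simpa using (intervalIntegrable_g hβ t 0).comp_sub_left t
  refine h1.smul_continuousOn (hu.mono ?_)
  rw [uIcc_of_le ht]
  exact Icc_subset_Ici_self

theorem J_clm [CompleteSpace X] {β t : ℝ} (hβ : 0 < β) (ht : 0 ≤ t) {u : ℝ → X}
    (hu : ContinuousOn u (Ici 0)) (L : X →L[ℂ] X) : J β (fun s => L (u s)) t = L (J β u t) := by
  rw [J, J, ← ContinuousLinearMap.intervalIntegral_comp_comm L (intervalIntegrable_g_smul hβ ht hu)]
  refine intervalIntegral.integral_congr fun s _ => ?_
  rw [← Complex.coe_smul, ← Complex.coe_smul, map_smul]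

theorem J_sub {β t : ℝ} (hβ : 0 < β) (ht : 0 ≤ t) {u v : ℝ → X}
    (hu : ContinuousOn u (Ici 0)) (hv : ContinuousOn v (Ici 0)) :
    J β (fun s => u s - v s) t = J β u t - J β v t := by
  rw [J, J, J, ← intervalIntegral.integral_sub (intervalIntegrable_g_smul hβ ht hu)
    (intervalIntegrable_g_smul hβ ht hv)]
  simp only [smul_sub]

theorem J_smul_sub [CompleteSpace X] {β t : ℝ} (hβ : 0 < β) (ht : 0 ≤ t) {u : ℝ → X}
    (hu : ContinuousOn u (Ici 0)) (μ : ℂ) (R : X →L[ℂ] X) :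
    J β (fun s => μ • R (u s) - u s) t = μ • R (J β u t) - J β u t := by
  have h1 : ContinuousOn (fun s => (μ • R) (u s)) (Ici 0) :=
    (μ • R).continuous.comp_continuousOn hu
  exact (J_sub hβ ht h1 hu).trans (by rw [J_clm hβ ht hu]; rfl)

namespace IsInverse

/-- This replaces statements about the unbounded `A` by equations for the bounded operator `R`,
which pass through integrals. -/
theorem exists_eq (hR : IsInverse A μ R) {z b : X} (h : z = R (μ • z - b)) :
    ∃ hz : z ∈ A.domain, A ⟨z, hz⟩ = b := by
  obtain ⟨h1, h2⟩ := hR.2 (μ • z - b)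
  have h3 : ∀ (y : X) (hy : y ∈ A.domain), y = z → μ • y - A ⟨y, hy⟩ = μ • z - b →
      ∃ hz : z ∈ A.domain, A ⟨z, hz⟩ = b := by
    rintro y hy rfl h4
    exact ⟨hy, sub_right_injective h4⟩
  exact h3 _ h1 h.symm h2

theorem eq_of_mem (hR : IsInverse A μ R) {z : X} (hz : z ∈ A.domain) :
    z = R (μ • z - A ⟨z, hz⟩) := (hR.1 ⟨z, hz⟩).symm

theorem apply_range (hR : IsInverse A μ R) (y : X) :
    ∃ h : R y ∈ A.domain, A ⟨R y, h⟩ = μ • R y - y := by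
  obtain ⟨h1, h2⟩ := hR.2 y
  exact ⟨h1, (sub_sub_cancel _ _).symm.trans (congrArg (μ • R y - ·) h2)⟩

theorem injective (hR : IsInverse A μ R) {y : X} (h : R y = 0) : y = 0 := by
  obtain ⟨h1, h2⟩ := hR.2 y
  have h3 : A ⟨R y, h1⟩ = 0 := by
    rw [← A.map_zero]
    exact congrArg A (Subtype.ext h)
  rw [← h2, h3, h, smul_zero, sub_zero]

theorem eq {R' : X →L[ℂ] X} (hR : IsInverse A μ R) (hR' : IsInverse A μ R') : R = R' := by
  ext y
  obtain ⟨h1, h2⟩ := hR'.2 y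
  rw [hR.eq_of_mem h1, h2]

theorem resolvent_eq (hR : IsInverse A μ R) : resolvent A μ = R := by
  have h : ∃ R : X →L[ℂ] X, IsInverse A μ R := ⟨R, hR⟩
  rw [resolvent, dif_pos h]
  exact h.choose_spec.eq hR

end IsInverse

namespace IsResolventFamily

/-- The resolvent family commutes with the resolvent of the generator. -/
theorem comm (hS : IsResolventFamily A α S) (hR : IsInverse A μ R) {t : ℝ} (ht : 0 ≤ t) (y : X) :
    S t (R y) = R (S t y) := by
  obtain ⟨h1, h2⟩ := hR.apply_range y
  obtain ⟨h3, h4⟩ := hS.commutes t ht ⟨R y, h1⟩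
  have h5 := hR.eq_of_mem h3
  rw [h4, h2] at h5
  simp only [map_sub, map_smul] at h5
  rw [h5]
  simp

theorem apply_range (hS : IsResolventFamily A α S) (hR : IsInverse A μ R) {t : ℝ} (ht : 0 ≤ t)
    (y : X) : S t (R y) = R y + J α (fun s => S s (μ • R y - y)) t := by
  obtain ⟨h1, h2⟩ := hR.apply_range y
  obtain ⟨-, v, hv, -, h3⟩ := hS.solution ⟨R y, h1⟩
  have h3 := h3 t ht
  simp only [hS.map_zero, ContinuousLinearMap.id_apply] at h3
  rw [h3]
  congr 1
  refine J_congr ht fun s hs _ => ?_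
  obtain ⟨h4, h5⟩ := hv s hs
  obtain ⟨h6, h7⟩ := hS.commutes s hs ⟨R y, h1⟩
  rw [h5, h7, h2]

/-- Apply `R` to the orbit of `y`: as `R y` lies in the domain, its orbit satisfies the integrated
equation with `A R = μ R - 1`. Commuting `R` past `S` and `J` and solving for `J α (S y)` gives the
form required by `exists_eq`. -/
theorem isMildSolution [CompleteSpace X] (hα : 0 < α) (hS : IsResolventFamily A α S)
    (hR : IsInverse A μ R) (y : X) : IsMildSolution A α fun t => S t y := by
  have hc := hS.strongly_continuous y
  refine ⟨hc, fun t ht => ?_⟩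
  have h1 : J α (fun s => S s y) t = R (μ • J α (fun s => S s y) t - (S t y - y)) := by
    have h2 := hS.apply_range hR ht y
    rw [hS.comm hR ht] at h2
    have h3 : J α (fun s => S s (μ • R y - y)) t
        = μ • R (J α (fun s => S s y) t) - J α (fun s => S s y) t := by
      rw [← J_smul_sub hα ht hc]
      refine J_congr ht fun s hs _ => ?_
      simp only [map_sub, map_smul, hS.comm hR hs]
    rw [h3] at h2
    simp only [map_sub, map_smul]
    rw [h2]
    abel
  obtain ⟨h2, h3⟩ := hR.exists_eq h1
  refine ⟨h2, ?_⟩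
  rw [h3]
  simp [hS.map_zero]

/-- Joint continuity of `(t, x) ↦ S t x`. -/
theorem continuousOn_apply {Y : Type*} [TopologicalSpace Y] (hS : IsResolventFamily A α S)
    {n : ℕ} {C : ℝ} (hb : ∀ t : ℝ, 0 ≤ t → ‖S t‖ ≤ C * (1 + t) ^ n) {φ : Y → ℝ} {f : Y → X}
    {s : Set Y} (hφ : ContinuousOn φ s) (hφ0 : MapsTo φ s (Ici 0)) (hf : ContinuousOn f s) :
    ContinuousOn (fun p => S (φ p) (f p)) s := by
  intro p hp
  rw [ContinuousWithinAt, tendsto_iff_norm_sub_tendsto_zero]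
  have h1 : Tendsto (fun q => ‖S (φ q) (f p) - S (φ p) (f p)‖) (𝓝[s] p) (𝓝 0) :=
    tendsto_iff_norm_sub_tendsto_zero.1
      (((hS.strongly_continuous (f p)).comp hφ hφ0) p hp)
  have h2 : Tendsto (fun q => C * (1 + φ q) ^ n * ‖f q - f p‖) (𝓝[s] p) (𝓝 0) := by
    have h3 : Tendsto (fun q => C * (1 + φ q) ^ n) (𝓝[s] p) (𝓝 (C * (1 + φ p) ^ n)) :=
      ((tendsto_const_nhds.add (hφ p hp)).pow n).const_mul C
    simpa using h3.mul (tendsto_iff_norm_sub_tendsto_zero.1 (hf p hp))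
  have h3 := h2.add h1
  rw [add_zero] at h3
  refine squeeze_zero' (Eventually.of_forall fun q => norm_nonneg _) ?_ h3
  filter_upwards [self_mem_nhdsWithin] with q hq
  calc ‖S (φ q) (f q) - S (φ p) (f p)‖
      = ‖S (φ q) (f q - f p) + (S (φ q) (f p) - S (φ p) (f p))‖ := by
        rw [map_sub]
        congr 1
        abel
    _ ≤ _ := (norm_add_le _ _).trans (add_le_add_left
        (((S (φ q)).le_opNorm _).trans (by have := hb (φ q) (hφ0 hq); gcongr)) _)

/-- Mild solutions with vanishing initial value vanish. -/
theorem eq_zero_of_J [CompleteSpace X] (hα : 0 < α) (hS : IsResolventFamily A α S)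
    (hR : IsInverse A μ R) {n : ℕ} {C : ℝ} (hb : ∀ t : ℝ, 0 ≤ t → ‖S t‖ ≤ C * (1 + t) ^ n)
    {w : ℝ → X} (hw : ContinuousOn w (Ici 0))
    (hwJ : ∀ t : ℝ, 0 ≤ t → R (w t) = J α (fun s => μ • R (w s) - w s) t) {t : ℝ} (ht : 0 < t) :
    w t = 0 := by
  set b : ℝ → X := fun s => μ • R (w s) - w s with hbdef
  have hRw : ContinuousOn (fun s => R (w s)) (Ici 0) := R.continuous.comp_continuousOn hw
  have hbc : ContinuousOn b (Ici 0) := (hRw.const_smul μ).sub hw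
  have hC : 0 ≤ C := by simpa using (norm_nonneg _).trans (hb 0 le_rfl)
  -- The convolution of `S` with `R w` is computed twice, expanding `S (t - r) (R (w r))` by the
  -- equation for `S` and `R (w (t - q))` by that for `w`. The double integrals agree by
  -- `integral_gz_triangle`, and only the primitive of `R w` is left over.
  have key : ∀ t : ℝ, 0 ≤ t → ∫ r in (0 : ℝ)..t, R (w r) = 0 := by
    intro t ht
    obtain ⟨M, hM⟩ := (isCompact_Icc (a := (0 : ℝ)) (b := t)).exists_bound_of_continuousOn
      (hbc.mono Icc_subset_Ici_self)
    have hswap := integral_gz_triangle (β := α) (t := t) (Φ := fun q r => S q (b r))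
      (a := fun q => C * (1 + q) ^ n * M) hα ?_ ?_ ?_
    · have hK : ContinuousOn (fun r => S (t - r) (R (w r))) (Icc 0 t) :=
        hS.continuousOn_apply hb (by fun_prop) (fun r hr => sub_nonneg.2 hr.2)
          (hRw.mono Icc_subset_Ici_self)
      have h1 : ∀ r ∈ Icc 0 t, S (t - r) (R (w r))
          = R (w r) + ∫ q in Ioc 0 t, gz α (t - r - q) • S q (b r) := by
        intro r hr
        rw [hS.apply_range hR (sub_nonneg.2 hr.2), J_eq_setIntegral (sub_nonneg.2 hr.2)
          measurableSet_Ioc (fun q hq => ⟨hq.1, by linarith [hq.2, hr.1]⟩) Ioc_subset_Ioi_self]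
      have h2 : ∀ q ∈ Icc 0 t, S q (R (w (t - q)))
          = ∫ r in Ioc 0 t, gz α (t - q - r) • S q (b r) := by
        intro q hq
        have hq' := sub_nonneg.2 hq.2
        have hsub : Ioo 0 (t - q) ⊆ Ioc 0 t := fun r hr => ⟨hr.1, by linarith [hr.2, hq.1]⟩
        rw [hwJ _ hq', ← J_clm hα hq' hbc, J_eq_setIntegral hq'
          measurableSet_Ioc hsub Ioc_subset_Ioi_self]
      have h3 : ∫ r in (0 : ℝ)..t, S (t - r) (R (w r)) = ∫ q in (0 : ℝ)..t, S q (R (w (t - q))) := by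
        have := intervalIntegral.integral_comp_sub_left (a := 0) (b := t)
          (fun q => S q (R (w (t - q)))) t
        simpa using this
      rw [intervalIntegral.integral_of_le ht, intervalIntegral.integral_of_le ht,
        setIntegral_congr_fun measurableSet_Ioc fun q hq => h2 q (Ioc_subset_Icc_self hq),
        hswap] at h3
      have i1 : IntegrableOn (fun r => R (w r)) (Ioc 0 t) :=
        (hRw.mono Icc_subset_Ici_self).integrableOn_Icc.mono_set Ioc_subset_Icc_self
      have i2 : IntegrableOn (fun r => S (t - r) (R (w r))) (Ioc 0 t) :=
        hK.integrableOn_Icc.mono_set Ioc_subset_Icc_self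
      have h4 : ∫ r in Ioc 0 t, (S (t - r) (R (w r)) - R (w r))
          = ∫ r in Ioc 0 t, ∫ q in Ioc 0 t, gz α (t - r - q) • S q (b r) :=
        setIntegral_congr_fun measurableSet_Ioc fun r hr => by
          simp only [h1 r (Ioc_subset_Icc_self hr), add_sub_cancel_left]
      rw [integral_sub i2 i1, h3, sub_eq_self] at h4
      rwa [intervalIntegral.integral_of_le ht]
    · rw [Measure.prod_restrict]
      refine ContinuousOn.aestronglyMeasurable ?_ (measurableSet_Ioc.prod measurableSet_Ioc)
      exact hS.continuousOn_apply hb (by fun_prop) (fun p hp => hp.1.1.le)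
        (hbc.comp (by fun_prop) fun p hp => hp.2.1.le)
    · exact (Continuous.continuousOn (by fun_prop)).integrableOn_Icc.mono_set Ioc_subset_Icc_self
    · intro q hq r hr
      have h1 := hM r (Ioc_subset_Icc_self hr)
      have h2 := hb q hq.1.le
      have := hq.1
      exact ((S q).le_opNorm _).trans (by gcongr)
  refine hR.injective ?_
  have h1 : HasDerivAt (fun s => ∫ r in (0 : ℝ)..s, R (w r)) (R (w t)) t := by
    refine intervalIntegral.integral_hasDerivAt_right
      ((hRw.mono Icc_subset_Ici_self).intervalIntegrable_of_Icc ht.le) ?_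
      (hRw.continuousAt (Ici_mem_nhds ht))
    exact (hRw.mono Ioi_subset_Ici_self).stronglyMeasurableAtFilter isOpen_Ioi t ht
  have h2 : (fun s => ∫ r in (0 : ℝ)..s, R (w r)) =ᶠ[𝓝 t] fun _ => 0 := by
    filter_upwards [Ici_mem_nhds ht] with s hs using key s hs
  exact (h1.congr_of_eventuallyEq h2.symm).unique (hasDerivAt_const t 0)

theorem eq_of_isMildSolution [CompleteSpace X] (hα : 0 < α) (hS : IsResolventFamily A α S)
    (hR : IsInverse A μ R) {n : ℕ} {C : ℝ} (hb : ∀ t : ℝ, 0 ≤ t → ‖S t‖ ≤ C * (1 + t) ^ n)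
    {u : ℝ → X} (hu : IsMildSolution A α u) {t : ℝ} (ht : 0 ≤ t) : u t = S t (u 0) := by
  rcases ht.eq_or_lt with rfl | ht
  · rw [hS.map_zero]
    simp
  have hrange : ∀ {f : ℝ → X}, IsMildSolution A α f → ∀ s : ℝ, 0 ≤ s →
      R (f s) = R (f 0) + (μ • R (J α f s) - J α f s) := by
    intro f hf s hs
    obtain ⟨h1, h2⟩ := hf.2 s hs
    have h3 := hR.eq_of_mem h1
    rw [← sub_eq_iff_eq_add] at h2
    rw [← h2] at h3
    simp only [map_sub, map_smul] at h3
    nth_rewrite 2 [h3]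
    abel
  have hm := hS.isMildSolution hα hR (u 0)
  -- The difference of the two mild solutions has initial value zero; applying `R` puts its equation
  -- into the form used by `eq_zero_of_J`.
  have hwc : ContinuousOn (fun s => u s - S s (u 0)) (Ici 0) := hu.1.sub hm.1
  refine sub_eq_zero.1 (hS.eq_zero_of_J hα hR hb hwc (fun s hs => ?_) ht)
  have h1 := hrange hu s hs
  have h2 := hrange hm s hs
  rw [J_smul_sub hα hs hwc, J_sub hα hs hu.1 hm.1, map_sub, h1, h2, hS.map_zero]
  simp only [ContinuousLinearMap.id_apply, map_sub, smul_sub]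
  abel

end IsResolventFamily

/-! ### Density of the domain, growth and uniform continuity of orbits -/

variable {n : ℕ} {C : ℝ}

namespace IsResolventFamily

/-- The domain of the generator is dense. -/
theorem exists_range_near [CompleteSpace X] (hα : 0 < α) (hS : IsResolventFamily A α S)
    (hR : IsInverse A μ R) (x : X) {ε : ℝ} (hε : 0 < ε) : ∃ y : X, ‖x - R y‖ ≤ ε := by
  have hc := hS.strongly_continuous x
  have h1 := Metric.continuousWithinAt_iff.1 (hc 0 (mem_Ici.2 le_rfl)) ε hε
  obtain ⟨δ, hδ, h1⟩ := h1
  simp only [hS.map_zero, ContinuousLinearMap.id_apply, dist_eq_norm, mem_Ici] at h1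
  set t : ℝ := δ / 2 with ht
  have ht0 : 0 < t := by positivity
  -- This is the mass of the kernel on `[0, t]`, so `J α (S x) t / c` is a weighted mean of `S s x`
  -- over small `s`. It lies in the domain and is close to `x`.
  set c : ℝ := t ^ α / Real.Gamma (α + 1) with hcdef
  have hc0 : 0 < c := by positivity
  obtain ⟨h2, -⟩ := (hS.isMildSolution hα hR x).2 t ht0.le
  have h3 := hR.eq_of_mem h2
  have h4 : ‖J α (fun s => S s x - x) t‖ ≤ ε * c := by
    refine norm_J_le hα ht0.le fun s hs hst => (h1 (x := s) hs.le ?_).le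
    rw [sub_zero, Real.norm_of_nonneg hs.le]
    linarith
  have h5 : J α (fun _ : ℝ => x) t = c • x := by
    rw [J, intervalIntegral.integral_smul_const, intervalIntegral.integral_comp_sub_left (g α) t,
      sub_self, sub_zero, integral_g hα]
  rw [J_sub hα ht0.le hc continuousOn_const, h5] at h4
  refine ⟨(c⁻¹ : ℂ) • (μ • J α (fun t => S t x) t - A ⟨J α (fun t => S t x) t, h2⟩), ?_⟩
  rw [map_smul, ← h3, norm_sub_rev]
  have h6 : (c⁻¹ : ℂ) • J α (fun t => S t x) t - x
      = (c⁻¹ : ℂ) • (J α (fun t => S t x) t - c • x) := by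
    have : (c : ℂ) ≠ 0 := Complex.ofReal_ne_zero.2 hc0.ne'
    rw [smul_sub, ← Complex.coe_smul c, smul_smul, inv_mul_cancel₀ this, one_smul]
  rw [h6, norm_smul, norm_inv, Complex.norm_real, Real.norm_of_nonneg hc0.le,
    inv_mul_le_iff₀ hc0, mul_comm]
  exact h4

/-- On the range of `R` an orbit is a constant plus a fractional integral, so its modulus of
continuity is of order `h ^ α` relative to the weight. Density and the uniform growth bound extend
uniform continuity to every `x`. -/
theorem memBUC [CompleteSpace X] (hα : 0 < α) (hα1 : α ≤ 1) (hS : IsResolventFamily A α S)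
    (hR : IsInverse A μ R) (hb : ∀ t : ℝ, 0 ≤ t → ‖S t‖ ≤ C * (1 + t) ^ n) (x : X) :
    MemBUC n fun t => S t x := by
  have hC : 0 ≤ C := by simpa using (norm_nonneg _).trans (hb 0 le_rfl)
  have hbx : ∀ (x : X) (t : ℝ), 0 ≤ t → ‖S t x‖ ≤ C * ‖x‖ * (1 + t) ^ n := fun x t ht =>
    calc ‖S t x‖ ≤ ‖S t‖ * ‖x‖ := (S t).le_opNorm x
      _ ≤ C * (1 + t) ^ n * ‖x‖ := by have := hb t ht; gcongr
      _ = _ := by ring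
  have hw : ∀ {t h : ℝ}, 0 ≤ t → h ≤ 1 → ∀ s, 0 ≤ s → s ≤ t + h →
      (1 + s) ^ n ≤ 2 ^ n * (1 + t) ^ n := fun {t h} ht hh s hs hsh => by
    rw [← mul_pow]
    exact pow_le_pow_left₀ (by linarith) (by linarith) n
  refine ⟨hS.strongly_continuous x, ⟨C * ‖x‖, fun t ht => ?_⟩, fun ε hε => ?_⟩
  · rw [div_le_iff₀ (by positivity)]
    exact hbx x t ht
  -- For `h ≤ 1` one has `1 + t + h ≤ 2 * (1 + t)`, whence the factor `2 ^ n`.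
  set K : ℝ := C * 2 ^ n with hK
  have hK0 : 0 ≤ K := by positivity
  obtain ⟨y, hy⟩ := hS.exists_range_near hα hR x (show 0 < ε / (4 * (K + C + 1)) by positivity)
  set b : X := μ • R y - y with hbdef
  have hlim : Tendsto (fun h : ℝ => K * ‖b‖ * (2 * (h ^ α / Real.Gamma (α + 1)))) (𝓝 0) (𝓝 0) := by
    have h1 : Tendsto (fun h : ℝ => h ^ α) (𝓝 0) (𝓝 0) := by
      have := (Real.continuousAt_rpow_const 0 α (Or.inr hα.le)).tendsto
      rwa [Real.zero_rpow hα.ne'] at this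
    simpa using ((h1.div_const (Real.Gamma (α + 1))).const_mul 2).const_mul (K * ‖b‖)
  obtain ⟨δ, hδ, h1⟩ := Metric.eventually_nhds_iff.1
    (hlim.eventually_lt_const (show 0 < ε / 2 by positivity))
  refine ⟨min δ 1, by positivity, fun h hh hhδ t ht => ?_⟩
  have hh1 : h ≤ 1 := (hhδ.trans_le (min_le_right _ _)).le
  have h2 := h1 (y := h) (by
    rw [dist_zero_right, Real.norm_of_nonneg hh.le]
    exact hhδ.trans_le (min_le_left _ _))
  rw [div_le_iff₀ (by positivity)]
  have hth : 0 ≤ t + h := by linarith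
  have h3 : ‖S (t + h) (R y) - S t (R y)‖
      ≤ K * ‖b‖ * (1 + t) ^ n * (2 * (h ^ α / Real.Gamma (α + 1))) := by
    rw [hS.apply_range hR hth, hS.apply_range hR ht, add_sub_add_left_eq_sub]
    refine norm_J_sub_le hα hα1 ht hh.le (((hS.strongly_continuous b).mono fun s hs =>
      (le_of_lt hs.1 : (0 : ℝ) ≤ s)).aestronglyMeasurable measurableSet_Ioc) (fun s hs hst => ?_)
      (by positivity)
    calc ‖S s b‖ ≤ C * ‖b‖ * (1 + s) ^ n := hbx b s hs.le
      _ ≤ C * ‖b‖ * (2 ^ n * (1 + t) ^ n) := by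
        have := hw ht hh1 s hs.le hst
        gcongr
      _ = _ := by ring
  have h4 : ‖S (t + h) (x - R y)‖ ≤ K * ‖x - R y‖ * (1 + t) ^ n :=
    calc ‖S (t + h) (x - R y)‖ ≤ C * ‖x - R y‖ * (1 + (t + h)) ^ n := hbx _ _ hth
      _ ≤ C * ‖x - R y‖ * (2 ^ n * (1 + t) ^ n) := by
        have := hw ht hh1 (t + h) hth le_rfl
        gcongr
      _ = _ := by ring
  have h5 := hbx (x - R y) t ht
  have h6 : S (t + h) x - S t x
      = S (t + h) (x - R y) - S t (x - R y) + (S (t + h) (R y) - S t (R y)) := by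
    simp only [map_sub]
    abel
  have h7 : (K + C) * ‖x - R y‖ ≤ ε / 4 := by
    calc (K + C) * ‖x - R y‖ ≤ (K + C + 1) * (ε / (4 * (K + C + 1))) := by
          exact mul_le_mul (by linarith) hy (norm_nonneg _) (by positivity)
      _ = ε / 4 := by
          field_simp
  rw [h6]
  calc _ ≤ ‖S (t + h) (x - R y)‖ + ‖S t (x - R y)‖ + ‖S (t + h) (R y) - S t (R y)‖ :=
        (norm_add_le _ _).trans (add_le_add_left (norm_sub_le _ _) _)
    _ ≤ K * ‖x - R y‖ * (1 + t) ^ n + C * ‖x - R y‖ * (1 + t) ^ n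
        + K * ‖b‖ * (1 + t) ^ n * (2 * (h ^ α / Real.Gamma (α + 1))) := by gcongr
    _ = ((K + C) * ‖x - R y‖ + K * ‖b‖ * (2 * (h ^ α / Real.Gamma (α + 1)))) * (1 + t) ^ n := by
        ring
    _ ≤ (ε / 4 + ε / 2) * (1 + t) ^ n := by gcongr
    _ ≤ ε * (1 + t) ^ n := by
        gcongr
        linarith

end IsResolventFamily

/-! ### The Laplace transform of an orbit -/

/-- The orbit of `x`, extended by zero to the negative half-line. -/
def orbit (S : ℝ → X →L[ℂ] X) (x : X) : ℝ → X := (Ici (0 : ℝ)).indicator fun t => S t x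

theorem orbit_of_nonneg {x : X} {t : ℝ} (ht : 0 ≤ t) : orbit S x t = S t x :=
  indicator_of_mem (mem_Ici.2 ht) _

theorem orbit_of_neg {x : X} {t : ℝ} (ht : t < 0) : orbit S x t = 0 :=
  indicator_of_notMem (by simpa using ht) _

namespace IsResolventFamily

theorem continuousOn_orbit (hS : IsResolventFamily A α S) (x : X) :
    ContinuousOn (orbit S x) (Ici 0) :=
  (hS.strongly_continuous x).congr fun _ ht => orbit_of_nonneg ht

theorem wbdd_orbit (hS : IsResolventFamily A α S)
    (hb : ∀ t : ℝ, 0 ≤ t → ‖S t‖ ≤ C * (1 + t) ^ n) (x : X) : WBdd n (orbit S x) (C * ‖x‖) := by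
  have hC : 0 ≤ C := by simpa using (norm_nonneg _).trans (hb 0 le_rfl)
  refine ⟨(aestronglyMeasurable_indicator_iff measurableSet_Ici).2
    ((hS.strongly_continuous x).aestronglyMeasurable measurableSet_Ici), fun t => ?_⟩
  rcases lt_or_ge t 0 with ht | ht
  · rw [orbit_of_neg ht, norm_zero]
    positivity
  · rw [orbit_of_nonneg ht, abs_of_nonneg ht]
    calc ‖S t x‖ ≤ ‖S t‖ * ‖x‖ := (S t).le_opNorm x
      _ ≤ C * (1 + t) ^ n * ‖x‖ := by have := hb t ht; gcongr
      _ = _ := by ring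

/-- The Laplace transform of the resolvent family, as a bounded operator. -/
theorem exists_laplace_clm (hS : IsResolventFamily A α S)
    (hb : ∀ t : ℝ, 0 ≤ t → ‖S t‖ ≤ C * (1 + t) ^ n) {z : ℂ} (hz : 0 < z.re) :
    ∃ L : X →L[ℂ] X, ∀ x, L x = laplace (orbit S x) z := by
  have hi := fun x => (hS.wbdd_orbit hb x).integrableOn_exp hz
  have hadd : ∀ x y : X, orbit S (x + y) = orbit S x + orbit S y := fun x y => by
    simp only [orbit, map_add]
    exact indicator_add _ _ _
  have hsmul : ∀ (c : ℂ) (x : X), orbit S (c • x) = c • orbit S x := fun c x => by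
    simp only [orbit, map_smul]
    exact indicator_const_smul _ _ _
  refine ⟨LinearMap.mkContinuous ⟨⟨fun x => laplace (orbit S x) z, fun x y => ?_⟩, fun c x => ?_⟩
    (C * ∫ s in Ioi (0 : ℝ), (1 + s) ^ n * Real.exp (-(z.re * s))) fun x => ?_, fun x => rfl⟩
  · simp only [laplace]
    rw [hadd, ← integral_add (hi x) (hi y)]
    simp only [Pi.add_apply, smul_add]
  · simp only [laplace, RingHom.id_apply]
    rw [hsmul, ← integral_smul]
    simp only [Pi.smul_apply, smul_comm c]
  · change ‖∫ s in Ioi (0 : ℝ), Complex.exp (-(z * s)) • orbit S x s‖ ≤ _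
    rw [mul_right_comm, ← integral_const_mul]
    refine norm_integral_le_of_norm_le ((integrableOn_weight_mul_exp n hz).const_mul _)
      ((ae_restrict_iff' measurableSet_Ioi).2 (ae_of_all _ fun s (hs : 0 < s) => ?_))
    rw [norm_smul, norm_exp_neg_mul]
    have := (hS.wbdd_orbit hb x).2 s
    rw [abs_of_pos hs] at this
    calc Real.exp (-(z.re * s)) * ‖orbit S x s‖
        ≤ Real.exp (-(z.re * s)) * (C * ‖x‖ * (1 + s) ^ n) := by gcongr
      _ = _ := by ring

theorem laplace_const [CompleteSpace X] {z : ℂ} (hz : 0 < z.re) (x : X) {t : ℝ} :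
    IntegrableOn (fun s : ℝ => Complex.exp (-(z * s)) • x) (Ioi t) ∧
    ∫ s in Ioi t, Complex.exp (-(z * s)) • x = (Complex.exp (-(z * t)) / z) • x := by
  have h0 : (-z).re < 0 := by simpa using hz
  constructor
  · have := integrableOn_exp_mul_complex_Ioi h0 t
    simp only [neg_mul] at this
    exact this.smul_const x
  · have := integral_exp_mul_complex_Ioi h0 t
    simp only [neg_mul] at this
    rw [integral_smul_const, this, neg_div_neg_eq]

/-- The resolvent of the generator is given by the Laplace transform of the resolvent family. -/
theorem isInverse_laplace [CompleteSpace X] (hα : 0 < α) (hS : IsResolventFamily A α S)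
    (hR : IsInverse A μ R) (hb : ∀ t : ℝ, 0 ≤ t → ‖S t‖ ≤ C * (1 + t) ^ n) {z : ℂ}
    (hz : 0 < z.re) {L : X →L[ℂ] X} (hL : ∀ x, L x = laplace (orbit S x) z) :
    IsInverse A (z ^ (α : ℂ)) (z ^ (1 - (α : ℂ)) • L) := by
  have hz0 : z ≠ 0 := fun h => by simp [h] at hz
  have hi := fun x => (hS.wbdd_orbit hb x).integrableOn_exp hz
  have hcomm : ∀ x, L (R x) = R (L x) := fun x => by
    rw [hL, hL, laplace, laplace, ← ContinuousLinearMap.integral_comp_comm R (hi x)]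
    refine setIntegral_congr_fun measurableSet_Ioi fun s (hs : 0 < s) => ?_
    simp only [orbit_of_nonneg hs.le, hS.comm hR hs.le, map_smul]
  -- The Laplace transform of the resolvent equation on the range of `R`, where `J α` becomes
  -- multiplication by `z ^ (-α)`.
  have hrange : ∀ x, L (R x) = z⁻¹ • R x + z ^ (-(α : ℂ)) • (μ • L (R x) - L x) := fun x => by
    obtain ⟨i1, -, h1⟩ := integral_exp_J hα le_rfl hz (hS.wbdd_orbit hb (μ • R x - x))
    obtain ⟨i2, h2⟩ := laplace_const hz (R x) (t := 0)
    simp only [Ioc_self, Measure.restrict_empty, integral_zero_measure, add_zero] at h1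
    rw [← map_smul L, ← map_sub L, hL (μ • R x - x), laplace, ← h1,
      show z⁻¹ • R x = (Complex.exp (-(z * (0 : ℝ))) / z) • R x by simp, ← h2,
      ← integral_add i2 i1, hL, laplace]
    refine setIntegral_congr_fun measurableSet_Ioi fun s (hs : 0 < s) => ?_
    simp only [orbit_of_nonneg hs.le, hS.apply_range hR hs.le, smul_add]
    congr 2
    exact J_congr hs.le fun r hr _ => (orbit_of_nonneg hr).symm
  set a : ℂ := z ^ (α : ℂ) with ha
  set b : ℂ := z ^ (1 - (α : ℂ)) with hbdef
  have hab : b * a = z := by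
    rw [ha, hbdef, ← Complex.cpow_add _ _ hz0, sub_add_cancel, Complex.cpow_one]
  have ha0 : a ≠ 0 := by
    rw [ha, Complex.cpow_def_of_ne_zero hz0]
    exact Complex.exp_ne_zero _
  set T : X →L[ℂ] X := b • L with hT
  have hTR : ∀ x, T (R x) = R (T x) := fun x => by
    simp only [hT, smul_apply, hcomm, map_smul]
  -- Through `exists_eq` this says `(a - A) T x = x`; together with `T R = R T` it also makes `T` a
  -- left inverse.
  have h1 : ∀ x, T x = R (μ • T x - (a • T x - x)) := fun x => by
    have h2 := hrange x
    rw [hcomm, Complex.cpow_neg, ← ha] at h2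
    have h3 : R x = b • a • R (L x) - b • (μ • R (L x) - L x) := by
      have h4 : (b * a) • R (L x) = R x + b • (μ • R (L x) - L x) := by
        conv_lhs => rw [h2]
        rw [smul_add, smul_smul, smul_smul, mul_inv_cancel_right₀ ha0, hab,
          mul_inv_cancel₀ hz0, one_smul]
      rw [smul_smul, h4]
      abel
    simp only [hT, smul_apply, map_sub, map_smul]
    conv_rhs => rw [h3]
    simp only [smul_sub, smul_smul, mul_comm μ, mul_comm a]
    abel
  refine ⟨fun x => ?_, fun y => ?_⟩
  · obtain ⟨y, hy⟩ : ∃ y, (x : X) = R y := ⟨_, hR.eq_of_mem x.2⟩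
    obtain ⟨h2, h3⟩ := hR.apply_range y
    have h4 : A x = μ • R y - y := by
      rw [← h3]
      exact congrArg A (Subtype.ext hy)
    rw [h4, hy]
    have h5 := h1 y
    simp only [map_sub, map_smul, hTR] at h5 ⊢
    refine sub_eq_zero.1 (Eq.trans ?_ (sub_eq_zero.2 h5))
    module
  · obtain ⟨h2, h3⟩ := hR.exists_eq (h1 y)
    exact ⟨h2, by rw [h3, sub_sub_cancel]⟩

theorem laplace_orbit [CompleteSpace X] (hα : 0 < α) (hS : IsResolventFamily A α S)
    (hR : IsInverse A μ R) (hb : ∀ t : ℝ, 0 ≤ t → ‖S t‖ ≤ C * (1 + t) ^ n) {z : ℂ}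
    (hz : 0 < z.re) (x : X) :
    IsInverse A (z ^ (α : ℂ)) (resolvent A (z ^ (α : ℂ))) ∧
      laplace (orbit S x) z = fracResolvent A α z x := by
  have hz0 : z ≠ 0 := fun h => by simp [h] at hz
  obtain ⟨L, hL⟩ := hS.exists_laplace_clm hb hz
  have h1 := hS.isInverse_laplace hα hR hb hz hL
  rw [fracResolvent, h1.resolvent_eq]
  refine ⟨h1, ?_⟩
  rw [smul_smul, ← Complex.cpow_add _ _ hz0, ← hL]
  simp

end IsResolventFamily

/-! ### Abel means of orbits and ergodicity -/

/-- The kernel that turns convolutions into Laplace averages of translates. -/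
def abelKernel (η ζ : ℝ) : ℝ → ℂ :=
  (Iio (0 : ℝ)).indicator fun s => η * Complex.exp ((η + ζ * Complex.I) * s)

theorem integral_abelKernel_smul (η ζ : ℝ) (f : ℝ → X) :
    ∫ s, abelKernel η ζ s • f s
      = ∫ s in Ioi (0 : ℝ), ((η : ℂ) * Complex.exp (-((η + ζ * Complex.I) * s))) • f (-s) := by
  have h1 : (fun s => abelKernel η ζ s • f s) = (Iio (0 : ℝ)).indicator
      fun s : ℝ => ((η : ℂ) * Complex.exp ((η + ζ * Complex.I) * s)) • f s := by
    ext s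
    simp only [abelKernel, indicator]
    split_ifs
    · rfl
    · rw [zero_smul]
  rw [h1, integral_indicator measurableSet_Iio, ← integral_Iic_eq_integral_Iio]
  have := integral_comp_neg_Ioi (0 : ℝ)
    fun s : ℝ => ((η : ℂ) * Complex.exp ((η + ζ * Complex.I) * s)) • f s
  rw [neg_zero] at this
  rw [← this]
  simp

theorem ker_abelKernel (m : ℕ) {η : ℝ} (hη : 0 < η) (ζ : ℝ) : Ker m (abelKernel η ζ) := by
  have h1 := ((integrable_indicator_iff measurableSet_Ioi).2
    (integrableOn_weight_mul_exp m hη)).comp_neg.const_mul η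
  refine h1.mono' ?_ (ae_of_all _ fun s => ?_)
  · have h2 : Continuous fun s : ℝ => (1 + |s|) ^ m := by fun_prop
    have h3 : Continuous fun s : ℝ => (η : ℂ) * Complex.exp ((η + ζ * Complex.I) * s) := by fun_prop
    exact h2.aestronglyMeasurable.smul
      ((aestronglyMeasurable_indicator_iff measurableSet_Iio).2 h3.aestronglyMeasurable)
  · by_cases hs : s < 0
    · rw [abelKernel, indicator_of_mem (mem_Iio.2 hs),
        indicator_of_mem (mem_Ioi.2 (neg_pos.2 hs)), norm_smul, norm_mul, Complex.norm_exp,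
        Complex.norm_real, Real.norm_of_nonneg hη.le, Real.norm_of_nonneg (by positivity),
        abs_of_neg hs]
      simp only [Complex.mul_re, Complex.add_re, Complex.ofReal_re, Complex.I_re, mul_zero,
        Complex.ofReal_im, Complex.I_im, mul_one, sub_self, add_zero, Complex.add_im,
        Complex.mul_im, sub_zero, mul_neg, neg_neg]
      exact le_of_eq (by ring)
    · rw [abelKernel, indicator_of_notMem (by simpa using hs),
        indicator_of_notMem (by simpa using hs)]
      simp

theorem integral_abelKernel {η : ℝ} (hη : 0 < η) (ζ : ℝ) :
    ∫ s : ℝ, abelKernel η ζ s *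
      Complex.exp (-(2 * Real.pi * Complex.I * ((ζ / (2 * Real.pi) : ℝ) : ℂ) * s)) = 1 := by
  have h1 := integral_abelKernel_smul η ζ (fun s : ℝ =>
    Complex.exp (-(2 * Real.pi * Complex.I * ((ζ / (2 * Real.pi) : ℝ) : ℂ) * s)))
  simp only [smul_eq_mul] at h1
  rw [h1]
  have h2 : ∀ s : ℝ, (η : ℂ) * Complex.exp (-((η + ζ * Complex.I) * s)) *
      Complex.exp (-(2 * Real.pi * Complex.I * ((ζ / (2 * Real.pi) : ℝ) : ℂ) * (-s : ℝ)))
      = η * Complex.exp (-(η * s)) := by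
    intro s
    rw [mul_assoc, ← Complex.exp_add]
    congr 2
    push_cast
    field_simp
    ring
  have h0 : (-(η : ℂ)).re < 0 := by simpa using hη
  have h3 := integral_exp_mul_complex_Ioi h0 0
  simp only [h2, integral_const_mul]
  simp only [neg_mul] at h3
  rw [h3]
  have : (η : ℂ) ≠ 0 := Complex.ofReal_ne_zero.2 hη.ne'
  simp [this]

/-- The kernel lives on the negative half-line, so the convolution sees only values of `F` after
time `t`. -/
theorem conv_abelKernel (η ζ : ℝ) (F : ℝ → X) (t : ℝ) :
    conv (abelKernel η ζ) F t = (η * Complex.exp ((η + ζ * Complex.I) * t)) •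
      ∫ s in Ioi t, Complex.exp (-((η + ζ * Complex.I) * s)) • F s := by
  rw [conv, integral_abelKernel_smul η ζ fun s => F (t - s), ← integral_smul,
    ← setIntegral_Ioi_comp_add (fun s : ℝ => (η * Complex.exp ((η + ζ * Complex.I) * t)) •
      Complex.exp (-((η + ζ * Complex.I) * s)) • F s) t]
  refine integral_congr_ae (ae_of_all _ fun s => ?_)
  simp only [sub_neg_eq_add, smul_smul, mul_assoc]
  rw [← Complex.exp_add]
  congr 3
  push_cast
  ring_nf

namespace IsResolventFamily

/-- Laplace averages of translates of an orbit are controlled by the resolvent. -/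
theorem exists_norm_laplace_orbit_le [CompleteSpace X] (hα : 0 < α) (hα1 : α ≤ 1)
    (hS : IsResolventFamily A α S)
    (hR : IsInverse A μ R) (hb : ∀ t : ℝ, 0 ≤ t → ‖S t‖ ≤ C * (1 + t) ^ n) :
    ∃ M : ℝ, 0 ≤ M ∧ ∀ z : ℂ, 0 < z.re → ∀ (x : X) (t : ℝ), 0 ≤ t →
      ‖∫ s in Ioi t, Complex.exp (-(z * s)) • orbit S x s‖
        ≤ Real.exp (-(z.re * t)) * (M * ‖fracResolvent A α z x‖ * (1 + t) ^ n) := by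
  obtain ⟨K, hK, hKb⟩ := exists_norm_laplace_sub_le (X := X) n hα hα1
  have hC : 0 ≤ C := by simpa using (norm_nonneg _).trans (hb 0 le_rfl)
  refine ⟨(C + 1) * K + 1, by positivity, fun z hz x t ht => ?_⟩
  have hz0 : z ≠ 0 := fun h => by simp [h] at hz
  have hT := (hS.laplace_orbit hα hR hb hz x).1
  set a : ℂ := z ^ (α : ℂ) with ha
  set y : X := resolvent A a x with hy
  obtain ⟨h1, h2⟩ := hT.apply_range x
  set b : X := a • y - x with hbdef
  -- With `x = a y - b` and `b = A y`, the function `w = S y - y` is the fractional integral of `S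
  -- b`, and it is controlled by `‖y‖`.
  set w : ℝ → X := fun s => orbit S y s - (Ici (0 : ℝ)).indicator (fun _ => y) s with hw
  have hwb : WBdd n w ((C + 1) * ‖y‖) := by
    have h3 := hS.wbdd_orbit hb y
    refine ⟨h3.1.sub ((aestronglyMeasurable_indicator_iff measurableSet_Ici).2
      aestronglyMeasurable_const), fun s => (norm_sub_le _ _).trans ?_⟩
    have h4 : ‖(Ici (0 : ℝ)).indicator (fun _ => y) s‖ ≤ ‖y‖ * (1 + |s|) ^ n :=
      (norm_indicator_le_norm_self _ _).trans (le_mul_of_one_le_right (norm_nonneg _)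
        (one_le_pow₀ (by linarith [abs_nonneg s])))
    have := h3.2 s
    linarith
  have hwJ : ∀ s : ℝ, 0 ≤ s → w s = J α (orbit S b) s := by
    intro s hs
    simp only [hw, orbit_of_nonneg hs, indicator_of_mem (mem_Ici.2 hs)]
    rw [hS.apply_range hT hs, add_sub_cancel_left]
    exact J_congr hs fun r hr _ => (orbit_of_nonneg hr).symm
  have h3 := hKb (orbit S b) w _ _ (hS.wbdd_orbit hb b) (hS.continuousOn_orbit b) hwb hwJ z hz t ht
  have iv := ((hS.wbdd_orbit hb b).integrableOn_exp hz).mono_set (Ioi_subset_Ioi ht)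
  have iw := (hwb.integrableOn_exp hz).mono_set (Ioi_subset_Ioi ht)
  obtain ⟨ic, hc⟩ := laplace_const hz y (t := t)
  have h4 : ∫ s in Ioi t, Complex.exp (-(z * s)) • orbit S x s
      = a • ((∫ s in Ioi t, Complex.exp (-(z * s)) • w s)
        + ∫ s in Ioi t, Complex.exp (-(z * s)) • y)
        - ∫ s in Ioi t, Complex.exp (-(z * s)) • orbit S b s := by
    rw [← integral_add iw ic, ← integral_smul]
    refine Eq.trans ?_ (integral_sub ((iw.add ic).smul a) iv)
    refine setIntegral_congr_fun measurableSet_Ioi fun s (hs : t < s) => ?_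
    have hs0 : 0 ≤ s := ht.trans hs.le
    simp only [hw, hbdef, orbit_of_nonneg hs0, indicator_of_mem (mem_Ici.2 hs0), map_sub,
      map_smul]
    module
  have hnf : ‖fracResolvent A α z x‖ = ‖z‖⁻¹ ^ (1 - α) * ‖y‖ := by
    rw [fracResolvent, smul_apply, norm_smul, ← ha, ← hy]
    congr 1
    have h5 : ((α : ℂ) - 1) = ((α - 1 : ℝ) : ℂ) := by push_cast; rfl
    rw [h5, Complex.norm_cpow_real, Real.inv_rpow (norm_nonneg _), ← Real.rpow_neg (norm_nonneg _),
      neg_sub]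
  have h5 : ‖a • ∫ s in Ioi t, Complex.exp (-(z * s)) • y‖
      = Real.exp (-(z.re * t)) * ‖fracResolvent A α z x‖ := by
    rw [hc, hnf, smul_smul, norm_smul, norm_mul, norm_div, norm_exp_neg_mul, ha,
      Complex.norm_cpow_real]
    have h6 := norm_pos_iff.2 hz0
    have h7 : ‖z‖⁻¹ ^ (1 - α) = ‖z‖ ^ α / ‖z‖ := by
      rw [Real.inv_rpow h6.le, ← Real.rpow_neg h6.le, neg_sub, Real.rpow_sub h6, Real.rpow_one]
    rw [h7]
    ring
  -- The constant `y` contributes exactly `exp (-zt) z ^ (α - 1) y`, that is `exp (-zt) R_α(z, A)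
  -- x`; the bracket is the comparison error already estimated.
  have h8 : ∫ s in Ioi t, Complex.exp (-(z * s)) • orbit S x s
      = a • (∫ s in Ioi t, Complex.exp (-(z * s)) • y)
        - ((∫ s in Ioi t, Complex.exp (-(z * s)) • orbit S b s)
          - a • ∫ s in Ioi t, Complex.exp (-(z * s)) • w s) := by
    rw [h4, smul_add]
    abel
  rw [h8]
  refine (norm_sub_le _ _).trans ?_
  rw [h5]
  have h9 : (1 : ℝ) ≤ (1 + t) ^ n := one_le_pow₀ (by linarith)
  calc _ ≤ Real.exp (-(z.re * t)) * (‖fracResolvent A α z x‖ * (1 + t) ^ n)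
        + Real.exp (-(z.re * t)) * ((C + 1) * ‖y‖ * (1 + t) ^ n) * (K * ‖z‖⁻¹ ^ (1 - α)) := by
        refine add_le_add ?_ h3
        gcongr
        exact le_mul_of_one_le_right (norm_nonneg _) h9
    _ = _ := by
        rw [hnf]
        ring

/-- One sufficiently small `η` serves for all `t`: the factor `exp (ηt)` of the Abel mean cancels
the `exp (-ηt)` in the bound. The division by `2π` is the Fourier normalization. -/
theorem ergodicAt_orbit [CompleteSpace X] (hα : 0 < α) (hα1 : α ≤ 1)
    (hS : IsResolventFamily A α S)
    (hR : IsInverse A μ R) (hb : ∀ t : ℝ, 0 ≤ t → ‖S t‖ ≤ C * (1 + t) ^ n) {ζ : ℝ} {x : X}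
    (h : Tendsto (fun η : ℝ => (η : ℂ) • fracResolvent A α ((η : ℂ) + (ζ : ℂ) * Complex.I) x)
      (𝓝[>] (0 : ℝ)) (𝓝 0)) : ErgodicAt n (orbit S x) (ζ / (2 * Real.pi)) := by
  obtain ⟨M, hM, hMb⟩ := hS.exists_norm_laplace_orbit_le hα hα1 hR hb
  intro ε hε
  have h1 := (tendsto_zero_iff_norm_tendsto_zero.1 h).const_mul M
  rw [mul_zero] at h1
  obtain ⟨η, h2, hη⟩ := ((h1.eventually_lt_const hε).and self_mem_nhdsWithin).exists
  have hη : 0 < η := hη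
  refine ⟨abelKernel η ζ, ker_abelKernel _ hη ζ, integral_abelKernel hη ζ,
    AsympLE.of_bound fun t ht => ?_⟩
  have hre : ((η : ℂ) + (ζ : ℂ) * Complex.I).re = η := by simp
  have h3 := hMb _ (by rwa [hre]) x t ht
  rw [hre] at h3
  have h4 : ‖Complex.exp (((η : ℂ) + (ζ : ℂ) * Complex.I) * t)‖ = Real.exp (η * t) := by
    rw [Complex.norm_exp]
    simp
  rw [norm_smul, Complex.norm_real, Real.norm_of_nonneg hη.le] at h2
  rw [conv_abelKernel, norm_smul, norm_mul, h4, Complex.norm_real, Real.norm_of_nonneg hη.le]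
  calc _ ≤ η * Real.exp (η * t) * (Real.exp (-(η * t)) *
        (M * ‖fracResolvent A α ((η : ℂ) + (ζ : ℂ) * Complex.I) x‖ * (1 + t) ^ n)) := by gcongr
    _ = (Real.exp (η * t) * Real.exp (-(η * t))) *
        (M * (η * ‖fracResolvent A α ((η : ℂ) + (ζ : ℂ) * Complex.I) x‖)) * (1 + t) ^ n := by ring
    _ = (M * (η * ‖fracResolvent A α ((η : ℂ) + (ζ : ℂ) * Complex.I) x‖)) * (1 + t) ^ n := by
      rw [← Real.exp_add, add_neg_cancel, Real.exp_zero, one_mul]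
    _ ≤ ε * (1 + t) ^ n := by gcongr

end IsResolventFamily

/-! ### The Tauberian theorem applied to orbits -/

/-- At zero, the ergodicity condition is automatic if zero is a regular point. -/
theorem tendsto_fracResolvent_zero (hα : 0 < α) (h : (0 : ℂ) ∈ fracResolventSet A α) (x : X) :
    Tendsto (fun η : ℝ => (η : ℂ) • fracResolvent A α ((η : ℂ) + ((0 : ℝ) : ℂ) * Complex.I) x)
      (𝓝[>] (0 : ℝ)) (𝓝 0) := by
  have h1 : Tendsto (fun η : ℝ => resolvent A ((η : ℂ) ^ (α : ℂ)) x) (𝓝[>] (0 : ℝ))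
      (𝓝 (resolvent A ((0 : ℂ) ^ (α : ℂ)) x)) := by
    have h2 : Tendsto (fun η : ℝ => (η : ℂ)) (𝓝[>] (0 : ℝ)) (𝓝 0) := by
      have := (Complex.continuous_ofReal.tendsto 0).mono_left
        (nhdsWithin_le_nhds (s := Ioi (0 : ℝ)))
      simpa using this
    exact ((ContinuousLinearMap.apply ℂ X x).continuous.tendsto _).comp
      (h.2.continuousAt.tendsto.comp h2)
  have h2 : Tendsto (fun η : ℝ => ((η ^ α : ℝ) : ℂ)) (𝓝[>] (0 : ℝ)) (𝓝 0) := by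
    have h3 := (Real.continuousAt_rpow_const 0 α (Or.inr hα.le)).tendsto
    rw [Real.zero_rpow hα.ne'] at h3
    have := (Complex.continuous_ofReal.tendsto 0).comp
      (h3.mono_left (nhdsWithin_le_nhds (s := Ioi (0 : ℝ))))
    simpa [Function.comp_def] using this
  have h3 := h2.smul h1
  rw [zero_smul] at h3
  refine h3.congr' ?_
  filter_upwards [self_mem_nhdsWithin] with η (hη : 0 < η)
  have hη0 : (η : ℂ) ≠ 0 := Complex.ofReal_ne_zero.2 hη.ne'
  rw [Complex.ofReal_zero, zero_mul, add_zero, fracResolvent, smul_apply, smul_smul]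
  congr 1
  rw [Complex.cpow_sub _ _ hη0, Complex.cpow_one, mul_div_cancel₀ _ hη0, Complex.ofReal_cpow hη.le]

/-- Orbits are slowly oscillating at infinity. -/
theorem MemBUC.oscillation {x : X} (h : MemBUC n fun t => S t x) {ε : ℝ} (hε : 0 < ε) :
    ∃ d : ℝ, 0 < d ∧ ∀ s : ℝ, |s| < d →
      AsympLE n (fun t => orbit S x t - orbit S x (t - s)) ε := by
  obtain ⟨d, hd, h1⟩ := h.2.2 ε hε
  refine ⟨d, hd, fun s hs ε' hε' => ?_⟩
  filter_upwards [eventually_ge_atTop |s|] with t ht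
  have ht0 : 0 ≤ t := (abs_nonneg s).trans ht
  have hts : 0 ≤ t - s := sub_nonneg.2 ((le_abs_self s).trans ht)
  rw [orbit_of_nonneg ht0, orbit_of_nonneg hts]
  rcases lt_trichotomy s 0 with h0 | rfl | h0
  · have h2 := h1 (-s) (by linarith) (by rwa [← abs_of_neg h0]) t ht0
    rw [div_le_iff₀ (by positivity)] at h2
    rw [← sub_eq_add_neg] at h2
    rw [norm_sub_rev]
    refine h2.trans ?_
    gcongr
    linarith
  · rw [sub_zero, sub_self, norm_zero]
    positivity
  · have h2 := h1 s h0 (by rwa [← abs_of_pos h0]) (t - s) hts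
    rw [div_le_iff₀ (by positivity), sub_add_cancel] at h2
    refine h2.trans ?_
    gcongr
    · linarith
    · linarith

theorem IsResolventFamily.asympLE_orbit [CompleteSpace X] (hα : 0 < α) (hα1 : α ≤ 1)
    (hS : IsResolventFamily A α S) (hR : IsInverse A μ R)
    (hb : ∀ t : ℝ, 0 ≤ t → ‖S t‖ ≤ C * (1 + t) ^ n)
    (hcount : (fracSpectrum A α ∩ {z : ℂ | z.re = 0}).Countable)
    (herg : ∀ ζ : ℝ, (ζ : ℂ) * Complex.I ∈ fracSpectrum A α → ∀ x : X,
      Tendsto (fun η : ℝ => (η : ℂ) • fracResolvent A α ((η : ℂ) + (ζ : ℂ) * Complex.I) x)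
        (𝓝[>] (0 : ℝ)) (𝓝 0)) (x : X) : AsympLE n (orbit S x) 0 := by
  set φ : ℝ → ℂ := fun ξ => ((2 * Real.pi * ξ : ℝ) : ℂ) * Complex.I with hφ
  have hφ2 : ∀ ξ, φ ξ = 2 * Real.pi * Complex.I * ξ := fun ξ => by
    simp only [hφ]
    push_cast
    ring
  have hφinj : Function.Injective φ := fun a b hab => by
    have := Complex.ofReal_inj.1 (mul_right_cancel₀ Complex.I_ne_zero hab)
    exact mul_left_cancel₀ (by positivity) this
  -- Frequency `0` always joins the exceptional set: `z ^ (α - 1)` need not be continuous there,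
  -- even if the resolvent is. When `0` is a regular point of the resolvent, ergodicity is free
  -- because `η * η ^ (α - 1) = η ^ α → 0`.
  refine asympLE_zero_of_countable (E := {ξ | φ ξ ∈ fracSpectrum A α} ∪ {0})
    (hS.wbdd_orbit hb x) (fun t ht => orbit_of_neg ht)
    (fun ε hε => (hS.memBUC hα hα1 hR hb x).oscillation hε) ?_ (fun ξ hξ => ?_) fun ξ hξ => ?_
  · refine Countable.union ?_ (countable_singleton 0)
    refine (hcount.preimage_of_injOn hφinj.injOn).mono fun ξ hξ => ?_
    exact ⟨hξ, by simp [hφ]⟩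
  · have h1 : ξ = 2 * Real.pi * ξ / (2 * Real.pi) := by field_simp
    rw [h1]
    refine hS.ergodicAt_orbit hα hα1 hR hb ?_
    by_cases h2 : φ ξ ∈ fracSpectrum A α
    · exact herg _ h2 x
    · obtain rfl : ξ = 0 := hξ.resolve_left h2
      have h3 : (0 : ℂ) ∈ fracResolventSet A α := by
        have := not_not.1 h2
        simpa [hφ] using this
      simpa using tendsto_fracResolvent_zero hα h3 x
  · rw [mem_union, not_or] at hξ
    have h1 : φ ξ ∈ fracResolventSet A α := not_not.1 hξ.1
    have h0 : ξ ≠ 0 := hξ.2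
    -- Away from `0` the imaginary axis avoids the branch cut of the principal power.
    have h2 : φ ξ ∈ Complex.slitPlane := by
      rw [Complex.mem_slitPlane_iff]
      right
      simp [hφ, h0]
    rw [← hφ2]
    refine ⟨fun z => fracResolvent A α z x, ?_, Eventually.of_forall fun z hz =>
      (hS.laplace_orbit hα hR hb hz x).2⟩
    filter_upwards [h1.2.eventually_analyticAt, Complex.isOpen_slitPlane.mem_nhds h2] with z h3 h4
    have h5 : ContinuousAt (fun z : ℂ => z ^ ((α : ℂ) - 1)) z :=
      continuousAt_id.cpow continuousAt_const h4
    exact (ContinuousLinearMap.apply ℂ X x).continuous.continuousAt.comp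
      (h5.smul h3.continuousAt)

end FracEq

end

theorem mainTheorem2 {X : Type*} [NormedAddCommGroup X] [NormedSpace ℂ X] [CompleteSpace X]
    (α : ℝ) (hα0 : 0 < α) (hα1 : α ≤ 1) (n : ℕ)
    (A : X →ₗ.[ℂ] X) (hA : A.IsClosed)
    (S : ℝ → X →L[ℂ] X) (hS : FracEq.IsResolventFamily A α S)
    (hbound : ∃ C : ℝ, ∀ t : ℝ, 0 ≤ t → ‖S t‖ / (1 + t) ^ n ≤ C)
    (hcount : (FracEq.fracSpectrum A α ∩ {z : ℂ | z.re = 0}).Countable)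
    (hergodic : ∀ ζ : ℝ, (ζ : ℂ) * Complex.I ∈ FracEq.fracSpectrum A α → ∀ x : X,
      Tendsto (fun η : ℝ => (η : ℂ) • FracEq.fracResolvent A α ((η : ℂ) + (ζ : ℂ) * Complex.I) x)
        (𝓝[>] (0 : ℝ)) (𝓝 0)) :
    (∀ x₀ : X, FracEq.IsMildSolution A α (fun t => S t x₀)) ∧
    ∀ u : ℝ → X, FracEq.IsMildSolution A α u →
      (∀ t : ℝ, 0 ≤ t → u t = S t (u 0)) ∧
      FracEq.MemBUC n u ∧
      Tendsto (fun t : ℝ => ‖u t‖ / (1 + t) ^ n) atTop (𝓝 0) := by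
  obtain ⟨C, hC⟩ := hbound
  have hb : ∀ t : ℝ, 0 ≤ t → ‖S t‖ ≤ C * (1 + t) ^ n := fun t ht =>
    (div_le_iff₀ (by positivity)).1 (hC t ht)
  -- The imaginary axis is uncountable, so some point of it lies outside the spectrum and provides a
  -- resolvent to work with.
  obtain ⟨μ, R, hR⟩ : ∃ μ : ℂ, ∃ R : X →L[ℂ] X, FracEq.IsInverse A μ R := by
    have hinj : Function.Injective fun ζ : ℝ => (ζ : ℂ) * Complex.I := fun a b hab =>
      Complex.ofReal_inj.1 (mul_right_cancel₀ Complex.I_ne_zero hab)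
    obtain ⟨ζ, hζ⟩ : ∃ ζ : ℝ, (ζ : ℂ) * Complex.I ∉ FracEq.fracSpectrum A α := by
      by_contra! h
      have h1 : (univ : Set ℝ).Countable := by
        refine (hcount.preimage_of_injOn hinj.injOn).mono fun ζ _ => ?_
        exact ⟨h ζ, by simp⟩
      exact Cardinal.not_countable_real h1
    exact ⟨_, (not_not.1 hζ).1.self_of_nhds⟩
  refine ⟨fun x => hS.isMildSolution hα0 hR x, fun u hu => ?_⟩
  have heq : ∀ t : ℝ, 0 ≤ t → u t = S t (u 0) := fun t ht =>
    hS.eq_of_isMildSolution hα0 hR hb hu ht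
  refine ⟨heq, ?_, ?_⟩
  · obtain ⟨-, h2, h3⟩ := hS.memBUC hα0 hα1 hR hb (u 0)
    refine ⟨hu.1, ?_, fun ε hε => ?_⟩
    · obtain ⟨K, hK⟩ := h2
      exact ⟨K, fun t ht => by rw [heq t ht]; exact hK t ht⟩
    · obtain ⟨δ, hδ, h4⟩ := h3 ε hε
      refine ⟨δ, hδ, fun h hh hhδ t ht => ?_⟩
      rw [heq t ht, heq (t + h) (by linarith)]
      exact h4 h hh hhδ t ht
  · refine ((hS.asympLE_orbit hα0 hα1 hR hb hcount hergodic (u 0)).congr ?_).tendsto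
    filter_upwards [eventually_ge_atTop 0] with t ht
    rw [heq t ht, FracEq.orbit_of_nonneg ht]
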